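/- **Lifted graphs.** Let $T$ be a connected, locally connected metric space with an embedding $h\colon\mathbb R\to T$ (a homeomorphism onto its image) and a bijective isometry $\tau\colon T\to T$ such that: $\tau(h(x))=h(x+1)$ for all $x\in\mathbb R$; the closure of each connected component of $T\setminus h(\mathbb R)$ is a topological finite graph (a compact connected set $G$ containing a finite set $V$ such that $G\setminus V$ has finitely many connected components, each homeomorphic to an open interval) that meets $h(\mathbb R)$ in exactly one point; and only finitely many connected components $C$ of $T\setminus h(\mathbb R)$ satisfy $\overline C\cap h([0,1])\neq\emptyset$. Identify $h(\mathbb R)$ with $\mathbb R$, write $x+m$ for $\tau^m(x)$ ($m\in\mathbb Z$), and let $r_{\mathbb R}\colon T\to\mathbb R$ be the retraction that is the identity on $\mathbb R$ and sends each connected component $C$ of $T\setminus\mathbb R$ to the unique point of $\overline C\cap\mathbb R$. **Sun-like maps.** Let $F\colon T\to T$ be continuous of degree $1$, i.e. $F(x+1)=F(x)+1$ for all $x\in T$. Put $T_{\mathbb R}:=\overline{\bigcup_{n\ge 0}F^n(\mathbb R)}$ and $X:=\overline{T\setminus T_{\mathbb R}}\cap r_{\mathbb R}^{-1}([0,1))$.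 The branches $(X^i)_{i\in\Lambda}$ of $F$ are the closures of the connected components of $(T\setminus T_{\mathbb R})\cap r_{\mathbb R}^{-1}([0,1))$. The map $F$ is called sun-like if there are finitely many branches, closures of distinct components are disjoint, and each branch is an arc (homeomorphic to $[0,1]$) meeting $T_{\mathbb R}$ in exactly one point, which is an endpoint of the arc. Each branch is ordered so that this point is $\min X^i$. **Rotation numbers.** $\rho_F(x):=\lim_{n\to\infty}\frac{r_{\mathbb R}(F^n(x))-r_{\mathbb R}(x)}{n}$ when the limit exists, and $\mathrm{Rot}(F)$ is the set of all $\rho_F(x)$, $x\in T$. A point $x$ is periodic (mod 1) if $F^n(x)\in x+\mathbb Z$ for some $n\ge 1$. **Basic partitions.** A basic partition $\mathcal P$ of $X$ consists, for each $i\in\Lambda$, of an integer $N_i\ge 0$ and nonempty compact intervals $X^i_1<\dots<X^i_{N_i}$ in $X^i$, together with $\ell(A)\in\Lambda$ and $p(A)\in\mathbb Z$ for each $A=X^i_j$, such that $F(A)\subset (X^{\ell(A)}+p(A))\cup\mathrm{Int}(T_{\mathbb R})$, $F(\min A)=\min X^{\ell(A)}+p(A)$, and $F\bigl(X\setminus\bigcup_{i,j}X^i_j\bigr)\cap(X+\mathbb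 Z)=\emptyset$. **Covering graph.** For $A_0,\dots,A_n\in\mathcal P$ let $\langle A_0\dots A_n\rangle:=F^n(\{x\in T: F^i(x)\in A_i+\mathbb Z,\ 0\le i\le n\})\cap X$. Write $A_0\dots A_n\sim B_0\dots B_m$ if for some $0\le k\le\min(n,m)$ one has $A_{n-i}=B_{m-i}$ for $0\le i\le k$ and $\langle A_0\dots A_{n-k}\rangle=A_{n-k}=B_{m-k}=\langle B_0\dots B_{m-k}\rangle$. The covering graph $\mathcal G$ of $\mathcal P$ is the oriented graph whose vertices are the $\sim$-classes of words with $\langle A_0\dots A_n\rangle\ne\emptyset$, with an arrow from the class of $A_0\dots A_n$ to the class of $A_0\dots A_nA_{n+1}$ whenever both are vertices; this arrow has weight $p(A_n)$. The connected components of $\mathcal G$ are its maximal nonempty strongly connected subgraphs (any two vertices $u,v$, possibly equal, are joined by a path of positive length from $u$ to $v$ in the subgraph). For a connected component $C$, $\Gamma(C)$ is the set of infinite paths in $C$, and $\mathrm{Rot}(\Gamma(C))$ is the set of all limits $\lim_{n\to\infty} W_n/n$, where $W_n$ is the sum of the weights of the first $n$ arrows of a path in $\Gamma(C)$ for which this limit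 exists. **Theorem.** Let $F$ be a sun-like map of degree $1$ on $T$. Then $\mathrm{Rot}(F)$ is a nonempty compact set and has finitely many connected components. Moreover, a basic partition of $X$ exists, and for every basic partition $\mathcal P$, with covering graph $\mathcal G$, there is a finite set $E\subset\mathbb R$ with $$\#E\le 2\,\#\mathcal P\qquad\text{and}\qquad E\subset\bigcup_{C}\partial\,\mathrm{Rot}(\Gamma(C)),$$ where $C$ runs over the connected components of $\mathcal G$, such that for every rational number $p/q\in\mathrm{Rot}(F)\setminus E$ there is a periodic (mod 1) point $x\in T$ with $\rho_F(x)=p/q$. -/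

import Mathlib

open Set Filter Topology

noncomputable section

/-- A topological finite graph inside a metric space: a compact connected set `G` with a finite
subset `V` such that `G \ V` has finitely many connected components, each of them homeomorphic
to an open interval (equivalently, to `ℝ`). -/
def IsFiniteGraph {T : Type*} [MetricSpace T] (G : Set T) : Prop :=
  IsCompact G ∧ IsConnected G ∧
    ∃ V : Set T, V.Finite ∧ V ⊆ G ∧
      {C : Set T | ∃ x ∈ G \ V, C = connectedComponentIn (G \ V) x}.Finite ∧
      ∀ x ∈ G \ V, Nonempty (connectedComponentIn (G \ V) x ≃ₜ ℝ)

/-- The structure of a lifted graph on a metric space `T`: an embedded copy `h : ℝ → T` of the real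
line and a translation `τ` preserving the distance.  The connected components of `T \ h(ℝ)` are the
sets `connectedComponentIn (range h)ᶜ x` for `x ∉ range h`. -/
structure LiftedGraph (T : Type*) [MetricSpace T] where
  /-- the distinguished copy of the real line -/
  h : ℝ → T
  /-- the translation by one -/
  τ : T ≃ᵢ T
  isEmbedding_h : IsEmbedding h
  τ_h : ∀ x : ℝ, τ (h x) = h (x + 1)
  isFiniteGraph_closure : ∀ x ∉ range h,
    IsFiniteGraph (closure (connectedComponentIn (range h)ᶜ x))
  closure_inter : ∀ x ∉ range h,
    ∃ z : T, closure (connectedComponentIn (range h)ᶜ x) ∩ range h = {z}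
  finite_components :
    {C : Set T | (∃ x ∉ range h, C = connectedComponentIn (range h)ᶜ x) ∧
      (closure C ∩ h '' Icc 0 1).Nonempty}.Finite

namespace LiftedGraph

variable {T : Type*} [MetricSpace T] (L : LiftedGraph T)

/-- `h t` is the image of `x` under the natural retraction of `T` onto the line. -/
def IsRetractOf (x : T) (t : ℝ) : Prop :=
  (x ∈ range L.h ∧ L.h t = x) ∨
    (x ∉ range L.h ∧ closure (connectedComponentIn (range L.h)ᶜ x) ∩ range L.h = {L.h t})

theorem exists_isRetractOf (x : T) : ∃ t, L.IsRetractOf x t := by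
  by_cases hx : x ∈ range L.h
  · obtain ⟨t, ht⟩ := hx
    exact ⟨t, Or.inl ⟨⟨t, ht⟩, ht⟩⟩
  · obtain ⟨z, hz⟩ := L.closure_inter x hx
    have hz' : z ∈ closure (connectedComponentIn (range L.h)ᶜ x) ∩ range L.h := by
      rw [hz]; exact mem_singleton z
    obtain ⟨t, ht⟩ := hz'.2
    exact ⟨t, Or.inr ⟨hx, by rw [hz, ht]⟩⟩

theorem isRetractOf_unique {x : T} {s t : ℝ} (hs : L.IsRetractOf x s) (ht : L.IsRetractOf x t) :
    s = t := by
  apply L.isEmbedding_h.injective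
  rcases hs with ⟨hx, hs⟩ | ⟨hx, hs⟩ <;> rcases ht with ⟨hx', ht⟩ | ⟨hx', ht⟩
  · rw [hs, ht]
  · exact absurd hx hx'
  · exact absurd hx' hx
  · rw [hs] at ht
    exact singleton_eq_singleton_iff.mp ht

/-- The natural retraction of `T` onto the line, read as a real number. -/
def retr (x : T) : ℝ := (L.exists_isRetractOf x).choose

theorem retr_spec (x : T) : L.IsRetractOf x (L.retr x) := (L.exists_isRetractOf x).choose_spec

theorem retr_h (t : ℝ) : L.retr (L.h t) = t :=
  L.isRetractOf_unique (L.retr_spec _) (Or.inl ⟨⟨t, rfl⟩, rfl⟩)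

/-- The translate `S + m` of a set `S`. -/
def shift (m : ℤ) (S : Set T) : Set T := (fun x => (L.τ ^ m) x) '' S

/-- Continuous maps of degree one. -/
structure IsDegreeOne (F : T → T) : Prop where
  continuous : Continuous F
  map_add_one : ∀ x : T, F (L.τ x) = L.τ (F x)

/-- `x` is periodic (mod 1): some iterate `F^n x`, `n ≥ 1`, is an integer translate of `x`. -/
def IsPeriodicModOne (F : T → T) (x : T) : Prop :=
  ∃ n : ℕ, 0 < n ∧ ∃ m : ℤ, F^[n] x = (L.τ ^ m) x

/-- The rotation number of `x` exists and is equal to `ρ`. -/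
def HasRotationNumber (F : T → T) (x : T) (ρ : ℝ) : Prop :=
  Tendsto (fun n : ℕ => (L.retr (F^[n] x) - L.retr x) / (n : ℝ)) atTop (𝓝 ρ)

/-- The rotation set `Rot(F)` of all rotation numbers of points of `T`. -/
def Rot (F : T → T) : Set ℝ := {ρ | ∃ x : T, L.HasRotationNumber F x ρ}

/-- `T_ℝ`, the closure of the union of the iterates of the line. -/
def TR (F : T → T) : Set T := closure (⋃ n : ℕ, F^[n] '' range L.h)

/-- The set `X`: the part of the closure of `T \ T_ℝ` that retracts into `[0, 1)`. -/
def X (F : T → T) : Set T := closure (L.TR F)ᶜ ∩ L.retr ⁻¹' Ico 0 1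

/-- `(T \ T_ℝ) ∩ r⁻¹([0, 1))`. -/
def openX (F : T → T) : Set T := (L.TR F)ᶜ ∩ L.retr ⁻¹' Ico 0 1

/-- The branches of `F`: the closures of the connected components of
`(T \ T_ℝ) ∩ r⁻¹([0, 1))`. -/
def Branch (F : T → T) : Type _ :=
  {B : Set T // ∃ x ∈ L.openX F, B = closure (connectedComponentIn (L.openX F) x)}

/-- Sun-like maps of degree one: there are finitely many branches, each branch is an arc that meets
`T_ℝ` exactly in one of its endpoints, and the closures of different components are disjoint. -/
structure IsSunLike (F : T → T) : Prop extends L.IsDegreeOne F where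
  finite_branches : Finite (L.Branch F)
  exists_arc : ∀ B : L.Branch F, ∃ γ : unitInterval → T,
    Continuous γ ∧ Function.Injective γ ∧ range γ = B.1 ∧ B.1 ∩ L.TR F = {γ 0}
  disjoint_closure : ∀ x ∈ L.openX F, ∀ y ∈ L.openX F,
    connectedComponentIn (L.openX F) x ≠ connectedComponentIn (L.openX F) y →
      Disjoint (closure (connectedComponentIn (L.openX F) x))
        (closure (connectedComponentIn (L.openX F) y))

variable {L} {F : T → T}

/-- A parametrization by `[0, 1]` of the branch `i`, starting at `min X^i`, the point of the branch
that lies in `T_ℝ`.  The order it induces on the branch does not depend on its choice. -/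
def IsSunLike.arc (hF : L.IsSunLike F) (i : L.Branch F) : unitInterval → T :=
  (hF.exists_arc i).choose

/-- A basic partition of `X`: finitely many disjoint compact intervals
`X^i_j = [lo i j, hi i j]`, `1 ≤ j ≤ N i`, in increasing order in the branch `X^i` (in the
parametrization `arc i`), with labels `ℓ(X^i_j)` and `p(X^i_j)`. -/
structure BasicPartition (hF : L.IsSunLike F) where
  /-- the number of intervals in a branch -/
  N : L.Branch F → ℕ
  /-- the lower endpoint -/
  lo : (i : L.Branch F) → Fin (N i) → unitInterval
  /-- the upper endpoint -/
  hi : (i : L.Branch F) → Fin (N i) → unitInterval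
  /-- the branch reached by the image of the interval -/
  ℓ : (i : L.Branch F) → Fin (N i) → L.Branch F
  /-- the translation of that branch -/
  p : (i : L.Branch F) → Fin (N i) → ℤ
  lo_le_hi : ∀ i j, lo i j ≤ hi i j
  hi_lt_lo : ∀ i j k, j < k → hi i j < lo i k
  image_subset : ∀ i j, F '' (hF.arc i '' Icc (lo i j) (hi i j)) ⊆
    L.shift (p i j) (ℓ i j).1 ∪ interior (L.TR F)
  image_min : ∀ i j, F (hF.arc i (lo i j)) = (L.τ ^ p i j) (hF.arc (ℓ i j) 0)
  image_compl : ∀ x ∈ L.X F, (∀ i j, x ∉ hF.arc i '' Icc (lo i j) (hi i j)) →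
    ∀ m : ℤ, F x ∉ L.shift m (L.X F)

namespace BasicPartition

variable {hF : L.IsSunLike F} (P : BasicPartition hF)

/-- The elements of the partition, as a set of indices `(i, j)`. -/
abbrev Letter : Type _ := (i : L.Branch F) × Fin (P.N i)

/-- The interval `X^i_j`. -/
def cell (A : P.Letter) : Set T := hF.arc A.1 '' Icc (P.lo A.1 A.2) (P.hi A.1 A.2)

/-- The set `⟨A₀ … Aₙ⟩ = Fⁿ {x | ∀ i ≤ n, Fⁱ x ∈ Aᵢ + ℤ} ∩ X` of a nonempty word
(given as a list of length `n + 1`). -/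
def past (w : List P.Letter) : Set T :=
  F^[w.length - 1] '' {x : T | ∀ (i : ℕ) (hi : i < w.length),
    ∃ m : ℤ, F^[i] x ∈ L.shift m (P.cell w[i])} ∩ L.X F

/-- Words giving a vertex: nonempty words with `⟨A₀ … Aₙ⟩ ≠ ∅`. -/
def Word : Type _ := {w : List P.Letter // w ≠ [] ∧ (P.past w).Nonempty}

/-- The equivalence `A₀ … Aₙ ∼ B₀ … Bₘ`: for some `k`, the last `k + 1` letters agree, and
`⟨A₀ … Aₙ₋ₖ⟩ = Aₙ₋ₖ = Bₘ₋ₖ = ⟨B₀ … Bₘ₋ₖ⟩`.  Below, `S` is the letter `Aₙ₋ₖ = Bₘ₋ₖ`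
and `s` consists of the last `k` letters. -/
def equiv (w w' : P.Word) : Prop :=
  ∃ (u u' s : List P.Letter) (S : P.Letter),
    w.1 = (u ++ [S]) ++ s ∧ w'.1 = (u' ++ [S]) ++ s ∧
    P.past (u ++ [S]) = P.cell S ∧ P.past (u' ++ [S]) = P.cell S

/-- Vertices of the covering graph: words up to equivalence. -/
def Vertex : Type _ := Quot P.equiv

/-- The vertex represented by a word. -/
def vertex (w : P.Word) : P.Vertex := Quot.mk _ w

/-- Arrows of the covering graph: `A₀ … Aₙ → A₀ … Aₙ Aₙ₊₁`. -/
def Arrow (α β : P.Vertex) : Prop :=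
  ∃ (w w' : P.Word) (A : P.Letter), w'.1 = w.1 ++ [A] ∧ α = P.vertex w ∧ β = P.vertex w'

/-- The last letter `Aₙ` of the vertex represented by `A₀ … Aₙ`.  As `⟨A₀ … Aₙ⟩` is a nonempty
subset of `Aₙ`, it is the unique element of the partition containing this set. -/
def lastLetter : P.Vertex → P.Letter :=
  Quot.lift (fun w : P.Word => w.1.getLast w.2.1) (by
    rintro ⟨w, hw⟩ ⟨w', hw'⟩ ⟨u, u', s, S, h1, h2, -, -⟩
    dsimp only at h1 h2 ⊢
    subst h1 h2
    simp only [List.append_assoc, List.cons_append, List.nil_append]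
    rw [List.getLast_append_of_ne_nil _ (List.cons_ne_nil S s),
      List.getLast_append_of_ne_nil _ (List.cons_ne_nil S s)])

/-- The weight `p(A)` of the arrows starting at `α`, where `A` is the unique element of the
partition that contains `⟨α⟩`. -/
def weight (α : P.Vertex) : ℤ := P.p (P.lastLetter α).1 (P.lastLetter α).2

/-- Every vertex of `C` is joined to every vertex of `C` by a path of positive length in `C`. -/
def IsStronglyConnected (C : Set P.Vertex) : Prop :=
  ∀ u ∈ C, ∀ v ∈ C, Relation.TransGen (fun a b => a ∈ C ∧ b ∈ C ∧ P.Arrow a b) u v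

/-- The connected components of the covering graph: its maximal strongly connected subgraphs (these
are induced subgraphs, so they are given by their sets of vertices). -/
def IsComponent (C : Set P.Vertex) : Prop :=
  Maximal (fun D : Set P.Vertex => D.Nonempty ∧ P.IsStronglyConnected D) C

/-- `Γ(C)`, the infinite paths in the subgraph with vertex set `C`. -/
def paths (C : Set P.Vertex) : Set (ℕ → P.Vertex) :=
  {α | ∀ n, α n ∈ C ∧ P.Arrow (α n) (α (n + 1))}

/-- The rotation set of `Γ(C)`. -/
def RotPaths (C : Set P.Vertex) : Set ℝ :=
  {ρ | ∃ α ∈ P.paths C,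
    Tendsto (fun n : ℕ => ((∑ i ∈ Finset.range n, P.weight (α i) : ℤ) : ℝ) / (n : ℝ))
      atTop (𝓝 ρ)}

end BasicPartition

end LiftedGraph

end

/-! Orbits are divided into those that enter the interior of T_ℝ and those that never do.

An orbit of the first kind has the rotation number of a point of the line. For r = p/q put G = F^q -
p (`powerMap`). Either some iterate G^n, n ≥ 1, fixes a point of the line, or all iterates of G move
the whole line weakly in one direction (`linePeriodic_or`). Hence rationals strictly between two
rotation numbers of line points come from periodic points on the line. Two such periodic points
force iterates of [0, 2] to cross translates of [0, 2], and concatenating crossings realises every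
slope in between, so `rotLine` is a compact interval. The passage from the line to T_ℝ rests on a
tameness fact: over a bounded interval, the closure of a connected set adds only finitely many
points to it (`finite_closure_diff`). If no line orbit were bounded above under G, the points of T_ℝ
with orbits bounded above would be isolated modulo translations, and a shadowing argument shows that
the iterates of the line cannot accumulate on them (`exists_bounded_of_boundedAbove`). When G moves
the line to the right but one line orbit is bounded above, the same tameness yields a finite
invariant set, hence a periodic point (`exists_periodic_of_bounded`). So each rational rotation
number occurring in T_ℝ belongs to a periodic point.

An orbit of the second kind follows letters of the partition. The minimum of a letter is mapped to
the minimum of a branch, so by intermediate values the past of a word is an initial segment of its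
last letter (`Run.down`). Among the continuations of a word by one letter, at most one therefore
fails to cover its last letter (`eq_of_not_full`). If, from some starting time, letters are fully
covered infinitely often, the rotation number is a limit of mean weights of loops and lies in some
`loopRot D`. Otherwise the orbit is eventually a chain of partially covered letters. A chain is
determined by its first letter, so finiteness of the alphabet makes it periodic (`IsOrbit.cases`),
and a monotone limit gives a periodic point with the same rotation number.

Loops of a letter can be concatenated. Thus `loopRot D` is a compact interval, its rational points
other than the endpoints are exact means of loops, and each mean is realised by a periodic point.
Only the endpoints can fail, at most two per letter, and `RotPaths_loopComponent` identifies the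
interval with the rotation set of a component of the covering graph. Altogether Rot(F) is a finite
union of compact, possibly empty intervals: `rotLine`, the sets `loopRot D`, and the at most
one-point sets `chainRot D`. -/

namespace LiftedGraph

variable {T : Type*} [MetricSpace T] (L : LiftedGraph T)

/-! ### The line, its translations and the retraction -/

theorem tau_zpow_h (m : ℤ) (x : ℝ) : (L.τ ^ m) (L.h x) = L.h (x + m) := by
  induction m using Int.induction_on generalizing x with
  | zero => simp
  | succ n ih =>
    rw [zpow_add_one, IsometryEquiv.mul_apply, L.τ_h, ih]
    push_cast; ring_nf
  | pred n ih =>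
    have h1 : L.τ⁻¹ (L.h x) = L.h (x - 1) := by
      have h2 : L.h x = L.τ (L.h (x - 1)) := by rw [L.τ_h]; ring_nf
      rw [h2, ← IsometryEquiv.mul_apply, inv_mul_cancel]
      rfl
    rw [sub_eq_add_neg, zpow_add, zpow_neg_one, IsometryEquiv.mul_apply, h1, ih]
    push_cast; ring_nf

theorem tau_zpow_add (m n : ℤ) (x : T) : (L.τ ^ (m + n)) x = (L.τ ^ m) ((L.τ ^ n) x) := by
  rw [zpow_add, IsometryEquiv.mul_apply]

theorem tau_zpow_neg_apply (m : ℤ) (x : T) : (L.τ ^ (-m)) ((L.τ ^ m) x) = x := by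
  rw [← tau_zpow_add]; simp

theorem tau_zpow_apply_neg (m : ℤ) (x : T) : (L.τ ^ m) ((L.τ ^ (-m)) x) = x := by
  rw [← tau_zpow_add]; simp

theorem tau_zpow_continuous (m : ℤ) : Continuous (L.τ ^ m : T ≃ᵢ T) := (L.τ ^ m).continuous

theorem tau_zpow_mem_range_iff (m : ℤ) (x : T) : (L.τ ^ m) x ∈ range L.h ↔ x ∈ range L.h := by
  constructor
  · rintro ⟨t, ht⟩
    refine ⟨t - m, ?_⟩
    rw [← L.tau_zpow_neg_apply m x, ← ht, tau_zpow_h]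
    push_cast; ring_nf
  · rintro ⟨t, rfl⟩
    exact ⟨t + m, (L.tau_zpow_h m t).symm⟩

theorem continuous_h : Continuous L.h := L.isEmbedding_h.continuous

/-- Compactness of [0, 1] and the embedding property give a constant for a in [0, 1]; the isometry τ
carries it to all a. This keeps distant parts of the line from accumulating on each other and makes
the line closed. -/
theorem exists_separation :
    ∃ ε > 0, ∀ a b : ℝ, dist (L.h a) (L.h b) < ε → |a - b| < 1 := by
  have key : ∃ ε > 0, ∀ a ∈ Icc (0 : ℝ) 1, ∀ b : ℝ, dist (L.h a) (L.h b) < ε → |a - b| < 1 := by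
    by_contra! hcon
    have hn : ∀ n : ℕ, (0 : ℝ) < 1 / ((n : ℝ) + 1) := fun n => by positivity
    choose a ha b hab hab' using fun n : ℕ => hcon _ (hn n)
    obtain ⟨x, -, φ, hφ, hx⟩ := isCompact_Icc.tendsto_subseq ha
    have h1 : Tendsto (fun n => L.h (a (φ n))) atTop (𝓝 (L.h x)) :=
      (L.continuous_h.tendsto x).comp hx
    have h0 : Tendsto (fun n => dist (L.h (a (φ n))) (L.h (b (φ n)))) atTop (𝓝 0) :=
      squeeze_zero (fun _ => dist_nonneg) (fun n => (hab (φ n)).le)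
        (tendsto_one_div_add_atTop_nhds_zero_nat.comp hφ.tendsto_atTop)
    have h2 : Tendsto (fun n => L.h (b (φ n))) atTop (𝓝 (L.h x)) :=
      tendsto_of_tendsto_of_dist h1 h0
    have h3 : Tendsto (fun n => b (φ n)) atTop (𝓝 x) :=
      L.isEmbedding_h.tendsto_nhds_iff.2 h2
    have h4 : Tendsto (fun n => |a (φ n) - b (φ n)|) atTop (𝓝 0) := by
      simpa using (hx.sub h3).abs
    exact absurd (ge_of_tendsto' h4 fun n => hab' (φ n)) (by norm_num)
  obtain ⟨ε, hε, H⟩ := key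
  refine ⟨ε, hε, fun a b hab => ?_⟩
  have := H (Int.fract a) ⟨Int.fract_nonneg a, (Int.fract_lt_one a).le⟩ (b - ⌊a⌋) (by
    rw [← (L.τ ^ ⌊a⌋).dist_eq, tau_zpow_h, tau_zpow_h]
    simpa using hab)
  rwa [Int.fract, show a - ⌊a⌋ - (b - ⌊a⌋) = a - b by ring] at this

theorem isClosed_range : IsClosed (range L.h) := by
  obtain ⟨ε, hε, H⟩ := L.exists_separation
  refine isClosed_of_closure_subset fun y hy => ?_
  obtain ⟨_, ⟨x₀, rfl⟩, hx₀⟩ := Metric.mem_closure_iff.1 hy (ε / 2) (half_pos hε)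
  have hK : IsClosed (L.h '' Icc (x₀ - 1) (x₀ + 1)) :=
    (isCompact_Icc.image L.continuous_h).isClosed
  have : y ∈ closure (L.h '' Icc (x₀ - 1) (x₀ + 1)) := by
    rw [Metric.mem_closure_iff]
    intro δ hδ
    obtain ⟨_, ⟨x, rfl⟩, hx⟩ := Metric.mem_closure_iff.1 hy (min δ (ε / 2)) (by positivity)
    refine ⟨L.h x, ⟨x, ?_, rfl⟩, hx.trans_le (min_le_left _ _)⟩
    have h1 : dist (L.h x₀) (L.h x) < ε := by
      have h2 := dist_triangle_left (L.h x₀) (L.h x) y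
      have h3 := hx.trans_le (min_le_right _ _)
      linarith
    have := abs_lt.1 (H _ _ h1)
    constructor <;> linarith [this.1, this.2]
  rw [hK.closure_eq] at this
  exact image_subset_range _ _ this

theorem h_retr {x : T} (hx : x ∈ range L.h) : L.h (L.retr x) = x := by
  obtain ⟨t, rfl⟩ := hx
  rw [L.retr_h]

theorem closure_inter_range {x : T} (hx : x ∉ range L.h) :
    closure (connectedComponentIn (range L.h)ᶜ x) ∩ range L.h = {L.h (L.retr x)} := by
  rcases L.retr_spec x with ⟨h, -⟩ | ⟨-, h⟩
  · exact absurd h hx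
  · exact h

theorem retr_eq_of_mem_component {x y : T} (hx : x ∉ range L.h)
    (hy : y ∈ connectedComponentIn (range L.h)ᶜ x) : L.retr y = L.retr x := by
  have hy' : y ∉ range L.h := connectedComponentIn_subset _ _ hy
  have h1 := L.closure_inter_range hx
  have h2 := L.closure_inter_range hy'
  rw [← connectedComponentIn_eq hy, h1] at h2
  exact (L.isEmbedding_h.injective (singleton_eq_singleton_iff.1 h2)).symm

/-- Adding limit points keeps a connected set connected, so those lying in S were already in the
component. -/
theorem component_relClosed {S : Set T} (x : T) :
    closure (connectedComponentIn S x) ∩ S ⊆ connectedComponentIn S x := by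
  intro y hy
  by_cases hx : x ∈ S
  · have hpre : IsPreconnected (closure (connectedComponentIn S x) ∩ S) :=
      isPreconnected_connectedComponentIn.subset_closure
        (subset_inter subset_closure (connectedComponentIn_subset _ _)) inter_subset_left
    exact hpre.subset_connectedComponentIn
      ⟨subset_closure (mem_connectedComponentIn hx), hx⟩ inter_subset_right hy
  · simp [connectedComponentIn_eq_empty hx] at hy

theorem root_mem_closure {x : T} (hx : x ∉ range L.h) :
    L.h (L.retr x) ∈ closure (connectedComponentIn (range L.h)ᶜ x) := by
  have := L.closure_inter_range hx
  exact (this.symm ▸ mem_singleton _ : L.h (L.retr x) ∈ _ ∩ range L.h).1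

theorem closure_component_subset {x : T} (hx : x ∉ range L.h) :
    closure (connectedComponentIn (range L.h)ᶜ x) ⊆
      insert (L.h (L.retr x)) (connectedComponentIn (range L.h)ᶜ x) := by
  intro y hy
  by_cases hy' : y ∈ range L.h
  · left
    have : y ∈ closure (connectedComponentIn (range L.h)ᶜ x) ∩ range L.h := ⟨hy, hy'⟩
    rwa [L.closure_inter_range hx] at this
  · right
    exact component_relClosed x ⟨hy, hy'⟩

theorem retr_tau_zpow (m : ℤ) (x : T) : L.retr ((L.τ ^ m) x) = L.retr x + m := by
  by_cases hx : x ∈ range L.h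
  · obtain ⟨t, rfl⟩ := hx
    rw [tau_zpow_h, retr_h, retr_h]
  · have hx' : (L.τ ^ m) x ∉ range L.h := by rwa [tau_zpow_mem_range_iff]
    have himg : (L.τ ^ m) '' (range L.h) = range L.h := by
      ext y
      constructor
      · rintro ⟨z, hz, rfl⟩
        exact (L.tau_zpow_mem_range_iff m z).2 hz
      · intro hy
        exact ⟨(L.τ ^ (-m)) y, (L.tau_zpow_mem_range_iff _ _).2 hy, L.tau_zpow_apply_neg m y⟩
    have hcomp : (L.τ ^ m) '' connectedComponentIn (range L.h)ᶜ x =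
        connectedComponentIn (range L.h)ᶜ ((L.τ ^ m) x) := by
      have := (L.τ ^ m).toHomeomorph.image_connectedComponentIn
        (s := (range L.h)ᶜ) hx
      simp only [IsometryEquiv.coe_toHomeomorph] at this
      rw [this, image_compl_eq (L.τ ^ m).bijective, himg]
    have hcl : (L.τ ^ m) '' closure (connectedComponentIn (range L.h)ᶜ x) =
        closure (connectedComponentIn (range L.h)ᶜ ((L.τ ^ m) x)) := by
      have := (L.τ ^ m).toHomeomorph.image_closure (connectedComponentIn (range L.h)ᶜ x)
      simp only [IsometryEquiv.coe_toHomeomorph] at this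
      rw [this, hcomp]
    have h1 := L.closure_inter_range hx'
    have h2 : L.h (L.retr x + m) ∈
        closure (connectedComponentIn (range L.h)ᶜ ((L.τ ^ m) x)) ∩ range L.h := by
      refine ⟨?_, mem_range_self _⟩
      rw [← hcl, ← tau_zpow_h]
      exact mem_image_of_mem _ (L.root_mem_closure hx)
    rw [h1] at h2
    exact (L.isEmbedding_h.injective h2).symm

section LocallyConnected

variable [LocallyConnectedSpace T]

theorem isOpen_component (x : T) : IsOpen (connectedComponentIn (range L.h)ᶜ x) :=
  L.isClosed_range.isOpen_compl.connectedComponentIn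

theorem eventually_retr_eq {x : T} (hx : x ∉ range L.h) : ∀ᶠ y in 𝓝 x, L.retr y = L.retr x := by
  filter_upwards [(L.isOpen_component x).mem_nhds (mem_connectedComponentIn hx)] with y hy
  exact L.retr_eq_of_mem_component hx hy

/-- Off the line the retraction is locally constant. At a point of the line, local connectedness
forces the root of any nearby component to be nearby as well. -/
theorem continuous_retr : Continuous L.retr := by
  rw [continuous_iff_continuousAt]
  intro x
  by_cases hx : x ∈ range L.h
  · obtain ⟨t, rfl⟩ := hx
    rw [ContinuousAt, L.retr_h, Metric.tendsto_nhds]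
    intro ε hε
    obtain ⟨V, hV, hVε⟩ : ∃ V ∈ 𝓝 (L.h t), L.h ⁻¹' V ⊆ Metric.ball t ε := by
      have := L.isEmbedding_h.nhds_eq_comap t ▸ Metric.ball_mem_nhds t hε
      exact mem_comap.1 this
    obtain ⟨U, hU, hUo, htU, hUc⟩ :=
      (locallyConnectedSpace_iff_subsets_isOpen_isConnected.1 inferInstance) (L.h t) V hV
    filter_upwards [hUo.mem_nhds htU] with y hy
    by_cases hyR : y ∈ range L.h
    · obtain ⟨s, rfl⟩ := hyR
      rw [L.retr_h]
      exact hVε (hU hy)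
    -- The connected set U contains y and also `L.h t`, which is outside the component of y, so U
    -- meets the frontier of that component. The only frontier point is the root.
    · have hne : (U ∩ frontier (connectedComponentIn (range L.h)ᶜ y)).Nonempty := by
        by_contra hcon
        rw [not_nonempty_iff_eq_empty] at hcon
        have hsub : U ⊆ connectedComponentIn (range L.h)ᶜ y := by
          have hclopen : IsClopen (Subtype.val ⁻¹' (connectedComponentIn (range L.h)ᶜ y) : Set U) := by
            refine ⟨?_, (L.isOpen_component y).preimage continuous_subtype_val⟩
            have : (Subtype.val ⁻¹' (connectedComponentIn (range L.h)ᶜ y) : Set U) =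
                Subtype.val ⁻¹' (closure (connectedComponentIn (range L.h)ᶜ y)) := by
              ext ⟨z, hz⟩
              refine ⟨fun h => subset_closure h, fun h => ?_⟩
              by_contra hz'
              have : z ∈ U ∩ frontier (connectedComponentIn (range L.h)ᶜ y) :=
                ⟨hz, h, fun h' => hz'
                  (show z ∈ connectedComponentIn (range L.h)ᶜ y from interior_subset h')⟩
              rw [hcon] at this
              exact this
            rw [this]
            exact isClosed_closure.preimage continuous_subtype_val
          have : ConnectedSpace U := isConnected_iff_connectedSpace.1 hUc
          have huniv := hclopen.eq_univ ⟨⟨y, hy⟩, mem_connectedComponentIn hyR⟩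
          intro z hz
          have : (⟨z, hz⟩ : U) ∈ (Subtype.val ⁻¹' (connectedComponentIn (range L.h)ᶜ y) : Set U) := by
            rw [huniv]; trivial
          exact this
        exact connectedComponentIn_subset _ _ (hsub htU) (mem_range_self t)
      obtain ⟨z, hzU, hz⟩ := hne
      rw [(L.isOpen_component y).frontier_eq] at hz
      rcases L.closure_component_subset hyR hz.1 with h | h
      · exact hVε (hU (h ▸ hzU))
      · exact absurd h hz.2
  · exact (tendsto_const_nhds.congr' ((L.eventually_retr_eq hx).mono fun y hy => hy.symm))

theorem isOpen_retr_gt (t : ℝ) : IsOpen {x | t < L.retr x} :=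
  isOpen_lt continuous_const L.continuous_retr

theorem isOpen_retr_lt (t : ℝ) : IsOpen {x | L.retr x < t} :=
  isOpen_lt L.continuous_retr continuous_const

theorem isOpen_fiber (t : ℝ) : IsOpen ({x | L.retr x = t} \ {L.h t}) := by
  rw [isOpen_iff_mem_nhds]
  rintro x ⟨hx, hxt⟩
  have hxR : x ∉ range L.h := fun h => hxt (by rw [← L.h_retr h, hx]; rfl)
  filter_upwards [L.eventually_retr_eq hxR, L.isClosed_range.isOpen_compl.mem_nhds hxR] with y hy hyR
  exact ⟨hy.trans hx, fun h => hyR (h ▸ mem_range_self t)⟩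

/-- A connected set missing `h t` lies on one side of `t`. -/
theorem subset_gt_of_isPreconnected {S : Set T} (hS : IsPreconnected S) {t : ℝ} (ht : L.h t ∉ S)
    {x : T} (hx : x ∈ S) (hxt : t < L.retr x) : S ⊆ {y | t < L.retr y} := by
  refine hS.subset_left_of_subset_union (L.isOpen_retr_gt t)
    ((L.isOpen_retr_lt t).union (L.isOpen_fiber t)) ?_ ?_ ⟨x, hx, hxt⟩
  · rw [disjoint_left]
    rintro y hy (h | h)
    · exact lt_asymm (mem_ofPred.1 hy) (mem_ofPred.1 h)
    · exact hy.ne' h.1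
  · intro y hy
    rcases lt_trichotomy t (L.retr y) with h | h | h
    · exact Or.inl h
    · exact Or.inr (Or.inr ⟨h.symm, fun h' => ht (h' ▸ hy)⟩)
    · exact Or.inr (Or.inl h)

theorem subset_lt_of_isPreconnected {S : Set T} (hS : IsPreconnected S) {t : ℝ} (ht : L.h t ∉ S)
    {x : T} (hx : x ∈ S) (hxt : L.retr x < t) : S ⊆ {y | L.retr y < t} := by
  refine hS.subset_left_of_subset_union (L.isOpen_retr_lt t)
    ((L.isOpen_retr_gt t).union (L.isOpen_fiber t)) ?_ ?_ ⟨x, hx, hxt⟩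
  · rw [disjoint_left]
    rintro y hy (h | h)
    · exact lt_asymm (mem_ofPred.1 hy) (mem_ofPred.1 h)
    · exact hy.ne h.1
  · intro y hy
    rcases lt_trichotomy t (L.retr y) with h | h | h
    · exact Or.inr (Or.inl h)
    · exact Or.inr (Or.inr ⟨h.symm, fun h' => ht (h' ▸ hy)⟩)
    · exact Or.inl h

/-- A connected set containing points on both sides of `t`, not both over `t`, contains `h t`. -/
theorem h_mem_of_isPreconnected {S : Set T} (hS : IsPreconnected S) {t : ℝ} {x y : T}
    (hx : x ∈ S) (hy : y ∈ S) (hxt : L.retr x ≤ t) (hty : t ≤ L.retr y)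
    (hxy : L.retr x < L.retr y) : L.h t ∈ S := by
  by_contra ht
  rcases hxt.lt_or_eq with h | h
  · exact absurd (L.subset_lt_of_isPreconnected hS ht hx h hy) (not_lt.2 hty)
  · exact absurd (L.subset_gt_of_isPreconnected hS ht hy (h ▸ hxy) hx) (not_lt.2 hxt)

end LocallyConnected

end LiftedGraph

/-! ### Points added to a connected set by its closure -/

/-- On an open arc of the ambient space there cannot be three points that belong to the closure of a
preconnected set but not to the set. -/
theorem not_three_frontier_points {T : Type*} [TopologicalSpace T] [T2Space T] {Y : Set T}
    (hY : IsPreconnected Y) {ψ : ℝ → T} (hψ : Continuous ψ) (hinj : Function.Injective ψ)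
    {p q t : ℝ} (hpq : p < q) (hqt : q < t)
    (ho : ∀ a b, p ≤ a → b ≤ t → IsOpen (ψ '' Ioo a b))
    (hp : ψ p ∈ closure Y \ Y) (hq : ψ q ∈ closure Y \ Y) (ht : ψ t ∈ closure Y \ Y) : False := by
  have hclosed : ∀ a b, IsClosed (ψ '' Icc a b) := fun a b => (isCompact_Icc.image hψ).isClosed
  have key : ∀ a b, p ≤ a → b ≤ t → ψ a ∉ Y → ψ b ∉ Y → (Y ∩ ψ '' Ioo a b).Nonempty →
      Y ⊆ ψ '' Ioo a b := by
    intro a b hpa hbt ha hb hne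
    refine hY.subset_left_of_subset_union (v := (ψ '' Icc a b)ᶜ) (ho a b hpa hbt)
      (hclosed a b).isOpen_compl ?_ ?_ hne
    · rw [disjoint_left]
      intro y hy hy'
      exact hy' (image_mono Ioo_subset_Icc_self hy)
    · intro y hy
      by_cases hy' : y ∈ ψ '' Icc a b
      · obtain ⟨c, hc, rfl⟩ := hy'
        left
        refine ⟨c, ⟨lt_of_le_of_ne hc.1 ?_, lt_of_le_of_ne hc.2 ?_⟩, rfl⟩
        · rintro rfl; exact ha hy
        · rintro rfl; exact hb hy
      · exact Or.inr hy'
  have hcl : ∀ a b c, Y ⊆ ψ '' Ioo a b → ψ c ∈ closure Y → c ∈ Icc a b := by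
    intro a b c hsub hc
    have : ψ c ∈ ψ '' Icc a b :=
      closure_minimal (hsub.trans (image_mono Ioo_subset_Icc_self)) (hclosed a b) hc
    obtain ⟨c', hc', h⟩ := this
    rwa [← hinj h]
  -- Since ψ q is a limit of Y, the open arc from p to t meets Y, and Y cannot leave it because it
  -- misses both ends. It also misses ψ q, so it lies on one side of q and its closure misses the
  -- end on the other side.
  have h1 : Y ⊆ ψ '' Ioo p t := by
    refine key p t le_rfl le_rfl hp.2 ht.2 ?_
    rw [inter_comm]
    exact mem_closure_iff.1 hq.1 _ (ho p t le_rfl le_rfl) ⟨q, ⟨hpq, hqt⟩, rfl⟩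
  by_cases h2 : (Y ∩ ψ '' Ioo p q).Nonempty
  · have := hcl p q t (key p q le_rfl hqt.le hp.2 hq.2 h2) ht.1
    exact absurd this.2 (not_le.2 hqt)
  · have h3 : Y ⊆ ψ '' Ioo q t := by
      intro y hy
      obtain ⟨c, hc, rfl⟩ := h1 hy
      refine ⟨c, ⟨?_, hc.2⟩, rfl⟩
      rcases lt_trichotomy c q with h | h | h
      · exact absurd ⟨ψ c, hy, c, ⟨hc.1, h⟩, rfl⟩ h2
      · subst h; exact absurd hy hq.2
      · exact h
    have := hcl q t p h3 hp.1
    exact absurd this.1 (not_le.2 hpq)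

/-- A preconnected set has finitely many frontier points outside itself in the part `C` of
a finite graph that is open in the ambient space and misses at most one point of the graph. -/
theorem IsFiniteGraph.finite_closure_diff {T : Type*} [MetricSpace T] {C Y : Set T}
    (hG : IsFiniteGraph (closure C)) (hC : IsOpen C) {z : T} (hzC : z ∉ C)
    (hz : closure C ⊆ insert z C) (hY : IsPreconnected Y) : ((closure Y \ Y) ∩ C).Finite := by
  obtain ⟨-, -, V, hV, -, hfin, hhom⟩ := hG
  set E : Set (Set T) := {e | ∃ x ∈ closure C \ V, e = connectedComponentIn (closure C \ V) x} with hE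
  have hsub : (closure Y \ Y) ∩ C ⊆ V ∪ ⋃ e ∈ E, ((closure Y \ Y) ∩ C) ∩ e := by
    intro y hy
    by_cases hyV : y ∈ V
    · exact Or.inl hyV
    · right
      have hyG : y ∈ closure C \ V := ⟨subset_closure hy.2, hyV⟩
      exact mem_biUnion (x := connectedComponentIn (closure C \ V) y) ⟨y, hyG, rfl⟩
        ⟨hy, mem_connectedComponentIn hyG⟩
  refine (hV.union (hfin.biUnion ?_)).subset hsub
  rintro _ ⟨x, hx, rfl⟩
  set e := connectedComponentIn (closure C \ V) x with he
  -- Inside C, an edge is the complement of the vertices and of the closures of the other edges,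
  -- which are finite in number.
  have hopen : IsOpen (e ∩ C) := by
    have heq : e ∩ C = C \ (V ∪ ⋃ e' ∈ E \ {e}, closure e') := by
      ext y
      constructor
      · rintro ⟨hye, hyC⟩
        refine ⟨hyC, ?_⟩
        have hyG := connectedComponentIn_subset _ _ hye
        rintro (h | h)
        · exact hyG.2 h
        · obtain ⟨e', ⟨⟨x', hx', rfl⟩, hne⟩, hye'⟩ := mem_iUnion₂.1 h
          have h1 := LiftedGraph.component_relClosed x' ⟨hye', hyG⟩
          exact hne ((connectedComponentIn_eq h1).trans (connectedComponentIn_eq hye).symm)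
      · rintro ⟨hyC, hy⟩
        refine ⟨?_, hyC⟩
        have hyG : y ∈ closure C \ V := ⟨subset_closure hyC, fun h => hy (Or.inl h)⟩
        by_contra hye
        refine hy (Or.inr (mem_biUnion (x := connectedComponentIn (closure C \ V) y)
          ⟨⟨y, hyG, rfl⟩, ?_⟩ (subset_closure (mem_connectedComponentIn hyG))))
        intro h
        rw [mem_singleton_iff] at h
        exact hye (h ▸ mem_connectedComponentIn hyG)
    rw [heq]
    refine hC.sdiff (hV.isClosed.union ?_)
    exact (hfin.subset sdiff_subset).isClosed_biUnion fun _ _ => isClosed_closure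
  obtain ⟨φ⟩ := hhom x hx
  set ψ : ℝ → T := fun a => (φ.symm a : T) with hψdef
  have hψ : Continuous ψ := continuous_subtype_val.comp φ.symm.continuous
  have hinj : Function.Injective ψ := Subtype.val_injective.comp φ.symm.injective
  have hψe : ∀ a, ψ a ∈ e := fun a => (φ.symm a).2
  have hψC : ∀ a, ψ a ≠ z → ψ a ∈ C := by
    intro a ha
    have := hz (connectedComponentIn_subset _ _ (hψe a)).1
    exact this.resolve_left ha
  have hψo : ∀ a b, (∀ c ∈ Ioo a b, ψ c ≠ z) → IsOpen (ψ '' Ioo a b) := by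
    intro a b hab
    obtain ⟨W, hW, hWe⟩ := isOpen_induced_iff.1 ((isOpen_Ioo (a := a) (b := b)).preimage φ.continuous)
    have : ψ '' Ioo a b = W ∩ (e ∩ C) := by
      ext y
      constructor
      · rintro ⟨c, hc, rfl⟩
        refine ⟨?_, hψe c, hψC c (hab c hc)⟩
        have : φ.symm c ∈ (Subtype.val ⁻¹' W : Set e) := by
          rw [hWe]; simpa using hc
        exact this
      · rintro ⟨hyW, hye, -⟩
        have : (⟨y, hye⟩ : e) ∈ φ ⁻¹' Ioo a b := by rw [← hWe]; exact hyW
        exact ⟨φ ⟨y, hye⟩, this, by simp [hψdef]⟩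
    rw [this]
    exact hW.inter hopen
  set A : Set ℝ := {a | ψ a ∈ closure Y \ Y ∧ ψ a ≠ z} with hA
  have hAfin : ∀ S : Set ℝ, S.OrdConnected → (∀ a ∈ S, ψ a ≠ z) → (A ∩ S).Finite := by
    intro S hS hSz
    refine Set.finite_of_forall_not_lt_lt fun p hp q hq t ht hpq hqt =>
      not_three_frontier_points hY hψ hinj hpq hqt ?_ hp.1.1 hq.1.1 ht.1.1
    intro a b hpa hbt
    exact hψo a b fun c hc => hSz c (hS.out hp.2 ht.2 ⟨hpa.trans hc.1.le, hc.2.le.trans hbt⟩)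
  -- The exceptional point z may lie in the middle of the edge, where openness in the ambient space
  -- can fail; the two sides of z are then treated separately.
  have hAfin' : A.Finite := by
    by_cases hc : ∃ c, ψ c = z
    · obtain ⟨c, hc⟩ := hc
      have hne : ∀ a, a ≠ c → ψ a ≠ z := fun a ha h => ha (hinj (h.trans hc.symm))
      refine ((hAfin (Iio c) ordConnected_Iio fun a ha => hne a (ne_of_lt ha)).union
        (hAfin (Ioi c) ordConnected_Ioi fun a ha => hne a (ne_of_gt ha))).subset ?_
      intro a ha
      rcases lt_trichotomy a c with h | h | h
      · exact Or.inl ⟨ha, h⟩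
      · exact absurd (h ▸ hc) ha.2
      · exact Or.inr ⟨ha, h⟩
    · push Not at hc
      simpa using hAfin univ ordConnected_univ fun a _ => hc a
  refine (hAfin'.image ψ).subset ?_
  rintro y ⟨⟨hy, hyC⟩, hye⟩
  have h1 : ψ (φ ⟨y, hye⟩) = y := by simp [hψdef]
  refine ⟨φ ⟨y, hye⟩, ⟨by rwa [h1], ?_⟩, h1⟩
  rw [h1]
  rintro rfl
  exact hzC hyC

namespace LiftedGraph

variable {T : Type*} [MetricSpace T] (L : LiftedGraph T)

theorem image_component (m : ℤ) {x : T} (hx : x ∉ range L.h) :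
    (L.τ ^ m) '' connectedComponentIn (range L.h)ᶜ x =
      connectedComponentIn (range L.h)ᶜ ((L.τ ^ m) x) := by
  have himg : (L.τ ^ m) '' (range L.h) = range L.h := by
    ext y
    constructor
    · rintro ⟨z, hz, rfl⟩
      exact (L.tau_zpow_mem_range_iff m z).2 hz
    · intro hy
      exact ⟨(L.τ ^ (-m)) y, (L.tau_zpow_mem_range_iff _ _).2 hy, L.tau_zpow_apply_neg m y⟩
  have := (L.τ ^ m).toHomeomorph.image_connectedComponentIn (s := (range L.h)ᶜ) hx
  simp only [IsometryEquiv.coe_toHomeomorph] at this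
  rw [this, image_compl_eq (L.τ ^ m).bijective, himg]

/-- Every component is an integer translate of one rooted in [0, 1], and only finitely many
translations are needed for roots in [s, t]. -/
theorem finite_components_Icc (s t : ℝ) :
    {C : Set T | ∃ x ∉ range L.h, C = connectedComponentIn (range L.h)ᶜ x ∧
      L.retr x ∈ Icc s t}.Finite := by
  refine ((finite_Icc ⌊s⌋ ⌊t⌋).biUnion fun m _ =>
    (L.finite_components).image fun C => (L.τ ^ m) '' C).subset ?_
  rintro _ ⟨x, hx, rfl, hst⟩
  refine mem_biUnion (x := ⌊L.retr x⌋) ⟨Int.floor_mono hst.1, Int.floor_mono hst.2⟩ ?_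
  have hx' : (L.τ ^ (-⌊L.retr x⌋)) x ∉ range L.h := by rwa [tau_zpow_mem_range_iff]
  refine ⟨connectedComponentIn (range L.h)ᶜ ((L.τ ^ (-⌊L.retr x⌋)) x),
    ⟨⟨_, hx', rfl⟩, _, L.root_mem_closure hx', _, ?_, rfl⟩, ?_⟩
  · rw [retr_tau_zpow]
    have h1 := Int.floor_le (L.retr x)
    have h2 := Int.lt_floor_add_one (L.retr x)
    push_cast
    constructor <;> linarith
  · simp only
    rw [L.image_component _ hx', tau_zpow_apply_neg]

theorem range_h_neg : range (fun x => L.h (-x)) = range L.h :=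
  (neg_surjective (G := ℝ)).range_comp L.h

/-- The lifted graph with the orientation of the line reversed. -/
def reflect : LiftedGraph T where
  h x := L.h (-x)
  τ := L.τ⁻¹
  isEmbedding_h := L.isEmbedding_h.comp (Homeomorph.neg ℝ).isEmbedding
  τ_h x := by
    have := L.tau_zpow_h (-1) (-x)
    simp only [zpow_neg, zpow_one] at this
    rw [this]; push_cast; ring_nf
  isFiniteGraph_closure := by
    rw [L.range_h_neg]
    exact L.isFiniteGraph_closure
  closure_inter := by
    rw [L.range_h_neg]
    exact L.closure_inter
  finite_components := by
    rw [L.range_h_neg]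
    refine (L.finite_components_Icc (-1) 0).subset ?_
    rintro _ ⟨⟨x, hx, rfl⟩, _, hy, a, ha, rfl⟩
    refine ⟨x, hx, rfl, ?_⟩
    have h1 : L.h (-a) ∈ closure (connectedComponentIn (range L.h)ᶜ x) ∩ range L.h :=
      ⟨hy, mem_range_self _⟩
    rw [L.closure_inter_range hx] at h1
    rw [← L.isEmbedding_h.injective h1]
    exact ⟨by linarith [ha.2], by linarith [ha.1]⟩

theorem range_reflect_h : range L.reflect.h = range L.h := L.range_h_neg

theorem retr_reflect (x : T) : L.reflect.retr x = -L.retr x := by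
  refine L.reflect.isRetractOf_unique (L.reflect.retr_spec x) ?_
  have h0 : L.reflect.h (-L.retr x) = L.h (L.retr x) := congrArg L.h (neg_neg _)
  rw [IsRetractOf, range_reflect_h, h0]
  exact L.retr_spec x

theorem TR_reflect (F : T → T) : L.reflect.TR F = L.TR F := by
  rw [TR, TR, range_reflect_h]

theorem IsDegreeOne.reflect {L : LiftedGraph T} {F : T → T} (hF : L.IsDegreeOne F) :
    L.reflect.IsDegreeOne F where
  continuous := hF.continuous
  map_add_one x := by
    have h1 : ∀ y, L.τ (L.reflect.τ y) = y := fun y => by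
      have := L.tau_zpow_apply_neg 1 y
      rwa [zpow_neg, zpow_one] at this
    apply L.τ.injective
    rw [← hF.map_add_one, h1, h1]

section LocallyConnected

variable [LocallyConnectedSpace T]

/-- A segment of the line together with the closures of the finitely many components rooted there:
these sets serve as fundamental domains for the translations. -/
theorem isCompact_retr_preimage (s t : ℝ) : IsCompact (L.retr ⁻¹' Icc s t) := by
  have hK : IsCompact (L.h '' Icc s t ∪
      ⋃ C ∈ {C : Set T | ∃ x ∉ range L.h, C = connectedComponentIn (range L.h)ᶜ x ∧
        L.retr x ∈ Icc s t}, closure C) := by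
    refine (isCompact_Icc.image L.continuous_h).union
      ((L.finite_components_Icc s t).isCompact_biUnion ?_)
    rintro _ ⟨x, hx, rfl, -⟩
    exact (L.isFiniteGraph_closure x hx).1
  refine hK.of_isClosed_subset (isClosed_Icc.preimage L.continuous_retr) ?_
  intro x hx
  by_cases hxR : x ∈ range L.h
  · left
    exact ⟨L.retr x, hx, L.h_retr hxR⟩
  · right
    exact mem_biUnion (x := connectedComponentIn (range L.h)ᶜ x) ⟨x, hxR, rfl, hx⟩
      (subset_closure (mem_connectedComponentIn hxR))

/-- On the line at most two points are added: if three were, the connected set would have to lie on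
one side of the middle one. Each of the finitely many components over [s, t] is handled by the
finite graph version. -/
theorem finite_closure_diff {Y : Set T} (hY : IsPreconnected Y) (s t : ℝ) :
    ((closure Y \ Y) ∩ L.retr ⁻¹' Icc s t).Finite := by
  have hR : ((closure Y \ Y) ∩ range L.h).Finite := by
    have : {a | L.h a ∈ closure Y \ Y}.Finite := by
      refine Set.finite_of_forall_not_lt_lt fun p hp q hq t ht hpq hqt => ?_
      have hcl : ∀ a b : ℝ, Y ⊆ L.retr ⁻¹' Icc a b → closure Y ⊆ L.retr ⁻¹' Icc a b := fun a b h =>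
        closure_minimal h (isClosed_Icc.preimage L.continuous_retr)
      have hclI : ∀ a : ℝ, Y ⊆ L.retr ⁻¹' Iic a → closure Y ⊆ L.retr ⁻¹' Iic a := fun a h =>
        closure_minimal h (isClosed_Iic.preimage L.continuous_retr)
      have hclI' : ∀ a : ℝ, Y ⊆ L.retr ⁻¹' Ici a → closure Y ⊆ L.retr ⁻¹' Ici a := fun a h =>
        closure_minimal h (isClosed_Ici.preimage L.continuous_retr)
      by_cases h1 : ∃ y ∈ Y, q < L.retr y
      · obtain ⟨y, hy, hqy⟩ := h1
        have := hclI' q (fun w hw => mem_Ici.2 (mem_ofPred.1 (L.subset_gt_of_isPreconnected hY hq.2 hy hqy hw)).le) hp.1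
        rw [mem_preimage, L.retr_h] at this
        exact absurd this (not_le.2 hpq)
      · push Not at h1
        have := hclI q h1 ht.1
        rw [mem_preimage, L.retr_h] at this
        exact absurd this (not_le.2 hqt)
    refine (this.image L.h).subset ?_
    rintro _ ⟨hy, a, rfl⟩
    exact ⟨a, hy, rfl⟩
  refine (hR.union ((L.finite_components_Icc s t).biUnion
    (t := fun C => (closure Y \ Y) ∩ C) ?_)).subset ?_
  · rintro _ ⟨x, hx, rfl, -⟩
    refine (L.isFiniteGraph_closure x hx).finite_closure_diff (L.isOpen_component x)
      (fun h => connectedComponentIn_subset _ _ h (mem_range_self _))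
      (L.closure_component_subset hx) hY
  · rintro y ⟨hy, hyst⟩
    by_cases hyR : y ∈ range L.h
    · exact Or.inl ⟨hy, hyR⟩
    · right
      exact mem_biUnion (x := connectedComponentIn (range L.h)ᶜ y) ⟨y, hyR, rfl, hyst⟩
        ⟨hy, mem_connectedComponentIn hyR⟩

end LocallyConnected

end LiftedGraph

/-! ### Slopes of sequences and means of additive sets of pairs -/

/-- A sequence with bounded increments that is asymptotically linear along a subsequence of times
with relatively small gaps is asymptotically linear. -/
theorem tendsto_div_of_tendsto_div_subseq {a : ℕ → ℝ} {M α : ℝ} (ha : ∀ m, |a (m + 1) - a m| ≤ M)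
    {Q : ℕ → ℕ} (hQ0 : Q 0 = 0) (hQ : StrictMono Q)
    (h1 : Tendsto (fun n => a (Q n) / Q n) atTop (𝓝 α))
    (h2 : Tendsto (fun n => ((Q (n + 1) : ℝ) - Q n) / Q n) atTop (𝓝 0)) :
    Tendsto (fun m : ℕ => a m / m) atTop (𝓝 α) := by
  have hM : 0 ≤ M := (abs_nonneg _).trans (ha 0)
  have hinc : ∀ m k, |a (m + k) - a m| ≤ M * k := by
    intro m k
    induction k with
    | zero => simp
    | succ k ih =>
      have := abs_sub_le (a (m + (k + 1))) (a (m + k)) (a m)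
      have h3 := ha (m + k)
      rw [show m + (k + 1) = m + k + 1 from rfl] at *
      push_cast
      linarith
  rw [Metric.tendsto_atTop]
  intro ε hε
  obtain ⟨δ, hδ, hδε⟩ : ∃ δ > 0, δ + (M + |α|) * δ < ε := by
    refine ⟨ε / (2 * (1 + M + |α|)), by positivity, ?_⟩
    have : 0 < 1 + M + |α| := by positivity
    have h3 : ε / (2 * (1 + M + |α|)) + (M + |α|) * (ε / (2 * (1 + M + |α|))) = ε / 2 := by
      field_simp; ring
    linarith
  obtain ⟨n₁, hn₁⟩ := Metric.tendsto_atTop.1 h1 δ hδ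
  obtain ⟨n₂, hn₂⟩ := Metric.tendsto_atTop.1 h2 δ hδ
  refine ⟨Q (max (max n₁ n₂) 1), fun m hm => ?_⟩
  -- The last sampling time not exceeding m; the gap hypothesis bounds m - Q n by δ * Q n.
  set n := Nat.findGreatest (fun n => Q n ≤ m) m with hn
  have hle : Q n ≤ m := Nat.findGreatest_spec (P := fun n => Q n ≤ m) (Nat.zero_le m) (by simp [hQ0])
  have hlt : m < Q (n + 1) := by
    by_contra hcon
    push Not at hcon
    have : n + 1 ≤ n :=
      Nat.le_findGreatest (P := fun n => Q n ≤ m) ((hQ.id_le (n + 1)).trans hcon) hcon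
    omega
  have hN : max (max n₁ n₂) 1 ≤ n :=
    Nat.le_findGreatest ((hQ.id_le _).trans hm) hm
  have hQpos : 0 < Q n := by
    have : Q 0 < Q n := hQ (by omega)
    omega
  have hQn : (0 : ℝ) < Q n := by exact_mod_cast hQpos
  have hmpos : (0 : ℝ) < m := lt_of_lt_of_le hQn (by exact_mod_cast hle)
  have e1 := hn₁ n (by omega)
  have e2 := hn₂ n (by omega)
  rw [Real.dist_eq] at e1 e2
  have f1 : |a (Q n) - α * Q n| ≤ δ * Q n := by
    have : a (Q n) - α * Q n = (a (Q n) / Q n - α) * Q n := by field_simp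
    rw [this, abs_mul, abs_of_pos hQn]
    exact mul_le_mul_of_nonneg_right e1.le hQn.le
  have f2 : (Q (n + 1) : ℝ) - Q n ≤ δ * Q n := by
    rw [sub_zero, abs_lt] at e2
    have := e2.2
    rw [div_lt_iff₀ hQn] at this
    exact this.le
  have f3 : |a m - a (Q n)| ≤ M * (m - Q n) := by
    have := hinc (Q n) (m - Q n)
    rw [Nat.add_sub_cancel' hle, Nat.cast_sub hle] at this
    exact this
  have f4 : (m : ℝ) - Q n ≤ δ * Q n := by
    have : (m : ℝ) ≤ Q (n + 1) := by exact_mod_cast hlt.le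
    linarith
  have hmQ : (Q n : ℝ) ≤ m := by exact_mod_cast hle
  have f5 : |a m - α * m| ≤ (δ + (M + |α|) * δ) * Q n := by
    have g1 : a m - α * m = (a m - a (Q n)) + (a (Q n) - α * Q n) - α * (m - Q n) := by ring
    have g2 : |α * ((m : ℝ) - Q n)| = |α| * (m - Q n) := by
      rw [abs_mul, abs_of_nonneg (sub_nonneg.2 hmQ)]
    have g3 := abs_sub (a m - a (Q n) + (a (Q n) - α * Q n)) (α * ((m : ℝ) - Q n))
    have g4 := abs_add_le (a m - a (Q n)) (a (Q n) - α * Q n)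
    rw [g1]
    have g5 := mul_le_mul_of_nonneg_left f4 hM
    have g6 := mul_le_mul_of_nonneg_left f4 (abs_nonneg α)
    linarith
  rw [Real.dist_eq]
  have f6 : a m / m - α = (a m - α * m) / m := by field_simp
  rw [f6, abs_div, abs_of_pos hmpos, div_lt_iff₀ hmpos]
  calc |a m - α * m| ≤ (δ + (M + |α|) * δ) * Q n := f5
    _ ≤ (δ + (M + |α|) * δ) * m := by
        refine mul_le_mul_of_nonneg_left hmQ (by positivity)
    _ < ε * m := mul_lt_mul_of_pos_right hδε hmpos

/-- The set of the quotients `p / q`, for `(q, p)` in `S`. -/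
def means (S : Set (ℕ × ℤ)) : Set ℝ := {x | ∃ l ∈ S, x = (l.2 : ℝ) / l.1}

/-- Given a set of pairs `(q, p)` and `α` in the closure of the quotients `p / q`, there is a
sequence of such pairs such that any sequence with bounded increments and increasing by about `p`
in time `q` for the consecutive pairs of the sequence has slope `α`. -/
theorem exists_schedule {S : Set (ℕ × ℤ)} (hS : ∀ l ∈ S, 0 < l.1) {α : ℝ}
    (hα : α ∈ closure (means S)) :
    ∃ l : ℕ → ℕ × ℤ, (∀ n, l n ∈ S) ∧ ∀ (a : ℕ → ℝ) (M C : ℝ), (∀ m, |a (m + 1) - a m| ≤ M) →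
      (∀ n, |a (∑ i ∈ Finset.range n, (l i).1) - ((∑ i ∈ Finset.range n, (l i).2 : ℤ) : ℝ)| ≤ C) →
      Tendsto (fun m : ℕ => a m / m) atTop (𝓝 α) := by
  have hex : ∀ j : ℕ, ∃ l ∈ S, |(l.2 : ℝ) - α * l.1| ≤ (1 / ((j : ℝ) + 1)) * l.1 := by
    intro j
    obtain ⟨_, ⟨l, hl, rfl⟩, hd⟩ :=
      Metric.mem_closure_iff.1 hα (1 / ((j : ℝ) + 1)) (by positivity)
    have hpos : (0 : ℝ) < l.1 := by exact_mod_cast hS l hl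
    refine ⟨l, hl, ?_⟩
    rw [dist_comm, Real.dist_eq] at hd
    have : (l.2 : ℝ) - α * l.1 = (l.2 / l.1 - α) * l.1 := by field_simp
    rw [this, abs_mul, abs_of_pos hpos]
    exact mul_le_mul_of_nonneg_right hd.le hpos.le
  choose l' hl'S hl' using hex
  -- The j-th pair is used only from index (j + 1) q_j on. As Q n ≥ n, its length is then at most Q
  -- n / (j + 1), so the gaps are relatively small.
  set c : ℕ → ℕ := fun j => (j + 1) * (l' j).1 with hc
  set j : ℕ → ℕ := fun n => Nat.findGreatest (fun j => c j ≤ n) n with hj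
  have hjt : Tendsto j atTop atTop := by
    rw [tendsto_atTop]
    intro J
    filter_upwards [eventually_ge_atTop (max J (c J))] with n hn
    exact Nat.le_findGreatest ((le_max_left _ _).trans hn) ((le_max_right _ _).trans hn)
  have hjc : ∀ᶠ n in atTop, c (j n) ≤ n := by
    filter_upwards [eventually_ge_atTop (c 0)] with n hn
    exact Nat.findGreatest_spec (P := fun j => c j ≤ n) (Nat.zero_le n) hn
  refine ⟨fun n => l' (j n), fun n => hl'S _, fun a M C ha hC => ?_⟩
  set q : ℕ → ℕ := fun n => (l' (j n)).1 with hq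
  set p : ℕ → ℤ := fun n => (l' (j n)).2 with hp
  set Q : ℕ → ℕ := fun n => ∑ i ∈ Finset.range n, q i with hQdef
  have hqpos : ∀ n, 0 < q n := fun n => hS _ (hl'S _)
  have hQsucc : ∀ n, Q (n + 1) = Q n + q n := fun n => Finset.sum_range_succ _ _
  have hQmono : StrictMono Q := strictMono_nat_of_lt_succ fun n => by
    rw [hQsucc]; exact Nat.lt_add_of_pos_right (hqpos n)
  have hQge : ∀ n, n ≤ Q n := hQmono.id_le
  have hQt : Tendsto (fun n => (Q n : ℝ)) atTop atTop :=
    tendsto_natCast_atTop_atTop.comp (tendsto_atTop_mono hQge tendsto_id)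
  have hinvj : Tendsto (fun n => 1 / ((j n : ℝ) + 1)) atTop (𝓝 0) :=
    tendsto_one_div_add_atTop_nhds_zero_nat.comp hjt
  have hlo : (fun n => ((p n : ℝ) - α * q n)) =o[atTop] (fun n => (q n : ℝ)) := by
    rw [Asymptotics.isLittleO_iff]
    intro ε hε
    filter_upwards [(tendsto_order.1 hinvj).2 ε hε] with n hn
    rw [Real.norm_eq_abs, Real.norm_of_nonneg (Nat.cast_nonneg _)]
    exact (hl' (j n)).trans (mul_le_mul_of_nonneg_right hn.le (Nat.cast_nonneg _))
  have hsum : (fun n => ∑ i ∈ Finset.range n, ((p i : ℝ) - α * q i)) =o[atTop]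
      (fun n => ∑ i ∈ Finset.range n, (q i : ℝ)) := by
    refine hlo.sum_range (fun n => Nat.cast_nonneg _) ?_
    convert hQt using 2 with n
    simp [hQdef]
  refine tendsto_div_of_tendsto_div_subseq ha (Q := Q) (by simp [hQdef]) hQmono ?_ ?_
  · have e1 : Tendsto (fun n => (∑ i ∈ Finset.range n, ((p i : ℝ) - α * q i)) / Q n) atTop (𝓝 0) := by
      have := hsum.tendsto_div_nhds_zero
      convert this using 2 with n
      simp [hQdef]
    have e2 : Tendsto (fun n => (a (Q n) - ((∑ i ∈ Finset.range n, p i : ℤ) : ℝ)) / Q n)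
        atTop (𝓝 0) := by
      refine squeeze_zero_norm (a := fun n => C / Q n) (fun n => ?_)
        (tendsto_const_nhds.div_atTop hQt)
      rw [norm_div, Real.norm_eq_abs, Real.norm_of_nonneg (Nat.cast_nonneg _)]
      exact div_le_div_of_nonneg_right (hC n) (Nat.cast_nonneg _)
    have e3 := (e1.add e2).const_add α
    rw [add_zero, add_zero] at e3
    refine e3.congr' ?_
    filter_upwards [eventually_ge_atTop 1] with n hn
    have hne : (Q n : ℝ) ≠ 0 := by
      have := hQge n
      exact_mod_cast (show Q n ≠ 0 by omega)
    rw [Finset.sum_sub_distrib, ← Finset.mul_sum]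
    have hcast : ∑ i ∈ Finset.range n, (q i : ℝ) = Q n := by simp [hQdef]
    rw [hcast]
    push_cast
    field_simp
    ring
  · refine squeeze_zero' (Eventually.of_forall fun n => ?_) ?_ hinvj
    · rw [hQsucc]; push_cast
      have : (0 : ℝ) ≤ q n := Nat.cast_nonneg _
      have h2 : (0 : ℝ) ≤ Q n := Nat.cast_nonneg _
      rw [add_sub_cancel_left]
      positivity
    · filter_upwards [hjc, eventually_ge_atTop 1] with n hn hn1
      have hQn : (0 : ℝ) < Q n := by
        have := hQge n
        exact_mod_cast (show 0 < Q n by omega)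
      rw [hQsucc]; push_cast
      rw [add_sub_cancel_left, div_le_div_iff₀ hQn (by positivity), one_mul]
      have : (j n + 1) * q n ≤ Q n := hn.trans (hQge n)
      have h3 : ((j n : ℝ) + 1) * q n ≤ Q n := by exact_mod_cast this
      linarith

/-- A bounded change of the time and of the weight does not affect a limiting slope, so pairs that
close up an initial segment at bounded cost have means approaching ρ. -/
theorem mem_closure_means_of_frequently {S : Set (ℕ × ℤ)} {W : ℕ → ℝ} {ρ : ℝ} {K : ℕ} {K' : ℝ}
    (hW : Tendsto (fun n => W n / n) atTop (𝓝 ρ))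
    (hS : ∃ᶠ n in atTop, ∃ l ∈ S, n ≤ l.1 ∧ l.1 ≤ n + K ∧ |(l.2 : ℝ) - W n| ≤ K') :
    ρ ∈ closure (means S) := by
  rw [Metric.mem_closure_iff]
  intro ε hε
  have hlim : Tendsto (fun n : ℕ => |W n / n - ρ| + (K' + |ρ| * K) / n) atTop (𝓝 0) := by
    have h1 : Tendsto (fun n => |W n / n - ρ|) atTop (𝓝 0) := by
      have := (hW.sub_const ρ).abs
      simpa using this
    have h2 : Tendsto (fun n : ℕ => (K' + |ρ| * K) / (n : ℝ)) atTop (𝓝 0) :=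
      tendsto_const_nhds.div_atTop tendsto_natCast_atTop_atTop
    simpa using h1.add h2
  obtain ⟨n, ⟨l, hl, hnl, hlK, hlW⟩, hn, hn1⟩ :=
    (hS.and_eventually (((tendsto_order.1 hlim).2 ε hε).and (eventually_ge_atTop 1))).exists
  refine ⟨_, ⟨l, hl, rfl⟩, ?_⟩
  have hn0 : (0 : ℝ) < n := by exact_mod_cast hn1
  have hl0 : (n : ℝ) ≤ l.1 := by exact_mod_cast hnl
  have hl1 : (l.1 : ℝ) ≤ n + K := by exact_mod_cast hlK
  have hlpos : (0 : ℝ) < l.1 := hn0.trans_le hl0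
  rw [dist_comm, Real.dist_eq]
  have e1 : (l.2 : ℝ) / l.1 - ρ = ((l.2 - W n) + (W n - ρ * n) - ρ * (l.1 - n)) / l.1 := by
    field_simp; ring
  have e2 : |W n - ρ * n| = |W n / n - ρ| * n := by
    rw [← abs_of_pos hn0, ← abs_mul, abs_of_pos hn0]; congr 1; field_simp
  have e3 : |ρ * ((l.1 : ℝ) - n)| ≤ |ρ| * K := by
    rw [abs_mul, abs_of_nonneg (sub_nonneg.2 hl0)]
    exact mul_le_mul_of_nonneg_left (by linarith) (abs_nonneg _)
  have e4 : |(l.2 - W n) + (W n - ρ * n) - ρ * (l.1 - n)| ≤ K' + |W n / n - ρ| * n + |ρ| * K := by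
    have g1 := abs_sub ((l.2 - W n) + (W n - ρ * n)) (ρ * ((l.1 : ℝ) - n))
    have g2 := abs_add_le (l.2 - W n) (W n - ρ * n)
    linarith
  rw [e1, abs_div, abs_of_pos hlpos]
  calc _ ≤ (K' + |W n / n - ρ| * n + |ρ| * K) / l.1 := div_le_div_of_nonneg_right e4 hlpos.le
    _ ≤ (K' + |W n / n - ρ| * n + |ρ| * K) / n :=
        div_le_div_of_nonneg_left ((abs_nonneg _).trans e4) hn0 hl0
    _ = |W n / n - ρ| + (K' + |ρ| * K) / n := by field_simp; ring
    _ < ε := hn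

theorem nsmul_mem_of_add_mem {S : Set (ℕ × ℤ)} (hS : ∀ a ∈ S, ∀ b ∈ S, a + b ∈ S)
    {a : ℕ × ℤ} (ha : a ∈ S) {n : ℕ} (hn : 0 < n) : n • a ∈ S := by
  induction n, hn using Nat.le_induction with
  | base => simpa
  | succ k _ ih => rw [succ_nsmul]; exact hS _ ih _ ha

/-- A rational strictly between two means is a weighted mediant of them with positive integer
weights, hence an exact mean and not only a limit. -/
theorem rat_mem_means {S : Set (ℕ × ℤ)} (hS : ∀ a ∈ S, ∀ b ∈ S, a + b ∈ S)
    (hpos : ∀ l ∈ S, 0 < l.1) {x y : ℝ} (hx : x ∈ means S) (hy : y ∈ means S) {r : ℚ}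
    (hxr : x < r) (hry : (r : ℝ) < y) : (r : ℝ) ∈ means S := by
  obtain ⟨a, ha, rfl⟩ := hx
  obtain ⟨b, hb, rfl⟩ := hy
  have ha0 : (0 : ℝ) < a.1 := by exact_mod_cast hpos a ha
  have hb0 : (0 : ℝ) < b.1 := by exact_mod_cast hpos b hb
  have hd0 : (0 : ℝ) < r.den := by exact_mod_cast r.den_pos
  rw [Rat.cast_def, div_lt_div_iff₀ (by assumption) (by assumption)] at hxr hry
  have hu : 0 < r.num * a.1 - a.2 * r.den := by
    have : (a.2 : ℝ) * r.den < r.num * a.1 := hxr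
    have : a.2 * r.den < r.num * a.1 := by exact_mod_cast this
    linarith
  have hv : 0 < b.2 * r.den - r.num * b.1 := by
    have : (r.num : ℝ) * b.1 < b.2 * r.den := hry
    have : r.num * b.1 < b.2 * r.den := by exact_mod_cast this
    linarith
  obtain ⟨u, hu'⟩ := Int.eq_ofNat_of_zero_le hu.le
  obtain ⟨v, hv'⟩ := Int.eq_ofNat_of_zero_le hv.le
  have hu0 : 0 < u := by omega
  have hv0 : 0 < v := by omega
  -- Up to the same factor, u and v measure the defects of a and b from slope r on opposite sides,
  -- so these multiplicities cancel them.
  refine ⟨v • a + u • b, hS _ (nsmul_mem_of_add_mem hS ha hv0) _ (nsmul_mem_of_add_mem hS hb hu0), ?_⟩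
  have e3 : (v • a + u • b).1 = v * a.1 + u * b.1 := rfl
  have e4 : (v • a + u • b).2 = v * a.2 + u * b.2 := by
    rw [← nsmul_eq_mul, ← nsmul_eq_mul]; rfl
  rw [e3, e4]
  push_cast
  have hv0' : (0 : ℝ) < v := by exact_mod_cast hv0
  have hu0' : (0 : ℝ) < u := by exact_mod_cast hu0
  have e1 : (u : ℝ) = r.num * a.1 - a.2 * r.den := by exact_mod_cast hu'.symm
  have e2 : (v : ℝ) = b.2 * r.den - r.num * b.1 := by exact_mod_cast hv'.symm
  rw [Rat.cast_def, div_eq_div_iff hd0.ne' (by positivity)]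
  rw [e1, e2]
  ring

theorem ordConnected_closure_means {S : Set (ℕ × ℤ)} (hS : ∀ a ∈ S, ∀ b ∈ S, a + b ∈ S)
    (hpos : ∀ l ∈ S, 0 < l.1) : (closure (means S)).OrdConnected := by
  refine ordConnected_of_Ioo fun x hx z hz _ y hy => ?_
  rw [mem_closure_iff_nhds]
  intro t ht
  obtain ⟨ε, hε, hεt⟩ := Metric.mem_nhds_iff.1 ht
  obtain ⟨m, hm, hmx⟩ := Metric.mem_closure_iff.1 hx (y - x) (sub_pos.2 hy.1)
  obtain ⟨m', hm', hmz⟩ := Metric.mem_closure_iff.1 hz (z - y) (sub_pos.2 hy.2)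
  rw [Real.dist_eq, abs_lt] at hmx hmz
  obtain ⟨r, hr1, hr2⟩ := exists_rat_btwn (show max m (y - ε) < y from
    max_lt (by linarith) (by linarith))
  refine ⟨r, hεt ?_, rat_mem_means hS hpos hm hm' ((le_max_left _ _).trans_lt hr1) (by linarith)⟩
  rw [Metric.mem_ball, Real.dist_eq, abs_lt]
  have := (le_max_right _ _).trans_lt hr1
  constructor <;> linarith

/-! ### Maps of degree one: fixed points and bounded line orbits -/

/-- Collapsing to the point `a` a set whose boundary is contained in `{a}` is continuous. -/
theorem continuous_collapse {T : Type*} [TopologicalSpace T] {S : Set T} {a : T}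
    [DecidablePred (· ∈ S)]
    (hS : ∀ x, x ≠ a → (∀ᶠ y in 𝓝 x, y ∈ S) ∨ (∀ᶠ y in 𝓝 x, y ∉ S)) :
    Continuous (fun x => if x ∈ S then x else a) := by
  rw [continuous_iff_continuousAt]
  intro x
  by_cases hx : x = a
  · subst hx
    have h0 : (if x ∈ S then x else x) = x := by split_ifs <;> rfl
    rw [ContinuousAt, h0]
    refine tendsto_def.2 fun V hV => ?_
    filter_upwards [hV] with y hy
    rw [mem_preimage]
    split_ifs
    · exact hy
    · exact mem_of_mem_nhds hV
  · rcases hS x hx with h | h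
    · exact continuousAt_id.congr (h.mono fun y hy => by simp [hy])
    · exact (continuousAt_const (y := a)).congr (h.mono fun y hy => by simp [hy])

theorem exists_periodic_of_finite {α : Type*} {G : α → α} {S : Set α}
    (hS : S.Finite) (hne : S.Nonempty)
    (hmaps : MapsTo G S S) : ∃ z ∈ S, ∃ n, 0 < n ∧ G^[n] z = z := by
  obtain ⟨x, hx⟩ := hne
  have hit : ∀ n, G^[n] x ∈ S := fun n => hmaps.iterate n hx
  obtain ⟨m, n, hmn, heq⟩ : ∃ m n : ℕ, m < n ∧ G^[m] x = G^[n] x := by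
    have : ¬ Function.Injective fun n : ℕ => G^[n] x := fun hinj =>
      Set.infinite_univ (α := ℕ) ((hS.preimage hinj.injOn).subset fun n _ => hit n)
    rw [Function.not_injective_iff] at this
    obtain ⟨m, n, h, hne⟩ := this
    rcases hne.lt_or_gt with h' | h'
    · exact ⟨m, n, h', h⟩
    · exact ⟨n, m, h', h.symm⟩
  refine ⟨G^[m] x, hit m, n - m, by omega, ?_⟩
  rw [← Function.iterate_add_apply, Nat.sub_add_cancel hmn.le, heq]

namespace LiftedGraph

variable {T : Type*} [MetricSpace T] {L : LiftedGraph T} {F G : T → T}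

namespace IsDegreeOne

theorem map_tau_zpow (hF : L.IsDegreeOne F) (m : ℤ) (x : T) :
    F ((L.τ ^ m) x) = (L.τ ^ m) (F x) := by
  induction m using Int.induction_on generalizing x with
  | zero => simp
  | succ n ih => rw [zpow_add_one, IsometryEquiv.mul_apply, IsometryEquiv.mul_apply, ih,
      hF.map_add_one]
  | pred n ih =>
    have h1 : F (L.τ⁻¹ x) = L.τ⁻¹ (F x) := by
      apply L.τ.injective
      rw [← hF.map_add_one, ← IsometryEquiv.mul_apply, ← IsometryEquiv.mul_apply, mul_inv_cancel]
      rfl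
    rw [zpow_sub_one, IsometryEquiv.mul_apply, IsometryEquiv.mul_apply, ih, h1]

theorem iterate (hF : L.IsDegreeOne F) (n : ℕ) : L.IsDegreeOne F^[n] where
  continuous := hF.continuous.iterate n
  map_add_one x := (Function.Semiconj.iterate_right (f := L.τ) (fun x => (hF.map_add_one x).symm) n x).symm

theorem translate (hF : L.IsDegreeOne F) (m : ℤ) :
    L.IsDegreeOne (fun x => (L.τ ^ m) (F x)) where
  continuous := (L.tau_zpow_continuous m).comp hF.continuous
  map_add_one x := by
    have := L.tau_zpow_add 1 m (F x)
    rw [add_comm, tau_zpow_add, zpow_one] at this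
    simp only [hF.map_add_one, this]

theorem translate_iterate (hF : L.IsDegreeOne F) (m : ℤ) (n : ℕ) (x : T) :
    (fun x => (L.τ ^ m) (F x))^[n] x = (L.τ ^ (n * m)) (F^[n] x) := by
  induction n with
  | zero => simp
  | succ n ih =>
    rw [Function.iterate_succ_apply', ih, hF.map_tau_zpow, ← tau_zpow_add,
      Function.iterate_succ_apply']
    congr 2
    push_cast; ring

theorem retr_map_add (hF : L.IsDegreeOne F) (y : ℝ) (m : ℤ) :
    L.retr (F (L.h (y + m))) = L.retr (F (L.h y)) + m := by
  rw [← tau_zpow_h, hF.map_tau_zpow, retr_tau_zpow]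

end IsDegreeOne

section LocallyConnected

variable [LocallyConnectedSpace T]

theorem IsDegreeOne.continuous_retr_map (hF : L.IsDegreeOne F) :
    Continuous fun y => L.retr (F (L.h y)) :=
  L.continuous_retr.comp (hF.continuous.comp L.continuous_h)

/-- The displacement is invariant under translations and continuous on a compact fundamental domain.
-/
theorem IsDegreeOne.exists_bound (hF : L.IsDegreeOne F) :
    ∃ M : ℝ, 0 ≤ M ∧ ∀ x, |L.retr (F x) - L.retr x| ≤ M := by
  obtain ⟨M, hM⟩ := (L.isCompact_retr_preimage 0 1).exists_bound_of_continuousOn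
    (f := fun x => L.retr (F x) - L.retr x)
    ((L.continuous_retr.comp hF.continuous).sub L.continuous_retr).continuousOn
  have key : ∀ x, |L.retr (F x) - L.retr x| ≤ M := by
    intro x
    have := hM ((L.τ ^ (-⌊L.retr x⌋)) x) (by
      rw [mem_preimage, retr_tau_zpow]
      push_cast
      exact ⟨by linarith [Int.floor_le (L.retr x)], by linarith [Int.lt_floor_add_one (L.retr x)]⟩)
    rw [hF.map_tau_zpow, retr_tau_zpow, retr_tau_zpow, add_sub_add_right_eq_sub] at this
    exact this
  exact ⟨M, (abs_nonneg _).trans (key (L.h 0)), key⟩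

/-- A point of a path that retracts to a value not locally constant along the path is on the line. -/
theorem mem_range_of_frequently {g : ℝ → T} (hg : Continuous g) {y : ℝ}
    (h : ∃ᶠ z in 𝓝 y, L.retr (g z) ≠ L.retr (g y)) : g y ∈ range L.h := by
  by_contra hy
  exact h ((hg.tendsto y).eventually ((L.eventually_retr_eq hy).mono fun z hz => not_not.2 hz))

/-- A map of degree one without a fixed point on the line moves all points of the line in the same
direction. -/
theorem IsDegreeOne.exists_fixed_or (hG : L.IsDegreeOne G) :
    (∃ y, G (L.h y) = L.h y) ∨ (∀ y, y < L.retr (G (L.h y))) ∨ ∀ y, L.retr (G (L.h y)) < y := by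
  by_contra! hcon
  obtain ⟨hfix, ⟨a, ha⟩, b, hb⟩ := hcon
  set f : ℝ → ℝ := fun y => L.retr (G (L.h y)) with hf
  have hfc : Continuous f := hG.continuous_retr_map
  have hd : Continuous fun y => f y - y := hfc.sub continuous_id
  have hloc : ∀ u, f u = u → ∀ᶠ z in 𝓝 u, f z = u := by
    intro u hu
    have : G (L.h u) ∉ range L.h := fun h => hfix u (by rw [← L.h_retr h]; exact congrArg L.h hu)
    have h2 := ((hG.continuous.comp L.continuous_h).tendsto u).eventually (L.eventually_retr_eq this)
    filter_upwards [h2] with z hz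
    exact hz.trans hu
  obtain ⟨u, hu⟩ : ∃ u, f u - u = 0 :=
    mem_range_of_exists_le_of_exists_ge hd ⟨a, sub_nonpos.2 ha⟩ ⟨b, sub_nonneg.2 hb⟩
  rw [sub_eq_zero] at hu
  -- Near u the function f is constant, so its graph is strictly below the diagonal just to the
  -- right of u, although it is on the diagonal again at u + 1. At the first return v, local
  -- constancy or strict inequality puts the graph on or above the diagonal already before v, which
  -- is absurd.
  obtain ⟨z, hz, huz, hzu⟩ : ∃ z, f z = u ∧ u < z ∧ z < u + 1 := by
    have h1 := (hloc u hu).filter_mono (nhdsWithin_le_nhds (s := Ioi u))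
    obtain ⟨z, h2, h3⟩ := (h1.and (Ioo_mem_nhdsGT (lt_add_one u))).exists
    exact ⟨z, h2, h3⟩
  have hA : IsCompact (Icc z (u + 1) ∩ {v | 0 ≤ f v - v}) :=
    isCompact_Icc.inter_right (isClosed_le continuous_const hd)
  have hu1 : f (u + 1) = u + 1 := by
    have := hG.retr_map_add u 1
    simp only [Int.cast_one] at this
    rw [hf]; simp only; rw [this]; simp only [hf] at hu; rw [hu]
  obtain ⟨v, hv, hvleast⟩ := hA.exists_isLeast ⟨u + 1, ⟨hzu.le, le_rfl⟩, by simp [hu1]⟩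
  have hzv : z < v := by
    refine lt_of_le_of_ne hv.1.1 ?_
    rintro rfl
    have : 0 ≤ f z - z := hv.2
    linarith
  have hev : ∀ᶠ w in 𝓝[<] v, 0 ≤ f w - w := by
    rcases (show 0 ≤ f v - v from hv.2).lt_or_eq with h | h
    · exact ((hd.tendsto v).eventually (lt_mem_nhds h)).filter_mono nhdsWithin_le_nhds |>.mono
        fun w hw => le_of_lt hw
    · have h3 := (hloc v (by linarith)).filter_mono (nhdsWithin_le_nhds (s := Iio v))
      filter_upwards [h3, self_mem_nhdsWithin] with w hw hwv
      rw [hw]; exact sub_nonneg.2 (le_of_lt hwv)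
  obtain ⟨w, hw, hw'⟩ := (hev.and (Ioo_mem_nhdsLT hzv)).exists
  exact absurd (hvleast ⟨⟨hw'.1.le, hw'.2.le.trans hv.1.2⟩, hw⟩) (not_le.2 hw'.2)

/-- The image of the line is connected and unbounded in both directions, so it contains the whole
line. -/
theorem IsDegreeOne.exists_map_eq_h (hG : L.IsDegreeOne G) (t : ℝ) : ∃ y, G (L.h y) = L.h t := by
  have hS : IsPreconnected (range fun y => G (L.h y)) :=
    isPreconnected_range (hG.continuous.comp L.continuous_h)
  set f := L.retr (G (L.h 0)) with hf
  have h1 := hG.retr_map_add 0 (⌊t - f⌋ - 1)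
  have h2 := hG.retr_map_add 0 (⌈t - f⌉ + 1)
  have h3 := Int.floor_le (t - f)
  have h4 := Int.le_ceil (t - f)
  push_cast at h1 h2
  have := L.h_mem_of_isPreconnected hS (t := t) (mem_range_self (0 + ((⌊t - f⌋ : ℝ) - 1)))
    (mem_range_self (0 + ((⌈t - f⌉ : ℝ) + 1))) (by rw [h1]; linarith) (by rw [h2]; linarith)
    (by rw [h1, h2]; linarith)
  exact this

/-- The dichotomy for G^n leaves only its direction to be decided, and one point moved to the right
decides it. Successive preimages of `L.h 0` within the line provide such a point. -/
theorem IsDegreeOne.lt_retr_iterate (hG : L.IsDegreeOne G) (h1 : ∀ y, y < L.retr (G (L.h y)))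
    {n : ℕ} (hn : 0 < n) (hfix : ∀ y, G^[n] (L.h y) ≠ L.h y) (y : ℝ) :
    y < L.retr (G^[n] (L.h y)) := by
  have key : ∀ n : ℕ, 0 < n → ∃ z, G^[n] (L.h z) = L.h 0 ∧ z < 0 := by
    intro n hn
    induction n, hn using Nat.le_induction with
    | base =>
      obtain ⟨z, hz⟩ := hG.exists_map_eq_h 0
      refine ⟨z, hz, ?_⟩
      have := h1 z
      rwa [hz, L.retr_h] at this
    | succ k _ ih =>
      obtain ⟨z, hz, hz0⟩ := ih
      obtain ⟨w, hw⟩ := hG.exists_map_eq_h z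
      refine ⟨w, by rw [Function.iterate_succ_apply, hw, hz], ?_⟩
      have := h1 w
      rw [hw, L.retr_h] at this
      linarith
  rcases (hG.iterate n).exists_fixed_or with ⟨z, hz⟩ | h | h
  · exact absurd hz (hfix z)
  · exact h y
  · obtain ⟨z, hz, hz0⟩ := key n hn
    have := h z
    rw [hz, L.retr_h] at this
    exact absurd this (not_lt.2 hz0.le)

variable [ConnectedSpace T]

open Classical in
/-- If all points of the line move to the right but the orbit of one of them stays bounded above,
then there is a periodic point. -/
theorem IsDegreeOne.exists_periodic_of_bounded (hG : L.IsDegreeOne G)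
    (h1 : ∀ y, y < L.retr (G (L.h y))) {y c : ℝ} (hyc : ∀ i, L.retr (G^[i] (L.h y)) ≤ c) :
    ∃ z, ∃ n, 0 < n ∧ G^[n] z = z := by
  set A : Set T := {z | ∀ i, L.retr (G^[i] z) ≤ c} with hA
  have hAclosed : IsClosed A := by
    have : A = ⋂ i, {z | L.retr (G^[i] z) ≤ c} := by ext; simp [hA]
    rw [this]
    exact isClosed_iInter fun i =>
      isClosed_le (L.continuous_retr.comp (hG.continuous.iterate i)) continuous_const
  have hGA : ∀ z ∈ A, G z ∈ A := fun z hz i => hz (i + 1)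
  have hcA : L.h c ∉ A := fun h => absurd (h 1) (not_le.2 (h1 c))
  have hyA : L.h y ∈ A := hyc
  have hyc' : y < c := by
    have h2 : L.retr (L.h y) ≤ c := hyA 0
    rw [L.retr_h] at h2
    refine lt_of_le_of_ne h2 ?_
    rintro rfl
    exact hcA hyA
  -- Q contains everything over (c, ∞), while the point `L.h y` of A blocks it on the left. The
  -- boundary of Q lies in A, over the bounded interval [y, c].
  set Q := connectedComponentIn Aᶜ (L.h c) with hQ
  have hcQ : L.h c ∈ Q := mem_connectedComponentIn hcA
  have hQpre : IsPreconnected Q := isPreconnected_connectedComponentIn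
  have hQA : Q ⊆ Aᶜ := connectedComponentIn_subset _ _
  have hQopen : IsOpen Q := hAclosed.isOpen_compl.connectedComponentIn
  have hQgt : Q ⊆ {z | y < L.retr z} :=
    L.subset_gt_of_isPreconnected hQpre (fun h => hQA h hyA) hcQ (by rwa [L.retr_h])
  have hside : ∀ S : Set T, (S = {x | L.retr x ≤ c} ∨ S = {x | c < L.retr x}) → ∀ x, x ≠ L.h c →
      (∀ᶠ y in 𝓝 x, y ∈ S) ∨ (∀ᶠ y in 𝓝 x, y ∉ S) := by
    intro S hS x hx
    have hconst : ∀ v, L.retr v = L.retr x → (v ∈ S ↔ x ∈ S) := by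
      rintro v hv
      rcases hS with rfl | rfl <;> simp [hv]
    rcases lt_trichotomy (L.retr x) c with h | h | h
    · have h2 : ∀ᶠ v in 𝓝 x, L.retr v < c := (L.isOpen_retr_lt c).mem_nhds h
      rcases hS with rfl | rfl
      · exact Or.inl (h2.mono fun v hv => hv.le)
      · exact Or.inr (h2.mono fun v hv => not_lt.2 hv.le)
    · have hxR : x ∉ range L.h := fun hR => hx (by rw [← L.h_retr hR, h])
      by_cases hxS : x ∈ S
      · exact Or.inl ((L.eventually_retr_eq hxR).mono fun v hv => (hconst v hv).2 hxS)
      · exact Or.inr ((L.eventually_retr_eq hxR).mono fun v hv => mt (hconst v hv).1 hxS)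
    · have h2 : ∀ᶠ v in 𝓝 x, c < L.retr v := (L.isOpen_retr_gt c).mem_nhds h
      rcases hS with rfl | rfl
      · exact Or.inr (h2.mono fun v hv => not_le.2 hv)
      · exact Or.inl h2
  -- the part of `Q` on the left of `c` is connected
  set Q' := Q ∩ {x | L.retr x ≤ c} with hQ'
  have hQ'pre : IsPreconnected Q' := by
    have h2 := hQpre.image _ (continuous_collapse (hside _ (Or.inl rfl))).continuousOn
    convert h2 using 1
    ext x
    constructor
    · rintro ⟨hx, hxc⟩
      exact ⟨x, hx, if_pos hxc⟩
    · rintro ⟨w, hw, rfl⟩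
      by_cases hwc : w ∈ {x | L.retr x ≤ c}
      · simp only [if_pos hwc]; exact ⟨hw, hwc⟩
      · simp only [if_neg hwc]; exact ⟨hcQ, by simp [L.retr_h]⟩
  have hright : ∀ x, c < L.retr x → x ∈ Q := by
    have h2 := isPreconnected_univ.image _
      (continuous_collapse (hside _ (Or.inr rfl))).continuousOn
    have hmem : ∀ x, c < L.retr x →
        x ∈ (fun x => if x ∈ {x | c < L.retr x} then x else L.h c) '' univ :=
      fun x hx => ⟨x, mem_univ _, if_pos hx⟩
    have hsub := h2.subset_connectedComponentIn (F := Aᶜ) (x := L.h c)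
      ⟨L.h c, mem_univ _, by simp [L.retr_h]⟩ (by
        rintro _ ⟨w, -, rfl⟩
        by_cases hwc : w ∈ {x | c < L.retr x}
        · simp only [if_pos hwc]; exact fun h => absurd (h 0) (not_le.2 hwc)
        · simp only [if_neg hwc]; exact hcA)
    exact fun x hx => hsub (hmem x hx)
  -- A point over (-∞, c] whose image is in A is itself in A, so G maps Q' into the complement of A.
  -- The image is connected and contains G (h c), a point over (c, ∞), hence in Q.
  have hGQ' : G '' Q' ⊆ Q := by
    have hGc : G (L.h c) ∈ G '' Q' := ⟨_, ⟨hcQ, by simp [L.retr_h]⟩, rfl⟩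
    have h2 : G (L.h c) ∈ Q := hright _ (h1 c)
    rw [hQ, connectedComponentIn_eq h2]
    refine (hQ'pre.image G hG.continuous.continuousOn).subset_connectedComponentIn hGc ?_
    rintro _ ⟨w, hw, rfl⟩ hGw
    refine hQA hw.1 fun i => ?_
    cases i with
    | zero => exact hw.2
    | succ i => exact hGw i
  -- This set is invariant, finite by the tameness of closures, and nonempty because otherwise Q
  -- would be open and closed.
  set B := closure Q ∩ A with hB
  have hGB : MapsTo G B B := by
    rintro z ⟨hzQ, hzA⟩
    refine ⟨?_, hGA z hzA⟩
    have hz : z ∈ closure Q' := by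
      have hsub : Q ⊆ Q' ∪ {x | c < L.retr x} := fun w hw => by
        rcases le_or_gt (L.retr w) c with h | h
        · exact Or.inl ⟨hw, h⟩
        · exact Or.inr h
      have h2 := closure_mono hsub hzQ
      rw [closure_union] at h2
      refine h2.resolve_right fun h3 => ?_
      have h4 : c ≤ L.retr z :=
        closure_lt_subset_le continuous_const L.continuous_retr h3
      have h5 : L.retr z = c := le_antisymm (hzA 0) h4
      by_cases hzR : z ∈ range L.h
      · rw [← L.h_retr hzR, h5] at hzA
        exact hcA hzA
      · obtain ⟨w, hw, hw'⟩ := mem_closure_iff_nhds.1 h3 _ (L.eventually_retr_eq hzR)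
        have : L.retr w = L.retr z := hw
        rw [h5] at this
        exact absurd hw' (by simp [this])
    exact closure_mono hGQ' (image_closure_subset_closure_image hG.continuous ⟨z, hz, rfl⟩)
  have hBfin : B.Finite := by
    refine (L.finite_closure_diff hQpre y c).subset ?_
    rintro z ⟨hzQ, hzA⟩
    refine ⟨⟨hzQ, fun h => hQA h hzA⟩, ?_, hzA 0⟩
    exact closure_lt_subset_le continuous_const L.continuous_retr (closure_mono hQgt hzQ)
  have hBne : B.Nonempty := by
    by_contra hcon
    rw [not_nonempty_iff_eq_empty] at hcon
    have hcl : IsClosed Q := by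
      refine isClosed_of_closure_subset fun z hz => component_relClosed (L.h c) ⟨hz, fun hzA => ?_⟩
      have : z ∈ B := ⟨hz, hzA⟩
      rwa [hcon] at this
    have huniv := IsClopen.eq_univ ⟨hcl, hQopen⟩ ⟨_, hcQ⟩
    exact hQA (huniv ▸ mem_univ (L.h y)) hyA
  obtain ⟨z, -, n, hn, hz⟩ := exists_periodic_of_finite hBfin hBne hGB
  exact ⟨z, n, hn, hz⟩

end LocallyConnected

end LiftedGraph

/-! ### Orbits in T_ℝ that are bounded above -/

namespace LiftedGraph

variable {T : Type*} [MetricSpace T] {L : LiftedGraph T} {F G : T → T}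

/-- The union of the iterates of the line. -/
def lineOrbit (L : LiftedGraph T) (F : T → T) : Set T := ⋃ n : ℕ, F^[n] '' range L.h

theorem range_subset_lineOrbit : range L.h ⊆ L.lineOrbit F :=
  subset_iUnion_of_subset 0 (by simp)

theorem range_subset_TR : range L.h ⊆ L.TR F := range_subset_lineOrbit.trans subset_closure

theorem isClosed_TR : IsClosed (L.TR F) := isClosed_closure

theorem IsDegreeOne.map_mem_TR (hF : L.IsDegreeOne F) {x : T} (hx : x ∈ L.TR F) :
    F x ∈ L.TR F := by
  refine map_mem_closure hF.continuous hx ?_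
  rintro y hy
  obtain ⟨n, z, hz, rfl⟩ := mem_iUnion.1 hy
  exact mem_iUnion.2 ⟨n + 1, z, hz, Function.iterate_succ_apply' F n z⟩

theorem IsDegreeOne.iterate_mem_TR (hF : L.IsDegreeOne F) {x : T} (hx : x ∈ L.TR F) (n : ℕ) :
    F^[n] x ∈ L.TR F := by
  induction n with
  | zero => exact hx
  | succ n ih => rw [Function.iterate_succ_apply']; exact hF.map_mem_TR ih

theorem IsDegreeOne.tau_zpow_mem_TR (hF : L.IsDegreeOne F) (m : ℤ) {x : T} (hx : x ∈ L.TR F) :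
    (L.τ ^ m) x ∈ L.TR F := by
  refine map_mem_closure (L.tau_zpow_continuous m) hx ?_
  rintro y hy
  obtain ⟨n, z, hz, rfl⟩ := mem_iUnion.1 hy
  exact mem_iUnion.2 ⟨n, (L.τ ^ m) z, (L.tau_zpow_mem_range_iff m z).2 hz,
    (hF.iterate n).map_tau_zpow m z⟩

theorem IsDegreeOne.tau_zpow_mem_TR_iff (hF : L.IsDegreeOne F) (m : ℤ) {x : T} :
    (L.τ ^ m) x ∈ L.TR F ↔ x ∈ L.TR F := by
  refine ⟨fun h => ?_, hF.tau_zpow_mem_TR m⟩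
  have := hF.tau_zpow_mem_TR (-m) h
  rwa [tau_zpow_neg_apply] at this

theorem mem_Icc_sub_floor (L : LiftedGraph T) (x : T) :
    (L.τ ^ (-⌊L.retr x⌋)) x ∈ L.retr ⁻¹' Icc 0 1 := by
  rw [mem_preimage, retr_tau_zpow]
  push_cast
  exact ⟨by linarith [Int.floor_le (L.retr x)], by linarith [Int.lt_floor_add_one (L.retr x)]⟩

/-- The points of `T_ℝ` whose orbits are bounded above. -/
def boundedAbove (L : LiftedGraph T) (G : T → T) : Set T :=
  {z | z ∈ L.TR G ∧ ∃ c, ∀ i, L.retr (G^[i] z) ≤ c}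

theorem IsDegreeOne.map_mem_boundedAbove (hG : L.IsDegreeOne G) {z : T}
    (hz : z ∈ L.boundedAbove G) : G z ∈ L.boundedAbove G :=
  ⟨hG.map_mem_TR hz.1, hz.2.choose, fun i => hz.2.choose_spec (i + 1)⟩

theorem IsDegreeOne.tau_mem_boundedAbove (hG : L.IsDegreeOne G) (m : ℤ) {z : T}
    (hz : z ∈ L.boundedAbove G) : (L.τ ^ m) z ∈ L.boundedAbove G := by
  obtain ⟨h1, c, hc⟩ := hz
  refine ⟨hG.tau_zpow_mem_TR m h1, c + m, fun i => ?_⟩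
  rw [(hG.iterate i).map_tau_zpow, retr_tau_zpow]
  linarith [hc i]

theorem mem_boundedAbove_of_map {z : T} (hz : z ∈ L.TR G) (h : G z ∈ L.boundedAbove G) :
    z ∈ L.boundedAbove G := by
  obtain ⟨-, c, hc⟩ := h
  refine ⟨hz, max c (L.retr z), fun i => ?_⟩
  cases i with
  | zero => exact le_max_right _ _
  | succ i => exact (hc i).trans (le_max_left _ _)

theorem IsDegreeOne.mem_boundedAbove_of_iterate (hG : L.IsDegreeOne G) {z : T} (hz : z ∈ L.TR G)
    (n : ℕ) (h : G^[n] z ∈ L.boundedAbove G) : z ∈ L.boundedAbove G := by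
  induction n with
  | zero => exact h
  | succ n ih =>
    rw [Function.iterate_succ_apply'] at h
    exact ih (mem_boundedAbove_of_map (hG.iterate_mem_TR hz n) h)

theorem IsDegreeOne.abs_iterate_le {M : ℝ} (hM : ∀ x, |L.retr (G x) - L.retr x| ≤ M)
    (n : ℕ) (x : T) : |L.retr (G^[n] x) - L.retr x| ≤ n * M := by
  induction n with
  | zero => simp
  | succ n ih =>
    rw [Function.iterate_succ_apply']
    have h1 := hM (G^[n] x)
    have := abs_sub_le (L.retr (G (G^[n] x))) (L.retr (G^[n] x)) (L.retr x)
    push_cast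
    linarith

section LocallyConnected

variable [LocallyConnectedSpace T]

theorem IsDegreeOne.range_subset_image (hF : L.IsDegreeOne F) (n : ℕ) :
    range L.h ⊆ F^[n] '' range L.h := by
  rintro _ ⟨t, rfl⟩
  obtain ⟨y, hy⟩ := (hF.iterate n).exists_map_eq_h t
  exact ⟨_, mem_range_self y, hy⟩

theorem IsDegreeOne.image_subset_image (hF : L.IsDegreeOne F) {m n : ℕ} (hmn : m ≤ n) :
    F^[m] '' range L.h ⊆ F^[n] '' range L.h := by
  obtain ⟨k, rfl⟩ := Nat.exists_eq_add_of_le hmn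
  rw [Function.iterate_add, image_comp]
  exact image_mono (hF.range_subset_image k)

theorem IsDegreeOne.isPreconnected_lineOrbit (hF : L.IsDegreeOne F) :
    IsPreconnected (L.lineOrbit F) := by
  refine isPreconnected_iUnion ⟨L.h 0, mem_iInter.2 fun n => hF.range_subset_image n
    (mem_range_self 0)⟩ fun n => ?_
  exact (isPreconnected_range L.continuous_h).image _ (hF.continuous.iterate n).continuousOn

/-- Compactness modulo translations. -/
theorem exists_uniform_bound (L : LiftedGraph T) {K : Set T} (hK : IsClosed K)
    (hKτ : ∀ (m : ℤ) z, z ∈ K → (L.τ ^ m) z ∈ K) {O : ℕ → Set T} (hO : ∀ i, IsOpen (O i))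
    (hOτ : ∀ i (m : ℤ) z, (L.τ ^ m) z ∈ O i → z ∈ O i) (hKO : ∀ z ∈ K, ∃ i, z ∈ O i) :
    ∃ N, ∀ z ∈ K, ∃ i ≤ N, z ∈ O i := by
  obtain ⟨N, hN⟩ := ((L.isCompact_retr_preimage 0 1).inter_left hK).elim_directed_cover
    (fun N => ⋃ i ≤ N, O i) (fun N => isOpen_biUnion fun i _ => hO i)
    (fun z hz => by
      obtain ⟨i, hi⟩ := hKO z hz.1
      exact mem_iUnion.2 ⟨i, mem_biUnion (le_refl i) hi⟩)
    (directed_of_isDirected_le fun a b hab => biUnion_subset_biUnion_left fun i hi => le_trans hi hab)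
  refine ⟨N, fun z hz => ?_⟩
  obtain ⟨i, hi, hzi⟩ := mem_iUnion₂.1 (hN ⟨hKτ (-⌊L.retr z⌋) z hz, L.mem_Icc_sub_floor z⟩)
  exact ⟨i, hi, hOτ i _ z hzi⟩

/-- If no orbit in T_ℝ were bounded above, compactness modulo translations would give a uniform N
within which every point of T_ℝ advances by more than 1. All rotation numbers would then be at least
1/N. -/
theorem IsDegreeOne.boundedAbove_nonempty (hG : L.IsDegreeOne G) {x : T} (hx : x ∈ L.TR G) {ρ : ℝ}
    (hρ : ρ ≤ 0) (h : L.HasRotationNumber G x ρ) : (L.boundedAbove G).Nonempty := by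
  by_contra hcon
  rw [not_nonempty_iff_eq_empty] at hcon
  obtain ⟨N, hN⟩ := L.exists_uniform_bound (isClosed_TR (F := G))
    (fun m z hz => hG.tau_zpow_mem_TR m hz)
    (O := fun i => {z | L.retr z + 1 < L.retr (G^[i] z)})
    (fun i => isOpen_lt (L.continuous_retr.add continuous_const)
      (L.continuous_retr.comp (hG.continuous.iterate i)))
    (fun i m z hz => by
      have hz' : L.retr ((L.τ ^ m) z) + 1 < L.retr (G^[i] ((L.τ ^ m) z)) := hz
      rw [(hG.iterate i).map_tau_zpow, retr_tau_zpow, retr_tau_zpow] at hz'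
      show L.retr z + 1 < L.retr (G^[i] z)
      linarith)
    (fun z hz => by
      by_contra! hz'
      have : z ∈ L.boundedAbove G := ⟨hz, L.retr z + 1, fun i => not_lt.1 (hz' i)⟩
      rwa [hcon] at this)
  have key : ∀ j : ℕ, ∃ n ≤ j * N, L.retr x + j ≤ L.retr (G^[n] x) := by
    intro j
    induction j with
    | zero => exact ⟨0, Nat.zero_le _, by simp⟩
    | succ j ih =>
      obtain ⟨n, hn, hj⟩ := ih
      obtain ⟨i, hi, hz⟩ := hN _ (hG.iterate_mem_TR hx n)
      refine ⟨i + n, by rw [add_mul]; omega, ?_⟩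
      rw [Function.iterate_add_apply]
      have hz' : L.retr (G^[n] x) + 1 < L.retr (G^[i] (G^[n] x)) := hz
      push_cast
      linarith
  obtain ⟨M, hM0, hM⟩ := hG.exists_bound
  have hNpos : 0 < N := by
    rcases Nat.eq_zero_or_pos N with rfl | h0
    · obtain ⟨n, hn, hj⟩ := key 1
      have : n = 0 := by simpa using hn
      subst this
      simp at hj
      linarith
    · exact h0
  have hev := (tendsto_order.1 h).2 (1 / (N : ℝ)) (lt_of_le_of_lt hρ (by positivity))
  obtain ⟨n₀, hn₀⟩ := eventually_atTop.1 hev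
  obtain ⟨j, hj⟩ := exists_nat_gt (n₀ * M)
  obtain ⟨n, hn, hjn⟩ := key (j + 1)
  have h1 := (le_abs_self _).trans (IsDegreeOne.abs_iterate_le hM n x)
  push_cast at hjn
  have hnpos : n₀ ≤ n := by
    by_contra! hlt
    have : (n : ℝ) * M ≤ n₀ * M :=
      mul_le_mul_of_nonneg_right (by exact_mod_cast hlt.le) hM0
    linarith
  have hn0 : (0 : ℝ) < n := by
    rcases Nat.eq_zero_or_pos n with rfl | h0
    · simp at hjn
      have : (0 : ℝ) ≤ j := Nat.cast_nonneg j
      linarith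
    · exact_mod_cast h0
  have h2 := hn₀ n hnpos
  rw [div_lt_div_iff₀ hn0 (by exact_mod_cast hNpos), one_mul] at h2
  have h3 : (n : ℝ) ≤ (j + 1) * N := by exact_mod_cast hn
  have h4 : ((j : ℝ) + 1) * N ≤ (L.retr (G^[n] x) - L.retr x) * N :=
    mul_le_mul_of_nonneg_right (by linarith) (Nat.cast_nonneg _)
  linarith

/-- If an orbit in `T_ℝ` is bounded above, then so is the orbit of some point of the line. -/
theorem IsDegreeOne.exists_bounded_of_boundedAbove (hG : L.IsDegreeOne G)
    (hne : (L.boundedAbove G).Nonempty) : ∃ y c, ∀ i, L.retr (G^[i] (L.h y)) ≤ c := by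
  by_contra hno
  set B := L.boundedAbove G with hB
  have hRB : ∀ y, L.h y ∉ B := fun y hy => hno ⟨y, hy.2⟩
  have hUB : ∀ z ∈ L.lineOrbit G, z ∉ B := by
    rintro z hz hzB
    obtain ⟨n, _, ⟨y, rfl⟩, rfl⟩ := mem_iUnion.1 hz
    exact hRB y (hG.mem_boundedAbove_of_iterate (range_subset_TR (mem_range_self y)) n hzB)
  have hBsub : B ⊆ closure (L.lineOrbit G) \ L.lineOrbit G := fun z hz =>
    ⟨hz.1, fun h => hUB z h hz⟩
  have hfin : (B ∩ L.retr ⁻¹' Icc 0 1).Finite :=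
    (L.finite_closure_diff hG.isPreconnected_lineOrbit 0 1).subset
      (inter_subset_inter_left _ hBsub)
  have htrans : ∀ P : T → Prop, (∀ b ∈ B ∩ L.retr ⁻¹' Icc 0 1, P b) →
      (∀ b (m : ℤ), P ((L.τ ^ m) b) → P b) → ∀ b ∈ B, P b := fun P h1 h2 b hb =>
    h2 b _ (h1 _ ⟨hG.tau_mem_boundedAbove _ hb, L.mem_Icc_sub_floor b⟩)
  -- a uniform separation constant
  obtain ⟨η, hη, hη1, hη2⟩ : ∃ η > 0, (∀ b ∈ B, ∀ b' ∈ B, dist b b' < 2 * η → b = b') ∧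
      ∀ b ∈ B, ∀ x, dist x b < η → L.retr x = L.retr b ∧ x ∉ range L.h := by
    have hloc : ∀ b ∈ B ∩ L.retr ⁻¹' Icc 0 1, ∀ᶠ η in 𝓝[>] (0 : ℝ),
        (∀ b' ∈ B, dist b b' < 2 * η → b = b') ∧
          ∀ x, dist x b < η → L.retr x = L.retr b ∧ x ∉ range L.h := by
      intro b hb
      have hbR : b ∉ range L.h := by
        rintro ⟨y, rfl⟩; exact hRB y hb.1
      have h3 : ∀ᶠ x in 𝓝 b, (L.retr x = L.retr b ∧ x ∉ range L.h) ∧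
          x ∉ (B ∩ L.retr ⁻¹' Icc 0 1) \ {b} :=
        ((L.eventually_retr_eq hbR).and (L.isClosed_range.isOpen_compl.mem_nhds hbR)).and
          ((hfin.subset sdiff_subset).isClosed.isOpen_compl.mem_nhds fun h => h.2 rfl)
      obtain ⟨ε, hε, hball⟩ := Metric.eventually_nhds_iff.1 h3
      filter_upwards [Ioo_mem_nhdsGT (half_pos hε)] with η hη
      refine ⟨fun b' hb' hd => ?_, fun x hx => (hball (by linarith [hη.2])).1⟩
      have h4 := hball (y := b') (by rw [dist_comm]; linarith [hη.2])
      by_contra hne'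
      refine h4.2 ⟨⟨hb', ?_⟩, fun h => hne' h.symm⟩
      rw [mem_preimage, h4.1.1]; exact hb.2
    obtain ⟨η, hη, hη0⟩ := (((eventually_all_finite hfin).2 hloc).and self_mem_nhdsWithin).exists
    refine ⟨η, hη0, ?_⟩
    have := htrans (fun b => (∀ b' ∈ B, dist b b' < 2 * η → b = b') ∧
          ∀ x, dist x b < η → L.retr x = L.retr b ∧ x ∉ range L.h) hη (by
      intro b m ⟨h1, h2⟩
      constructor
      · intro b' hb' hd
        refine (L.τ ^ m).injective (h1 _ (hG.tau_mem_boundedAbove m hb') ?_)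
        rwa [(L.τ ^ m).dist_eq]
      · intro x hx
        have := h2 ((L.τ ^ m) x) (by rwa [(L.τ ^ m).dist_eq])
        rwa [retr_tau_zpow, retr_tau_zpow, tau_zpow_mem_range_iff, add_left_inj] at this)
    exact ⟨fun b hb => (this b hb).1, fun b hb => (this b hb).2⟩
  -- Points δ-close to b have images η-close to G b. With the 2η-separation of B, a point of B close
  -- to the image of such a point can only be G b.
  obtain ⟨δ, hδ, hδη, hδG⟩ : ∃ δ > 0, δ ≤ η ∧ ∀ b ∈ B, ∀ x, dist x b < δ → dist (G x) (G b) < η := by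
    have hloc : ∀ b ∈ B ∩ L.retr ⁻¹' Icc 0 1, ∀ᶠ δ in 𝓝[>] (0 : ℝ),
        ∀ x, dist x b < δ → dist (G x) (G b) < η := by
      intro b hb
      obtain ⟨ε, hε, hball⟩ := Metric.continuousAt_iff.1 hG.continuous.continuousAt η hη
      filter_upwards [Ioo_mem_nhdsGT hε] with δ hδ x hx
      exact hball (hx.trans hδ.2)
    obtain ⟨δ, hδ, hδ0⟩ := (((eventually_all_finite hfin).2 hloc).and (Ioo_mem_nhdsGT hη)).exists
    refine ⟨δ, hδ0.1, hδ0.2.le, htrans _ hδ ?_⟩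
    intro b m h1 x hx
    have := h1 ((L.τ ^ m) x) (by rwa [(L.τ ^ m).dist_eq])
    rwa [hG.map_tau_zpow, hG.map_tau_zpow, (L.τ ^ m).dist_eq] at this
  -- The nearby points of B form a single orbit by separation. Since the retraction agrees with
  -- theirs at each time, the orbit of v is bounded above too.
  have hshadow : ∀ v ∈ L.TR G, (∀ i, ∃ b ∈ B, dist (G^[i + 1] v) b < δ) → v ∈ B := by
    intro v hv h
    choose b hbB hb using h
    have hbs : ∀ i, b i = G^[i] (b 0) := by
      intro i
      induction i with
      | zero => rfl
      | succ i ih =>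
        rw [Function.iterate_succ_apply', ← ih]
        refine hη1 _ (hbB _) _ (hG.map_mem_boundedAbove (hbB i)) ?_
        have h1 := hδG _ (hbB i) _ (hb i)
        rw [← Function.iterate_succ_apply' G] at h1
        have h2 := hb (i + 1)
        have h3 := dist_triangle_left (b (i + 1)) (G (b i)) (G^[i + 1 + 1] v)
        linarith
    obtain ⟨c, hc⟩ := (hbB 0).2
    refine mem_boundedAbove_of_map hv ⟨hG.map_mem_TR hv, c, fun i => ?_⟩
    rw [← Function.iterate_succ_apply, (hη2 _ (hbB i) _ ((hb i).trans_le hδη)).1, hbs]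
    exact hc i
  -- Points of T_ℝ away from B. By shadowing, each of them has a forward iterate away from B, within
  -- a time uniform in the point.
  set K := L.TR G \ Metric.thickening (δ / 2) B with hK
  have hdistτ : ∀ (m : ℤ) z ε, (L.τ ^ m) z ∈ Metric.thickening ε B → z ∈ Metric.thickening ε B := by
    intro m z ε hz
    obtain ⟨b, hb, hd⟩ := Metric.mem_thickening_iff.1 hz
    refine Metric.mem_thickening_iff.2 ⟨(L.τ ^ (-m)) b, hG.tau_mem_boundedAbove _ hb, ?_⟩
    rwa [← (L.τ ^ m).dist_eq, tau_zpow_apply_neg]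
  have hclosed : IsClosed K := isClosed_TR.sdiff Metric.isOpen_thickening
  have hKτ : ∀ (m : ℤ) z, z ∈ K → (L.τ ^ m) z ∈ K := fun m z hz =>
    ⟨hG.tau_zpow_mem_TR m hz.1, fun h => hz.2 (hdistτ m z _ h)⟩
  obtain ⟨N, hN⟩ := L.exists_uniform_bound hclosed hKτ
    (O := fun i => {v | G^[i + 1] v ∉ Metric.cthickening (δ / 2) B})
    (fun i => Metric.isClosed_cthickening.isOpen_compl.preimage (hG.continuous.iterate (i + 1)))
    (fun i m z hz hz' => by
      refine hz ?_
      rw [(hG.iterate (i + 1)).map_tau_zpow]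
      rw [Metric.cthickening_eq_iInter_thickening (by positivity)] at hz' ⊢
      refine mem_iInter₂.2 fun ε hε => hdistτ (-m) _ _ ?_
      rw [tau_zpow_neg_apply]
      exact mem_iInter₂.1 hz' ε hε)
    (fun z hz => by
      by_contra! hcon
      refine hz.2 (Metric.self_subset_thickening (half_pos hδ) _ (hshadow z hz.1 fun i => ?_))
      have h1 : G^[i + 1] z ∈ Metric.cthickening (δ / 2) B := not_not.1 (hcon i)
      exact Metric.mem_thickening_iff.1
        (Metric.cthickening_subset_thickening' hδ (half_lt_self hδ) _ h1))
  -- At any time m, a line orbit has visited K during the last N steps, because line points start in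
  -- K and the return times to K are uniformly bounded.
  have hcover : ∀ y m, ∃ k ≤ m, m ≤ k + N ∧ G^[k] (L.h y) ∈ K := by
    intro y m
    induction m with
    | zero =>
      refine ⟨0, le_rfl, Nat.zero_le _, range_subset_TR (mem_range_self y), fun h => ?_⟩
      obtain ⟨b, hb, hd⟩ := Metric.mem_thickening_iff.1 h
      exact (hη2 b hb (L.h y) (hd.trans (by linarith))).2 (mem_range_self y)
    | succ m ih =>
      obtain ⟨k, hkm, hmk, hk⟩ := ih
      rcases Nat.lt_or_ge m (k + N) with h | h
      · exact ⟨k, by omega, by omega, hk⟩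
      · obtain ⟨i, hi, hv⟩ := hN _ hk
        by_cases hle : k + (i + 1) ≤ m + 1
        · refine ⟨i + 1 + k, by omega, by omega, ?_⟩
          rw [Function.iterate_add_apply]
          exact ⟨hG.iterate_mem_TR hk.1 _, fun h =>
            hv (Metric.thickening_subset_cthickening _ _ h)⟩
        · omega
  obtain ⟨M, hM0, hM⟩ := hG.exists_bound
  obtain ⟨z, hz⟩ := hne
  -- All points of the line orbit that retract near z arise from a compact part of K in at most N
  -- steps. Hence z itself does, and its origin in K would belong to B, contradicting the definition
  -- of K.
  set D := ⋃ k ∈ Finset.range (N + 1), G^[k] '' (K ∩ L.retr ⁻¹' Icc (L.retr z - 1 - k * M)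
    (L.retr z + 1 + k * M)) with hD
  have hDclosed : IsClosed D := by
    refine isClosed_biUnion_finset fun k _ => IsCompact.isClosed ?_
    exact ((L.isCompact_retr_preimage _ _).inter_left hclosed).image (hG.continuous.iterate k)
  have hsub : L.lineOrbit G ∩ {w | L.retr w ∈ Ioo (L.retr z - 1) (L.retr z + 1)} ⊆ D := by
    rintro w ⟨hw, hwz⟩
    obtain ⟨m, _, ⟨y, rfl⟩, rfl⟩ := mem_iUnion.1 hw
    obtain ⟨k, hkm, hmk, hk⟩ := hcover y m
    refine mem_biUnion (x := m - k) (by simp; omega) ⟨G^[k] (L.h y), ⟨hk, ?_⟩, ?_⟩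
    · have h1 := abs_le.1 (IsDegreeOne.abs_iterate_le hM (m - k) (G^[k] (L.h y)))
      rw [← Function.iterate_add_apply, Nat.sub_add_cancel hkm] at h1
      have h2 : L.retr (G^[m] (L.h y)) ∈ Ioo (L.retr z - 1) (L.retr z + 1) := hwz
      exact ⟨by linarith [h2.1], by linarith [h2.2]⟩
    · rw [← Function.iterate_add_apply, Nat.sub_add_cancel hkm]
  have hzD : z ∈ D := by
    have hopen : IsOpen {w | L.retr w ∈ Ioo (L.retr z - 1) (L.retr z + 1)} :=
      isOpen_Ioo.preimage L.continuous_retr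
    have h1 : z ∈ closure (L.lineOrbit G ∩ {w | L.retr w ∈ Ioo (L.retr z - 1) (L.retr z + 1)}) :=
      hopen.closure_inter ⟨hz.1, by constructor <;> linarith⟩
    exact closure_minimal hsub hDclosed h1
  obtain ⟨k, -, v, ⟨hvK, -⟩, hv⟩ := mem_iUnion₂.1 hzD
  exact hvK.2 (Metric.self_subset_thickening (half_pos hδ) _
    (hG.mem_boundedAbove_of_iterate hvK.1 k (hv ▸ hz)))

end LocallyConnected

end LiftedGraph

/-! ### Rotation numbers of the line and of T_ℝ -/

namespace LiftedGraph

variable {T : Type*} [MetricSpace T] {L : LiftedGraph T} {F G : T → T}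

theorem hasRotationNumber_reflect {x : T} {ρ : ℝ} :
    L.reflect.HasRotationNumber F x (-ρ) ↔ L.HasRotationNumber F x ρ := by
  have h : (fun n : ℕ => (L.reflect.retr (F^[n] x) - L.reflect.retr x) / (n : ℝ)) =
      fun n : ℕ => -((L.retr (F^[n] x) - L.retr x) / (n : ℝ)) := by
    funext n
    rw [retr_reflect, retr_reflect]; ring
  rw [HasRotationNumber, HasRotationNumber, h]
  exact ⟨fun h => by simpa using h.neg, fun h => h.neg⟩

/-- The map `x ↦ F^q(x) - p`, where `r = p / q`. -/
def powerMap (L : LiftedGraph T) (F : T → T) (r : ℚ) (x : T) : T :=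
  (L.τ ^ (-r.num)) (F^[r.den] x)

theorem IsDegreeOne.powerMap (hF : L.IsDegreeOne F) (r : ℚ) :
    L.IsDegreeOne (L.powerMap F r) := (hF.iterate r.den).translate (-r.num)

theorem IsDegreeOne.powerMap_iterate (hF : L.IsDegreeOne F) (r : ℚ) (n : ℕ) (x : T) :
    (L.powerMap F r)^[n] x = (L.τ ^ (-(n * r.num))) (F^[r.den * n] x) := by
  have := (hF.iterate r.den).translate_iterate (-r.num) n x
  rw [← Function.iterate_mul, mul_neg] at this
  exact this

theorem IsDegreeOne.iterate_mul_eq (hF : L.IsDegreeOne F) {k : ℕ} {m : ℤ} {x : T}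
    (h : F^[k] x = (L.τ ^ m) x) (n : ℕ) : F^[k * n] x = (L.τ ^ (n * m)) x := by
  induction n with
  | zero => simp
  | succ n ih =>
    rw [mul_add, mul_one, add_comm, Function.iterate_add_apply, ih, (hF.iterate k).map_tau_zpow, h,
      ← tau_zpow_add]
    congr 2
    push_cast; ring

theorem IsDegreeOne.hasRotationNumber_powerMap (hF : L.IsDegreeOne F) {r : ℚ} {x : T} {ρ : ℝ}
    (h : L.HasRotationNumber F x ρ) :
    L.HasRotationNumber (L.powerMap F r) x (r.den * ρ - r.num) := by
  have hd : (0 : ℝ) < r.den := by exact_mod_cast r.den_pos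
  have h1 : Tendsto (fun n : ℕ => r.den * n) atTop atTop :=
    tendsto_id.const_mul_atTop' r.den_pos
  have h2 := ((h.comp h1).const_mul (r.den : ℝ)).sub_const (r.num : ℝ)
  refine h2.congr' ?_
  filter_upwards [eventually_ge_atTop 1] with n hn
  have hn0 : (n : ℝ) ≠ 0 := by exact_mod_cast (by omega : n ≠ 0)
  rw [hF.powerMap_iterate, retr_tau_zpow]
  simp only [Function.comp]
  push_cast
  field_simp
  ring

section LocallyConnected

variable [LocallyConnectedSpace T]

theorem IsDegreeOne.hasRotationNumber_of_periodic (hF : L.IsDegreeOne F) {k : ℕ} (hk : 0 < k)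
    {m : ℤ} {x : T} (h : F^[k] x = (L.τ ^ m) x) : L.HasRotationNumber F x (m / k) := by
  obtain ⟨M, -, hM⟩ := hF.exists_bound
  have hk0 : (k : ℝ) ≠ 0 := by exact_mod_cast hk.ne'
  refine tendsto_div_of_tendsto_div_subseq (a := fun n => L.retr (F^[n] x) - L.retr x) (M := M)
    (fun n => ?_) (Q := fun n => k * n) (by simp) (fun a b hab => Nat.mul_lt_mul_of_pos_left hab hk)
    ?_ ?_
  · rw [sub_sub_sub_cancel_right, Function.iterate_succ_apply']
    exact hM _
  · refine tendsto_const_nhds.congr' ?_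
    filter_upwards [eventually_ge_atTop 1] with n hn
    have hn0 : (n : ℝ) ≠ 0 := by exact_mod_cast (by omega : n ≠ 0)
    rw [hF.iterate_mul_eq h, retr_tau_zpow]
    push_cast
    field_simp
    ring
  · have h1 : Tendsto (fun n : ℕ => 1 / (n : ℝ)) atTop (𝓝 0) := tendsto_one_div_atTop_nhds_zero_nat
    refine h1.congr' ?_
    filter_upwards [eventually_ge_atTop 1] with n hn
    have hn0 : (n : ℝ) ≠ 0 := by exact_mod_cast (by omega : n ≠ 0)
    push_cast
    field_simp
    ring

/-- The iterates of `F` follow those of `x ↦ F^q(x) - p`, up to a linear term. -/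
theorem IsDegreeOne.exists_powerMap_bound (hF : L.IsDegreeOne F) (r : ℚ) :
    ∃ C : ℝ, ∀ x m, |L.retr (F^[m] x) - L.retr ((L.powerMap F r)^[m / r.den] x) - r * m| ≤ C := by
  obtain ⟨M, hM0, hM⟩ := hF.exists_bound
  refine ⟨r.den * M + |(r.num : ℝ)|, fun x m => ?_⟩
  rw [hF.powerMap_iterate, retr_tau_zpow]
  set n := m / r.den with hn
  have hd : (0 : ℝ) < r.den := by exact_mod_cast r.den_pos
  have hm : m = m % r.den + r.den * n := (Nat.mod_add_div m r.den).symm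
  have hs : m % r.den < r.den := Nat.mod_lt _ r.den_pos
  have h1 := IsDegreeOne.abs_iterate_le hM (m % r.den) (F^[r.den * n] x)
  rw [← Function.iterate_add_apply, ← hm] at h1
  have h2 : ((m % r.den : ℕ) : ℝ) * M ≤ r.den * M :=
    mul_le_mul_of_nonneg_right (by exact_mod_cast hs.le) hM0
  have h3 : (r : ℝ) * m = r.num / r.den * ((m % r.den : ℕ) : ℝ) + n * r.num := by
    have h4 : (m : ℝ) = ((m % r.den : ℕ) : ℝ) + r.den * n := by exact_mod_cast hm
    rw [h4, Rat.cast_def]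
    field_simp
  have h5 : |(r.num : ℝ) / r.den * ((m % r.den : ℕ) : ℝ)| ≤ |(r.num : ℝ)| := by
    rw [abs_mul, abs_div, abs_of_pos hd, abs_of_nonneg (show (0 : ℝ) ≤ ((m % r.den : ℕ) : ℝ) from Nat.cast_nonneg _),
      div_mul_eq_mul_div, div_le_iff₀ hd]
    exact mul_le_mul_of_nonneg_left (by exact_mod_cast hs.le) (abs_nonneg _)
  have h6 : L.retr (F^[m] x) - (L.retr (F^[r.den * n] x) + ((-(n * r.num) : ℤ) : ℝ)) - r * m =
      (L.retr (F^[m] x) - L.retr (F^[r.den * n] x)) -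
        r.num / r.den * ((m % r.den : ℕ) : ℝ) := by
    rw [h3]; push_cast; ring
  rw [h6]
  have h7 := abs_sub (L.retr (F^[m] x) - L.retr (F^[r.den * n] x))
    ((r.num : ℝ) / r.den * ((m % r.den : ℕ) : ℝ))
  linarith

/-- The iterates of the line increase with the exponent, so using only multiples of q, and
translating, does not change their union. -/
theorem IsDegreeOne.TR_powerMap (hF : L.IsDegreeOne F) (r : ℚ) :
    L.TR (L.powerMap F r) = L.TR F := by
  have h : L.lineOrbit (L.powerMap F r) = L.lineOrbit F := by
    apply subset_antisymm
    · refine iUnion_subset fun n => ?_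
      rintro _ ⟨x, hx, rfl⟩
      rw [hF.powerMap_iterate, ← (hF.iterate _).map_tau_zpow]
      exact mem_iUnion.2 ⟨_, _, (L.tau_zpow_mem_range_iff _ _).2 hx, rfl⟩
    · refine iUnion_subset fun n => ?_
      intro y hy
      obtain ⟨x, hx, rfl⟩ := hF.image_subset_image (Nat.le_mul_of_pos_left n r.den_pos) hy
      refine mem_iUnion.2 ⟨n, (L.τ ^ (n * r.num)) x, (L.tau_zpow_mem_range_iff _ _).2 hx, ?_⟩
      rw [hF.powerMap_iterate, (hF.iterate _).map_tau_zpow, tau_zpow_neg_apply]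
  exact congrArg closure h

theorem IsDegreeOne.periodic_of_powerMap (hF : L.IsDegreeOne F) {r : ℚ} {n : ℕ} (hn : 0 < n) {z : T}
    (h : (L.powerMap F r)^[n] z = z) :
    L.IsPeriodicModOne F z ∧ L.HasRotationNumber F z r := by
  have h1 : F^[r.den * n] z = (L.τ ^ (n * r.num)) z := by
    rw [hF.powerMap_iterate] at h
    rw [← L.tau_zpow_apply_neg (n * r.num) (F^[r.den * n] z), h]
  have hpos : 0 < r.den * n := Nat.mul_pos r.den_pos hn
  refine ⟨⟨_, hpos, _, h1⟩, ?_⟩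
  have h2 := hF.hasRotationNumber_of_periodic hpos h1
  have hd : (r.den : ℝ) ≠ 0 := by exact_mod_cast r.den_pos.ne'
  have hn0 : (n : ℝ) ≠ 0 := by exact_mod_cast hn.ne'
  convert h2 using 1
  rw [Rat.cast_def]
  push_cast
  field_simp

theorem IsDegreeOne.exists_bounded_of_rotation_nonpos (hG : L.IsDegreeOne G) {x : T}
    (hx : x ∈ L.TR G) {ρ : ℝ} (hρ : ρ ≤ 0) (h : L.HasRotationNumber G x ρ) :
    ∃ y c, ∀ i, L.retr (G^[i] (L.h y)) ≤ c :=
  hG.exists_bounded_of_boundedAbove (hG.boundedAbove_nonempty hx hρ h)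

/-- If there is no fixed point on the line, the line moves in one direction; rotation number 0
produces a line orbit bounded on that side. The leftward case is the rightward one for the reflected
line. -/
theorem IsDegreeOne.exists_periodic_of_rotation_zero [ConnectedSpace T] (hG : L.IsDegreeOne G) {x : T}
    (hx : x ∈ L.TR G) (h : L.HasRotationNumber G x 0) : ∃ z, ∃ n, 0 < n ∧ G^[n] z = z := by
  rcases hG.exists_fixed_or with ⟨y, hy⟩ | h1 | h1
  · exact ⟨_, 1, one_pos, hy⟩
  · obtain ⟨y, c, hyc⟩ := hG.exists_bounded_of_rotation_nonpos hx le_rfl h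
    exact hG.exists_periodic_of_bounded h1 hyc
  · have h' : L.reflect.HasRotationNumber G x 0 := by
      have := hasRotationNumber_reflect.2 h
      rwa [neg_zero] at this
    obtain ⟨y, c, hyc⟩ := hG.reflect.exists_bounded_of_rotation_nonpos (L.TR_reflect G ▸ hx) le_rfl h'
    refine hG.reflect.exists_periodic_of_bounded (fun y => ?_) hyc
    rw [retr_reflect]
    have := h1 (-y)
    show y < -L.retr (G (L.h (-y)))
    linarith

/-- A rational rotation number of a point of `T_ℝ` is the rotation number of a periodic point. -/
theorem IsDegreeOne.exists_periodicModOne [ConnectedSpace T] (hF : L.IsDegreeOne F) {x : T}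
    (hx : x ∈ L.TR F) {r : ℚ} (h : L.HasRotationNumber F x r) :
    ∃ z, L.IsPeriodicModOne F z ∧ L.HasRotationNumber F z r := by
  have h0 := hF.hasRotationNumber_powerMap (r := r) h
  have hd : (r.den : ℝ) ≠ 0 := by exact_mod_cast r.den_pos.ne'
  rw [Rat.cast_def, mul_div_cancel₀ _ hd, sub_self] at h0
  obtain ⟨z, n, hn, hz⟩ :=
    (hF.powerMap r).exists_periodic_of_rotation_zero ((hF.TR_powerMap r).symm ▸ hx) h0
  exact ⟨z, hF.periodic_of_powerMap hn hz⟩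

/-- A path crossing the part `[y₁, y₂]` of the line contains a subpath from one endpoint to the
other that stays over `[y₁, y₂]`. -/
theorem exists_crossing {g : ℝ → T} (hg : Continuous g) {u v y₁ y₂ : ℝ} (huv : u ≤ v)
    (hy : y₁ < y₂) (hu : L.retr (g u) ≤ y₁) (hv : y₂ ≤ L.retr (g v)) :
    ∃ a b, u ≤ a ∧ a < b ∧ b ≤ v ∧ g a = L.h y₁ ∧ g b = L.h y₂ ∧
      ∀ t ∈ Icc a b, L.retr (g t) ∈ Icc y₁ y₂ := by
  have hf : Continuous fun t => L.retr (g t) := L.continuous_retr.comp hg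
  -- Here b is the first time over y₂, and a will be the last time before b over y₁. At both times
  -- the retraction is not locally constant along the path, so the path is on the line itself.
  obtain ⟨b, ⟨hb, hb'⟩, hbmin⟩ := (isCompact_Icc.inter_right
    (isClosed_le continuous_const hf)).exists_isLeast (s := Icc u v ∩ {t | y₂ ≤ L.retr (g t)})
    ⟨v, ⟨huv, le_rfl⟩, hv⟩
  have hblt : ∀ t ∈ Ico u b, L.retr (g t) < y₂ := fun t ht => by
    by_contra! hcon
    exact absurd (hbmin ⟨⟨ht.1, ht.2.le.trans hb.2⟩, hcon⟩) (not_le.2 ht.2)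
  have hub : u < b := lt_of_le_of_ne hb.1 (by
    rintro rfl
    have : y₂ ≤ L.retr (g u) := hb'
    linarith)
  have hfb : L.retr (g b) = y₂ := by
    refine le_antisymm ?_ hb'
    exact le_of_tendsto ((hf.tendsto b).mono_left (nhdsWithin_le_nhds (s := Iio b)))
      (by filter_upwards [Ioo_mem_nhdsLT hub] with t ht; exact (hblt t ⟨ht.1.le, ht.2⟩).le)
  have hgb : g b = L.h y₂ := by
    rw [← hfb, L.h_retr]
    refine mem_range_of_frequently hg (Frequently.filter_mono ?_ (nhdsWithin_le_nhds (s := Iio b)))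
    refine Eventually.frequently ?_
    filter_upwards [Ioo_mem_nhdsLT hub] with t ht
    rw [hfb]
    exact (hblt t ⟨ht.1.le, ht.2⟩).ne
  obtain ⟨a, ⟨ha, ha'⟩, hamax⟩ := (isCompact_Icc.inter_right
    (isClosed_le hf continuous_const)).exists_isGreatest (s := Icc u b ∩ {t | L.retr (g t) ≤ y₁})
    ⟨u, ⟨le_rfl, hub.le⟩, hu⟩
  have hagt : ∀ t ∈ Ioc a b, y₁ < L.retr (g t) := fun t ht => by
    by_contra! hcon
    exact absurd (hamax ⟨⟨ha.1.trans ht.1.le, ht.2⟩, hcon⟩) (not_le.2 ht.1)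
  have hab : a < b := lt_of_le_of_ne ha.2 (by
    rintro rfl
    have : L.retr (g a) ≤ y₁ := ha'
    linarith)
  have hfa : L.retr (g a) = y₁ := by
    refine le_antisymm ha' ?_
    refine ge_of_tendsto ((hf.tendsto a).mono_left (nhdsWithin_le_nhds (s := Ioi a))) ?_
    filter_upwards [Ioo_mem_nhdsGT hab] with t ht
    exact (hagt t ⟨ht.1, ht.2.le⟩).le
  have hga : g a = L.h y₁ := by
    rw [← hfa, L.h_retr]
    refine mem_range_of_frequently hg (Frequently.filter_mono ?_ (nhdsWithin_le_nhds (s := Ioi a)))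
    refine Eventually.frequently ?_
    filter_upwards [Ioo_mem_nhdsGT hab] with t ht
    rw [hfa]
    exact (hagt t ⟨ht.1, ht.2.le⟩).ne'
  refine ⟨a, b, ha.1, hab, hb.2, hga, hgb, fun t ht => ⟨?_, ?_⟩⟩
  · rcases ht.1.eq_or_lt with rfl | h
    · exact hfa.ge
    · exact (hagt t ⟨h, ht.2⟩).le
  · rcases ht.2.eq_or_lt with rfl | h
    · exact hfb.le
    · exact (hblt t ⟨ha.1.trans ht.1, h⟩).le

/-- The pairs `(q, p)` such that the image of `[0, 2]` under `F^q` crosses `[p, p + 2]` from the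
left to the right. -/
def lineCovers (L : LiftedGraph T) (F : T → T) : Set (ℕ × ℤ) :=
  {l | 0 < l.1 ∧ ∃ u v : ℝ, 0 ≤ u ∧ u < v ∧ v ≤ 2 ∧ L.retr (F^[l.1] (L.h u)) ≤ l.2 ∧
    l.2 + 2 ≤ L.retr (F^[l.1] (L.h v))}

/-- The crossings compose: F^(q_0 + … + q_(n-1)) carries some subinterval of [0, 2] across [P n, P n
+ 2]. A point common to the nested subintervals follows the schedule with bounded error. -/
theorem IsDegreeOne.exists_hasRotationNumber_of_mem_closure (hF : L.IsDegreeOne F) {α : ℝ}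
    (hα : α ∈ closure (means (L.lineCovers F))) : ∃ y, L.HasRotationNumber F (L.h y) α := by
  obtain ⟨l, hl, hsched⟩ := exists_schedule (fun l hl => hl.1) hα
  set Q : ℕ → ℕ := fun n => ∑ i ∈ Finset.range n, (l i).1 with hQ
  set P : ℕ → ℤ := fun n => ∑ i ∈ Finset.range n, (l i).2 with hP
  let S : ℕ → ℝ × ℝ → Prop := fun n ab => ab.1 < ab.2 ∧ F^[Q n] (L.h ab.1) = L.h (P n) ∧
    F^[Q n] (L.h ab.2) = L.h (P n + 2) ∧
    ∀ t ∈ Icc ab.1 ab.2, L.retr (F^[Q n] (L.h t)) ∈ Icc (P n : ℝ) (P n + 2)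
  have hstep : ∀ n ab, S n ab → ∃ ab', S (n + 1) ab' ∧ Icc ab'.1 ab'.2 ⊆ Icc ab.1 ab.2 := by
    rintro n ⟨a, b⟩ ⟨hab, ha, hb, -⟩
    obtain ⟨-, u, v, hu0, huv, hv2, hu, hv⟩ := hl n
    obtain ⟨u', v', hau, huv', hvb, hgu, hgv, -⟩ := exists_crossing
      (g := fun t => F^[Q n] (L.h t)) ((hF.continuous.iterate _).comp L.continuous_h) hab.le
      (y₁ := P n + u) (y₂ := P n + v) (by linarith) (by simp only at ha ⊢; rw [ha, retr_h]; linarith)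
      (by simp only at hb ⊢; rw [hb, retr_h]; linarith)
    have hgu' : L.retr (F^[Q (n + 1)] (L.h u')) = L.retr (F^[(l n).1] (L.h u)) + P n := by
      rw [hQ]; simp only
      rw [Finset.sum_range_succ, add_comm, Function.iterate_add_apply]
      rw [hgu, add_comm (P n : ℝ) u, (hF.iterate _).retr_map_add]
    have hgv' : L.retr (F^[Q (n + 1)] (L.h v')) = L.retr (F^[(l n).1] (L.h v)) + P n := by
      rw [hQ]; simp only
      rw [Finset.sum_range_succ, add_comm, Function.iterate_add_apply]
      rw [hgv, add_comm (P n : ℝ) v, (hF.iterate _).retr_map_add]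
    have hPs : (P (n + 1) : ℝ) = P n + (l n).2 := by
      rw [hP]; simp only
      rw [Finset.sum_range_succ]; push_cast; ring
    obtain ⟨a', b', hua, hab', hbv, hga, hgb, hin⟩ := exists_crossing
      (g := fun t => F^[Q (n + 1)] (L.h t)) ((hF.continuous.iterate _).comp L.continuous_h) huv'.le
      (y₁ := P (n + 1)) (y₂ := P (n + 1) + 2) (by linarith)
      (by rw [hgu', hPs]; linarith) (by rw [hgv', hPs]; linarith)
    exact ⟨(a', b'), ⟨hab', hga, hgb, hin⟩, Icc_subset_Icc (hau.trans hua) (hbv.trans hvb)⟩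
  choose! f hf hfsub using hstep
  let seq : ℕ → ℝ × ℝ := fun n => Nat.rec (0, 2) (fun n ab => f n ab) n
  have hseq : ∀ n, S n (seq n) := by
    intro n
    induction n with
    | zero =>
      refine ⟨by simp [seq], by simp [seq, hQ, hP], by simp [seq, hQ, hP], ?_⟩
      intro t ht
      simpa [seq, hQ, hP, retr_h] using ht
    | succ n ih => exact hf n _ ih
  obtain ⟨y, hy⟩ := IsCompact.nonempty_iInter_of_sequence_nonempty_isCompact_isClosed
    (fun n => Icc (seq n).1 (seq n).2) (fun n => hfsub n _ (hseq n))
    (fun n => nonempty_Icc.2 (hseq n).1.le) isCompact_Icc (fun n => isClosed_Icc)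
  have hyn := fun n => mem_iInter.1 hy n
  have hy0 : 0 ≤ y ∧ y ≤ 2 := hyn 0
  obtain ⟨M, -, hM⟩ := hF.exists_bound
  refine ⟨y, hsched _ M 4 (fun m => ?_) (fun n => ?_)⟩
  · rw [sub_sub_sub_cancel_right, Function.iterate_succ_apply']
    exact hM _
  · have h1 := (hseq n).2.2.2 y (hyn n)
    rw [retr_h, abs_le]
    have h2 : (P n : ℝ) ≤ L.retr (F^[Q n] (L.h y)) := h1.1
    have h3 : L.retr (F^[Q n] (L.h y)) ≤ P n + 2 := h1.2
    constructor <;> linarith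

/-- Some point of the line is periodic (mod 1) on the line with rotation number `r`. -/
def HasLinePeriodic (L : LiftedGraph T) (F : T → T) (r : ℝ) : Prop :=
  ∃ k : ℕ, 0 < k ∧ ∃ m : ℤ, ∃ z, F^[k] (L.h z) = (L.τ ^ m) (L.h z) ∧ (m : ℝ) / k = r

end LocallyConnected

/-- Two points of the line with speeds r < s separate linearly, so after a long time the arc between
them crosses an interval of length 2 translated at any intermediate speed. -/
theorem IsDegreeOne.mem_closure_means_of_linePeriodic (hF : L.IsDegreeOne F) {r s α : ℝ}
    (hr : L.HasLinePeriodic F r) (hs : L.HasLinePeriodic F s) (hα : α ∈ Ioo r s) :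
    α ∈ closure (means (L.lineCovers F)) := by
  obtain ⟨k₁, hk₁, m₁, z₁, hz₁, rfl⟩ := hr
  obtain ⟨k₂, hk₂, m₂, z₂, hz₂, rfl⟩ := hs
  have hmove : ∀ {k : ℕ} {m : ℤ} {z : ℝ}, F^[k] (L.h z) = (L.τ ^ m) (L.h z) → ∀ (i : ℤ) (n : ℕ),
      L.retr (F^[k * n] (L.h (z + i))) = z + i + n * m := by
    intro k m z h i n
    rw [(hF.iterate _).retr_map_add, hF.iterate_mul_eq h, retr_tau_zpow, retr_h]
    push_cast; ring
  have hk₁' : (0 : ℝ) < k₁ := by exact_mod_cast hk₁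
  have hk₂' : (0 : ℝ) < k₂ := by exact_mod_cast hk₂
  set K := k₁ * k₂ with hK
  have hK0 : (0 : ℝ) < K := by rw [hK]; push_cast; positivity
  have e1 : (k₂ : ℝ) * m₁ < K * α := by
    have := (div_lt_iff₀ hk₁').1 hα.1
    rw [hK]; push_cast
    nlinarith
  have e2 : K * α < (k₁ : ℝ) * m₂ := by
    have := (lt_div_iff₀ hk₂').1 hα.2
    rw [hK]; push_cast
    nlinarith
  rw [Metric.mem_closure_iff]
  intro ε hε
  obtain ⟨n, hn, hn1, hn2, hn3⟩ : ∃ n : ℕ, 0 < n ∧ n * ((k₂ : ℝ) * m₁) + 2 ≤ n * (K * α) ∧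
      n * (K * α) + 1 ≤ n * ((k₁ : ℝ) * m₂) ∧ 1 < n * (K * ε) := by
    obtain ⟨n₁, h1⟩ := exists_nat_gt (2 / (K * α - k₂ * m₁))
    obtain ⟨n₂, h2⟩ := exists_nat_gt (1 / (k₁ * m₂ - K * α))
    obtain ⟨n₃, h3⟩ := exists_nat_gt (1 / (K * ε))
    rw [div_lt_iff₀ (by linarith)] at h1 h2
    rw [div_lt_iff₀ (by positivity)] at h3
    refine ⟨n₁ + n₂ + n₃ + 1, by omega, ?_, ?_, ?_⟩
    · have : (0 : ℝ) ≤ (n₂ + n₃ + 1) * (K * α - k₂ * m₁) :=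
        mul_nonneg (by positivity) (by linarith)
      push_cast; nlinarith
    · have : (0 : ℝ) ≤ (n₁ + n₃ + 1) * (k₁ * m₂ - K * α) :=
        mul_nonneg (by positivity) (by linarith)
      push_cast; nlinarith
    · have : (0 : ℝ) ≤ (n₁ + n₂ + 1) * (K * ε) := by positivity
      push_cast; nlinarith
  have hn0 : (0 : ℝ) < n := by exact_mod_cast hn
  have hfl := Int.floor_le (n * (K * α))
  have hfl' := Int.lt_floor_add_one (n * (K * α))
  -- The slower point is translated into [0, 1) and the faster one into [1, 2), so they are in the
  -- right order inside [0, 2]. This is why the covering intervals have length 2.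
  refine ⟨_, ⟨(K * n, ⌊n * (K * α)⌋), ⟨?_, Int.fract z₁, Int.fract z₂ + 1, Int.fract_nonneg _, ?_,
    ?_, ?_, ?_⟩, rfl⟩, ?_⟩
  · simp only; positivity
  · linarith [Int.fract_lt_one z₁, Int.fract_nonneg z₂]
  · linarith [Int.fract_lt_one z₂]
  · have := hmove hz₁ (-⌊z₁⌋) (k₂ * n)
    rw [← mul_assoc] at this
    have h4 : z₁ + ((-⌊z₁⌋ : ℤ) : ℝ) = Int.fract z₁ := by rw [Int.fract]; push_cast; ring
    rw [h4] at this
    rw [← hK] at this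
    push_cast at this
    show L.retr (F^[K * n] _) ≤ (⌊(n : ℝ) * (K * α)⌋ : ℝ)
    rw [this]
    linarith [Int.fract_lt_one z₁]
  · have := hmove hz₂ (-⌊z₂⌋ + 1) (k₁ * n)
    rw [← mul_assoc, mul_comm k₂ k₁] at this
    have h4 : z₂ + ((-⌊z₂⌋ + 1 : ℤ) : ℝ) = Int.fract z₂ + 1 := by rw [Int.fract]; push_cast; ring
    rw [h4] at this
    rw [← hK] at this
    push_cast at this
    show (⌊(n : ℝ) * (K * α)⌋ : ℝ) + 2 ≤ L.retr (F^[K * n] _)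
    rw [this]
    linarith [Int.fract_nonneg z₂]
  · rw [Real.dist_eq, abs_lt]
    push_cast
    have hKn : (0 : ℝ) < K * n := by positivity
    constructor
    · rw [neg_lt_sub_iff_lt_add, div_lt_iff₀ hKn]; nlinarith
    · rw [sub_lt_iff_lt_add, ← sub_lt_iff_lt_add', lt_div_iff₀ hKn]; nlinarith

section LocallyConnected

variable [LocallyConnectedSpace T]

/-- With no periodic point of G on the line, the direction in which G moves the line is inherited by
all its iterates. A rational is thus either attained on the line or bounds all rotation numbers of
the line from one side. -/
theorem IsDegreeOne.linePeriodic_or (hF : L.IsDegreeOne F) (r : ℚ) :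
    L.HasLinePeriodic F r ∨ (∀ n y, y ≤ L.retr ((L.powerMap F r)^[n] (L.h y))) ∨
      ∀ n y, L.retr ((L.powerMap F r)^[n] (L.h y)) ≤ y := by
  by_cases hfix : ∃ n, 0 < n ∧ ∃ y, (L.powerMap F r)^[n] (L.h y) = L.h y
  · left
    obtain ⟨n, hn, y, hy⟩ := hfix
    rw [hF.powerMap_iterate] at hy
    refine ⟨r.den * n, Nat.mul_pos r.den_pos hn, n * r.num, y, ?_, ?_⟩
    · conv_rhs => rw [← hy]
      rw [tau_zpow_apply_neg]
    · have hd : (r.den : ℝ) ≠ 0 := by exact_mod_cast r.den_pos.ne'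
      have hn0 : (n : ℝ) ≠ 0 := by exact_mod_cast hn.ne'
      rw [Rat.cast_def]
      push_cast
      field_simp
  · push Not at hfix
    right
    rcases (hF.powerMap r).exists_fixed_or with ⟨y, hy⟩ | h | h
    · exact absurd hy (hfix 1 one_pos y)
    · left
      intro n y
      rcases Nat.eq_zero_or_pos n with rfl | hn
      · simp [retr_h]
      · exact ((hF.powerMap r).lt_retr_iterate h hn (hfix n hn) y).le
    · right
      intro n y
      rcases Nat.eq_zero_or_pos n with rfl | hn
      · simp [retr_h]
      · have := (hF.powerMap r).reflect.lt_retr_iterate (fun y => by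
          rw [retr_reflect]
          have := h (-y)
          show y < -L.retr (L.powerMap F r (L.h (-y)))
          linarith) hn (fun y => hfix n hn (-y)) (-y)
        rw [retr_reflect] at this
        have h2 : L.reflect.h (-y) = L.h y := congrArg L.h (neg_neg y)
        rw [h2] at this
        linarith

/-- The set of rotation numbers of the points of the line. -/
def rotLine (L : LiftedGraph T) (F : T → T) : Set ℝ := {ρ | ∃ y, L.HasRotationNumber F (L.h y) ρ}

theorem IsDegreeOne.mem_rotLine_of_linePeriodic (hF : L.IsDegreeOne F) {r : ℝ}
    (h : L.HasLinePeriodic F r) : r ∈ L.rotLine F := by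
  obtain ⟨k, hk, m, z, hz, rfl⟩ := h
  exact ⟨z, hF.hasRotationNumber_of_periodic hk hz⟩

theorem tendsto_const_sub_div (a C : ℝ) :
    Tendsto (fun n : ℕ => a - C / (n : ℝ)) atTop (𝓝 a) := by
  have : Tendsto (fun n : ℕ => C / (n : ℝ)) atTop (𝓝 0) :=
    tendsto_const_nhds.div_atTop tendsto_natCast_atTop_atTop
  simpa using this.const_sub a

theorem IsDegreeOne.exists_le_of_powerMap (hF : L.IsDegreeOne F) {r : ℚ} {x : T} {c : ℝ}
    (h : ∀ n, c ≤ L.retr ((L.powerMap F r)^[n] x)) :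
    ∃ C : ℝ, ∀ m : ℕ, 0 < m → r - C / m ≤ (L.retr (F^[m] x) - L.retr x) / m := by
  obtain ⟨C, hC⟩ := hF.exists_powerMap_bound r
  refine ⟨C - c + L.retr x, fun m hm => ?_⟩
  have hm0 : (0 : ℝ) < m := by exact_mod_cast hm
  have h1 := (abs_le.1 (hC x m)).1
  have h2 := h (m / r.den)
  rw [sub_le_iff_le_add, ← add_div, le_div_iff₀ hm0]
  linarith

theorem IsDegreeOne.exists_ge_of_powerMap (hF : L.IsDegreeOne F) {r : ℚ} {x : T} {c : ℝ}
    (h : ∀ n, L.retr ((L.powerMap F r)^[n] x) ≤ c) :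
    ∃ C : ℝ, ∀ m : ℕ, 0 < m → (L.retr (F^[m] x) - L.retr x) / m ≤ r - C / m := by
  obtain ⟨C, hC⟩ := hF.exists_powerMap_bound r
  refine ⟨-C - c + L.retr x, fun m hm => ?_⟩
  have hm0 : (0 : ℝ) < m := by exact_mod_cast hm
  have h1 := (abs_le.1 (hC x m)).2
  have h2 := h (m / r.den)
  rw [le_sub_iff_add_le, ← add_div, div_le_iff₀ hm0]
  linarith

theorem IsDegreeOne.le_of_powerMap (hF : L.IsDegreeOne F) {r : ℚ} {x : T} {c ρ : ℝ}
    (h : ∀ n, c ≤ L.retr ((L.powerMap F r)^[n] x)) (hρ : L.HasRotationNumber F x ρ) : r ≤ ρ := by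
  obtain ⟨C, hC⟩ := hF.exists_le_of_powerMap h
  exact le_of_tendsto_of_tendsto (tendsto_const_sub_div r C) hρ
    ((eventually_gt_atTop 0).mono hC)

theorem IsDegreeOne.ge_of_powerMap (hF : L.IsDegreeOne F) {r : ℚ} {x : T} {c ρ : ℝ}
    (h : ∀ n, L.retr ((L.powerMap F r)^[n] x) ≤ c) (hρ : L.HasRotationNumber F x ρ) : ρ ≤ r := by
  obtain ⟨C, hC⟩ := hF.exists_ge_of_powerMap h
  exact le_of_tendsto_of_tendsto hρ (tendsto_const_sub_div r C)
    ((eventually_gt_atTop 0).mono hC)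

theorem IsDegreeOne.linePeriodic_of_mem_Ioo (hF : L.IsDegreeOne F) {α β : ℝ}
    (hα : α ∈ L.rotLine F) (hβ : β ∈ L.rotLine F) {r : ℚ} (hr : (r : ℝ) ∈ Ioo α β) :
    L.HasLinePeriodic F r := by
  obtain ⟨y, hy⟩ := hα
  obtain ⟨z, hz⟩ := hβ
  rcases hF.linePeriodic_or r with h | h | h
  · exact h
  · exact absurd (hF.le_of_powerMap (fun n => h n y) hy) (not_le.2 hr.1)
  · exact absurd (hF.ge_of_powerMap (fun n => h n z) hz) (not_le.2 hr.2)

theorem IsDegreeOne.Ioo_subset_closure_means (hF : L.IsDegreeOne F) {α β : ℝ}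
    (hα : α ∈ L.rotLine F) (hβ : β ∈ L.rotLine F) :
    Ioo α β ⊆ closure (means (L.lineCovers F)) := by
  intro x hx
  obtain ⟨r, hr1, hr2⟩ := exists_rat_btwn hx.1
  obtain ⟨s, hs1, hs2⟩ := exists_rat_btwn hx.2
  exact hF.mem_closure_means_of_linePeriodic
    (hF.linePeriodic_of_mem_Ioo hα hβ ⟨hr1, hr2.trans hx.2⟩)
    (hF.linePeriodic_of_mem_Ioo hα hβ ⟨hx.1.trans hs1, hs2⟩) ⟨hr2, hs1⟩

theorem IsDegreeOne.ordConnected_rotLine (hF : L.IsDegreeOne F) : (L.rotLine F).OrdConnected :=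
  ordConnected_of_Ioo fun _ hα _ hβ _ _ hx =>
    hF.exists_hasRotationNumber_of_mem_closure (hF.Ioo_subset_closure_means hα hβ hx)

/-- If there are two different rotation numbers, the whole set equals the closure of the means of
`lineCovers`, since each of its points is an endpoint of an open interval inside that closure. -/
theorem IsDegreeOne.isClosed_rotLine (hF : L.IsDegreeOne F) : IsClosed (L.rotLine F) := by
  by_cases hsub : (L.rotLine F).Subsingleton
  · exact hsub.finite.isClosed
  · rw [not_subsingleton_iff] at hsub
    have h1 : L.rotLine F ⊆ closure (means (L.lineCovers F)) := by
      intro α hα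
      obtain ⟨β, hβ, hne⟩ := hsub.exists_ne α
      rcases hne.lt_or_gt with h | h
      · have := closure_mono (hF.Ioo_subset_closure_means hβ hα)
        rw [closure_closure, closure_Ioo h.ne] at this
        exact this (right_mem_Icc.2 h.le)
      · have := closure_mono (hF.Ioo_subset_closure_means hα hβ)
        rw [closure_closure, closure_Ioo h.ne] at this
        exact this (left_mem_Icc.2 h.le)
    have h2 : L.rotLine F = closure (means (L.lineCovers F)) :=
      h1.antisymm fun α hα => hF.exists_hasRotationNumber_of_mem_closure hα
    rw [h2]
    exact isClosed_closure

theorem IsDegreeOne.exists_rotation_bound (hF : L.IsDegreeOne F) :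
    ∃ M : ℝ, ∀ x ρ, L.HasRotationNumber F x ρ → ρ ∈ Icc (-M) M := by
  obtain ⟨M, hM0, hM⟩ := hF.exists_bound
  refine ⟨M, fun x ρ h => ?_⟩
  have hev : ∀ᶠ n : ℕ in atTop, (L.retr (F^[n] x) - L.retr x) / (n : ℝ) ∈ Icc (-M) M := by
    filter_upwards [eventually_gt_atTop 0] with n hn
    have hn0 : (0 : ℝ) < n := by exact_mod_cast hn
    have h1 := abs_le.1 (IsDegreeOne.abs_iterate_le hM n x)
    exact ⟨by rw [le_div_iff₀ hn0]; linarith [h1.1], by rw [div_le_iff₀ hn0]; linarith [h1.2]⟩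
  exact isClosed_Icc.mem_of_tendsto h hev

/-- If no rational is attained by a periodic point of the line, the two directions of motion define
a Dedekind cut of the rationals, and the cut is the rotation number of `L.h 0`. -/
theorem IsDegreeOne.rotLine_nonempty (hF : L.IsDegreeOne F) : (L.rotLine F).Nonempty := by
  by_contra hcon
  have hno : ∀ r : ℚ, ¬ L.HasLinePeriodic F r := fun r hr =>
    hcon ⟨_, hF.mem_rotLine_of_linePeriodic hr⟩
  obtain ⟨M, hM0, hM⟩ := hF.exists_bound
  have hbd : ∀ n : ℕ, 0 < n → |(L.retr (F^[n] (L.h 0)) - L.retr (L.h 0)) / n| ≤ M := by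
    intro n hn
    have hn0 : (0 : ℝ) < n := by exact_mod_cast hn
    rw [abs_div, abs_of_pos hn0, div_le_iff₀ hn0, mul_comm]
    exact IsDegreeOne.abs_iterate_le hM n _
  set S : Set ℝ := {a | ∃ r : ℚ, (r : ℝ) = a ∧ ∀ n y, y ≤ L.retr ((L.powerMap F r)^[n] (L.h y))}
    with hS
  have hSle : ∀ (r : ℚ), (∀ n y, y ≤ L.retr ((L.powerMap F r)^[n] (L.h y))) → (r : ℝ) ≤ M := by
    intro r hr
    obtain ⟨C, hC⟩ := hF.exists_le_of_powerMap (fun n => hr n 0)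
    exact le_of_tendsto (tendsto_const_sub_div r C)
      ((eventually_gt_atTop 0).mono fun n hn => (hC n hn).trans (abs_le.1 (hbd n hn)).2)
  have hge : ∀ (r : ℚ), (∀ n y, L.retr ((L.powerMap F r)^[n] (L.h y)) ≤ y) → -M ≤ (r : ℝ) := by
    intro r hr
    obtain ⟨C, hC⟩ := hF.exists_ge_of_powerMap (fun n => hr n 0)
    exact ge_of_tendsto (tendsto_const_sub_div r C)
      ((eventually_gt_atTop 0).mono fun n hn => (abs_le.1 (hbd n hn)).1.trans (hC n hn))
  have hSne : S.Nonempty := by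
    obtain ⟨r, hr⟩ := exists_rat_lt (-M)
    rcases hF.linePeriodic_or r with h | h | h
    · exact absurd h (hno r)
    · exact ⟨r, r, rfl, h⟩
    · exact absurd (hge r h) (not_le.2 hr)
  have hSbdd : BddAbove S := ⟨M, by rintro _ ⟨r, rfl, hr⟩; exact hSle r hr⟩
  refine hcon ⟨sSup S, 0, ?_⟩
  refine tendsto_order.2 ⟨fun a ha => ?_, fun a ha => ?_⟩
  · obtain ⟨_, ⟨r, rfl, hr⟩, har⟩ := exists_lt_of_lt_csSup hSne ha
    obtain ⟨C, hC⟩ := hF.exists_le_of_powerMap (fun n => hr n 0)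
    filter_upwards [(tendsto_order.1 (tendsto_const_sub_div r C)).1 a har, eventually_gt_atTop 0]
      with n hn hn0
    exact hn.trans_le (hC n hn0)
  · obtain ⟨r, hr1, hr2⟩ := exists_rat_btwn ha
    rcases hF.linePeriodic_or r with h | h | h
    · exact absurd h (hno r)
    · exact absurd (le_csSup hSbdd ⟨r, rfl, h⟩) (not_le.2 hr1)
    · obtain ⟨C, hC⟩ := hF.exists_ge_of_powerMap (fun n => h n 0)
      filter_upwards [(tendsto_order.1 (tendsto_const_sub_div r C)).2 a hr2, eventually_gt_atTop 0]
        with n hn hn0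
      exact (hC n hn0).trans_lt hn

/-- For a rational r in the gap, G moves the line to the right, while the point of T_ℝ has negative
rotation number for G. Some line orbit is then bounded above as well as below, and so has rotation
number r, inside the gap. -/
theorem IsDegreeOne.not_gap (hF : L.IsDegreeOne F) {x : T} (hx : x ∈ L.TR F) {α ε : ℝ}
    (hε : 0 < ε) (hα : L.HasRotationNumber F x α) (h : ∀ β ∈ L.rotLine F, α + ε ≤ β) : False := by
  obtain ⟨r, hr1, hr2⟩ := exists_rat_btwn (show α < α + ε by linarith)
  have hrn : (r : ℝ) ∉ L.rotLine F := fun hr => absurd (h r hr) (not_le.2 hr2)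
  rcases hF.linePeriodic_or r with h' | h' | h'
  · exact hrn (hF.mem_rotLine_of_linePeriodic h')
  · have h0 := hF.hasRotationNumber_powerMap (r := r) hα
    have hd : (0 : ℝ) < r.den := by exact_mod_cast r.den_pos
    have hneg : (r.den : ℝ) * α - r.num ≤ 0 := by
      rw [Rat.cast_def, lt_div_iff₀ hd] at hr1
      linarith
    obtain ⟨y, c, hyc⟩ := (hF.powerMap r).exists_bounded_of_rotation_nonpos
      ((hF.TR_powerMap r).symm ▸ hx) hneg h0
    obtain ⟨C, hC⟩ := hF.exists_le_of_powerMap (fun n => h' n y)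
    obtain ⟨C', hC'⟩ := hF.exists_ge_of_powerMap hyc
    refine hrn ⟨y, tendsto_of_tendsto_of_tendsto_of_le_of_le' (tendsto_const_sub_div r C)
      (tendsto_const_sub_div r C') ((eventually_gt_atTop 0).mono hC)
      ((eventually_gt_atTop 0).mono hC')⟩
  · obtain ⟨β, y, hy⟩ := hF.rotLine_nonempty
    have h1 := h β ⟨y, hy⟩
    have h2 := hF.ge_of_powerMap (fun n => h' n y) hy
    linarith

/-- The points of `T_ℝ` have the same rotation numbers as the points of the line. -/
theorem IsDegreeOne.mem_rotLine (hF : L.IsDegreeOne F) {x : T} (hx : x ∈ L.TR F) {α : ℝ}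
    (hα : L.HasRotationNumber F x α) : α ∈ L.rotLine F := by
  by_contra hn
  obtain ⟨ε, hε, hball⟩ := Metric.isOpen_iff.1 hF.isClosed_rotLine.isOpen_compl α hn
  have hout : ∀ β ∈ L.rotLine F, ε ≤ |β - α| := by
    intro β hβ
    by_contra! hlt
    exact hball (by rwa [Metric.mem_ball, Real.dist_eq]) hβ
  by_cases h : ∃ β ∈ L.rotLine F, β < α
  · obtain ⟨β, hβ, hβα⟩ := h
    refine hF.reflect.not_gap (L.TR_reflect F ▸ hx) hε (hasRotationNumber_reflect.2 hα) ?_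
    rintro γ ⟨y, hy⟩
    have hγ : -γ ∈ L.rotLine F := by
      refine ⟨-y, hasRotationNumber_reflect.1 ?_⟩
      rw [neg_neg]
      exact hy
    have h1 := hout _ hγ
    rcases le_or_gt α (-γ) with h2 | h2
    · exact absurd (hF.ordConnected_rotLine.out hβ hγ ⟨hβα.le, h2⟩) hn
    · rw [abs_of_neg (by linarith)] at h1
      linarith
  · push Not at h
    refine hF.not_gap hx hε hα fun β hβ => ?_
    have h1 := hout β hβ
    rw [abs_of_nonneg (by linarith [h β hβ])] at h1
    linarith

end LocallyConnected

end LiftedGraph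

/-! ### Branches of a sun-like map -/

namespace LiftedGraph

variable {T : Type*} [MetricSpace T] {L : LiftedGraph T} {F : T → T}

namespace IsSunLike

theorem continuous_arc (hF : L.IsSunLike F) (i : L.Branch F) : Continuous (hF.arc i) :=
  (hF.exists_arc i).choose_spec.1

theorem injective_arc (hF : L.IsSunLike F) (i : L.Branch F) : Function.Injective (hF.arc i) :=
  (hF.exists_arc i).choose_spec.2.1

theorem range_arc (hF : L.IsSunLike F) (i : L.Branch F) : range (hF.arc i) = i.1 :=
  (hF.exists_arc i).choose_spec.2.2.1

theorem branch_inter_TR (hF : L.IsSunLike F) (i : L.Branch F) : i.1 ∩ L.TR F = {hF.arc i 0} :=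
  (hF.exists_arc i).choose_spec.2.2.2

theorem arc_mem (hF : L.IsSunLike F) (i : L.Branch F) (t : unitInterval) : hF.arc i t ∈ i.1 :=
  hF.range_arc i ▸ mem_range_self t

theorem arc_mem_TR_iff (hF : L.IsSunLike F) {i : L.Branch F} {t : unitInterval} :
    hF.arc i t ∈ L.TR F ↔ t = 0 := by
  constructor
  · intro h
    have : hF.arc i t ∈ i.1 ∩ L.TR F := ⟨hF.arc_mem i t, h⟩
    rw [hF.branch_inter_TR] at this
    exact hF.injective_arc i this
  · rintro rfl
    have : hF.arc i 0 ∈ i.1 ∩ L.TR F := by rw [hF.branch_inter_TR]; rfl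
    exact this.2

theorem isClosed_branch (i : L.Branch F) : IsClosed i.1 := by
  obtain ⟨x, -, h⟩ := i.2
  rw [h]
  exact isClosed_closure

theorem isClosed_shift_branch (m : ℤ) (i : L.Branch F) : IsClosed (L.shift m i.1) :=
  (L.τ ^ m).toHomeomorph.isClosedMap _ (isClosed_branch i)

theorem mem_shift_branch (hF : L.IsSunLike F) {m : ℤ} {i : L.Branch F} {y : T} :
    y ∈ L.shift m i.1 ↔ ∃ u, y = (L.τ ^ m) (hF.arc i u) := by
  constructor
  · rintro ⟨x, hx, rfl⟩
    rw [← hF.range_arc] at hx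
    obtain ⟨u, rfl⟩ := hx
    exact ⟨u, rfl⟩
  · rintro ⟨u, rfl⟩
    exact ⟨_, hF.arc_mem i u, rfl⟩

end IsSunLike

/-- The components of `T \ T_ℝ` lie over single points of the line. -/
theorem retr_eq_of_mem_componentIn_compl_TR {x y : T}
    (hy : y ∈ connectedComponentIn (L.TR F)ᶜ x) : L.retr y = L.retr x := by
  have hx : x ∈ (L.TR F)ᶜ := by
    by_contra h
    rw [connectedComponentIn_eq_empty h] at hy
    exact hy
  have hsub : (L.TR F)ᶜ ⊆ (range L.h)ᶜ := compl_subset_compl.2 range_subset_TR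
  exact L.retr_eq_of_mem_component (hsub hx) (connectedComponentIn_mono x hsub hy)

theorem connectedComponentIn_openX {x : T} (hx : x ∈ L.openX F) :
    connectedComponentIn (L.openX F) x = connectedComponentIn (L.TR F)ᶜ x := by
  apply subset_antisymm (connectedComponentIn_mono x inter_subset_left)
  refine isPreconnected_connectedComponentIn.subset_connectedComponentIn
    (mem_connectedComponentIn hx.1) fun y hy => ⟨connectedComponentIn_subset _ _ hy, ?_⟩
  rw [mem_preimage, retr_eq_of_mem_componentIn_compl_TR hy]
  exact hx.2

section LocallyConnected

variable [LocallyConnectedSpace T]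

theorem retr_eq_of_mem_closure_componentIn {x y : T}
    (hy : y ∈ closure (connectedComponentIn (L.TR F)ᶜ x)) : L.retr y = L.retr x := by
  have : closure (connectedComponentIn (L.TR F)ᶜ x) ⊆ L.retr ⁻¹' {L.retr x} :=
    closure_minimal (fun z hz => retr_eq_of_mem_componentIn_compl_TR hz)
      (isClosed_singleton.preimage L.continuous_retr)
  exact this hy

theorem exists_retr_eq_of_branch (i : L.Branch F) : ∃ c ∈ Ico (0 : ℝ) 1, ∀ x ∈ i.1, L.retr x = c := by
  obtain ⟨x, hx, h⟩ := i.2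
  refine ⟨L.retr x, hx.2, fun y hy => ?_⟩
  rw [h, connectedComponentIn_openX hx] at hy
  exact retr_eq_of_mem_closure_componentIn hy

theorem retr_mem_of_branch {i : L.Branch F} {x : T} (hx : x ∈ i.1) : L.retr x ∈ Ico (0 : ℝ) 1 := by
  obtain ⟨c, hc, h⟩ := exists_retr_eq_of_branch i
  rw [h x hx]
  exact hc

theorem branch_subset_X (i : L.Branch F) : i.1 ⊆ L.X F := by
  intro y hy
  refine ⟨?_, retr_mem_of_branch hy⟩
  obtain ⟨x, hx, h⟩ := i.2
  rw [h] at hy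
  exact closure_mono ((connectedComponentIn_subset _ _).trans inter_subset_left) hy

/-- A branch without its endpoint in `T_ℝ` is open in `T`. -/
theorem isOpen_branch_diff (i : L.Branch F) : IsOpen (i.1 \ L.TR F) := by
  obtain ⟨x, hx, h⟩ := i.2
  have : i.1 \ L.TR F = connectedComponentIn (L.TR F)ᶜ x := by
    rw [h, connectedComponentIn_openX hx]
    exact subset_antisymm (component_relClosed x)
      fun y hy => ⟨subset_closure hy, connectedComponentIn_subset _ _ hy⟩
  rw [this]
  exact isClosed_TR.isOpen_compl.connectedComponentIn

namespace IsSunLike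

theorem isOpen_arc_image_Ioi (hF : L.IsSunLike F) (i : L.Branch F) (a : unitInterval) :
    IsOpen (hF.arc i '' Ioi a) := by
  have h1 : hF.arc i '' Ioi a = (i.1 \ L.TR F) \ hF.arc i '' Iic a := by
    ext y
    constructor
    · rintro ⟨t, ht, rfl⟩
      refine ⟨⟨hF.arc_mem i t, fun h => ?_⟩, ?_⟩
      · rw [hF.arc_mem_TR_iff.1 h] at ht
        exact absurd (mem_Ioi.1 ht) (not_lt.2 unitInterval.nonneg')
      · rintro ⟨s, hs, hst⟩
        rw [hF.injective_arc i hst] at hs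
        exact absurd (mem_Ioi.1 ht) (not_lt.2 hs)
    · rintro ⟨⟨hy, -⟩, hy'⟩
      rw [← hF.range_arc] at hy
      obtain ⟨t, rfl⟩ := hy
      exact ⟨t, mem_Ioi.2 (not_le.1 fun h => hy' ⟨t, h, rfl⟩), rfl⟩
  rw [h1]
  exact (isOpen_branch_diff i).sdiff (isClosed_Iic.isCompact.image (hF.continuous_arc i)).isClosed

/-- Branches retract into [0, 1), which fixes the translation; different branches are disjoint and
arcs are injective. So the coordinates (translation, branch, parameter) of a point are unique. -/
theorem arc_eq_shift_arc (hF : L.IsSunLike F) {i j : L.Branch F} {m : ℤ} {t u : unitInterval}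
    (h : hF.arc i t = (L.τ ^ m) (hF.arc j u)) : m = 0 ∧ i = j ∧ t = u := by
  have h1 := retr_mem_of_branch (hF.arc_mem i t)
  have h2 := retr_mem_of_branch (hF.arc_mem j u)
  rw [h, retr_tau_zpow] at h1
  obtain rfl : m = 0 := by
    have h3 : (m : ℝ) < 1 := by linarith [h1.2, h2.1]
    have h4 : (-1 : ℝ) < m := by linarith [h1.1, h2.2]
    have h5 : m < 1 := by exact_mod_cast h3
    have h6 : -1 < m := by exact_mod_cast h4
    omega
  rw [zpow_zero] at h
  have h' : hF.arc i t = hF.arc j u := h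
  obtain rfl : i = j := by
    obtain ⟨x, hx, hi⟩ := i.2
    obtain ⟨y, hy, hj⟩ := j.2
    by_contra hne
    have hd := hF.disjoint_closure x hx y hy fun hxy => hne (Subtype.ext (by rw [hi, hj, hxy]))
    rw [← hi, ← hj] at hd
    exact hd.le_bot ⟨hF.arc_mem i t, h' ▸ hF.arc_mem j u⟩
  exact ⟨rfl, rfl, hF.injective_arc i h'⟩

theorem shift_arc_eq (hF : L.IsSunLike F) {i j : L.Branch F} {m n : ℤ} {t u : unitInterval}
    (h : (L.τ ^ m) (hF.arc i t) = (L.τ ^ n) (hF.arc j u)) : m = n ∧ i = j ∧ t = u := by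
  have h1 : hF.arc i t = (L.τ ^ (-m + n)) (hF.arc j u) := by
    rw [tau_zpow_add, ← h, tau_zpow_neg_apply]
  obtain ⟨h2, h3⟩ := hF.arc_eq_shift_arc h1
  exact ⟨by omega, h3⟩

theorem exists_arc_of_mem_X (hF : L.IsSunLike F) {x : T} (hx : x ∈ L.X F) : ∃ i t, x = hF.arc i t := by
  have := hF.finite_branches
  -- Closure points are only controlled over an open set, so [0, 1) is enlarged to (-1, 2), where
  -- three translates of the branches suffice. Uniqueness of the translation then selects 0.
  set K : Set T := ⋃ i : L.Branch F, ⋃ m ∈ ({-1, 0, 1} : Set ℤ), L.shift m i.1 with hK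
  have hKc : IsClosed K := isClosed_iUnion_of_finite fun i =>
    Set.Finite.isClosed_biUnion (by simp) fun m _ => isClosed_shift_branch m i
  have hsub : (L.TR F)ᶜ ∩ L.retr ⁻¹' Ioo (-1) 2 ⊆ K := by
    rintro y ⟨hy, hy1, hy2⟩
    set m := ⌊L.retr y⌋ with hm
    have hm1 : m < 2 := Int.floor_lt.2 (by exact_mod_cast hy2)
    have hm2 : -1 ≤ m := Int.le_floor.2 (by push_cast; exact hy1.le)
    have hz : (L.τ ^ (-m)) y ∈ L.openX F := by
      refine ⟨fun h => hy ((hF.tau_zpow_mem_TR_iff _).1 h), ?_⟩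
      rw [mem_preimage, retr_tau_zpow]
      push_cast
      exact ⟨by linarith [Int.floor_le (L.retr y)], by linarith [Int.lt_floor_add_one (L.retr y)]⟩
    refine mem_iUnion.2 ⟨⟨_, _, hz, rfl⟩, mem_iUnion₂.2 ⟨m, ?_, _,
      subset_closure (mem_connectedComponentIn hz), L.tau_zpow_apply_neg m y⟩⟩
    simp only [mem_insert_iff, mem_singleton_iff]
    omega
  have hxK : x ∈ K := by
    refine closure_minimal hsub hKc ?_
    exact (isOpen_Ioo.preimage L.continuous_retr).closure_inter
      ⟨hx.1, by linarith [hx.2.1], by linarith [hx.2.2]⟩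
  obtain ⟨i, m, -, hxm⟩ : ∃ i : L.Branch F, ∃ m ∈ ({-1, 0, 1} : Set ℤ), x ∈ L.shift m i.1 := by
    simpa only [hK, mem_iUnion, exists_prop] using hxK
  obtain ⟨u, rfl⟩ := hF.mem_shift_branch.1 hxm
  have h1 := hx.2
  have h2 := retr_mem_of_branch (hF.arc_mem i u)
  rw [mem_preimage, retr_tau_zpow] at h1
  obtain rfl : m = 0 := by
    have h3 : (m : ℝ) < 1 := by linarith [h1.2, h2.1]
    have h4 : (-1 : ℝ) < m := by linarith [h1.1, h2.2]
    have h5 : m < 1 := by exact_mod_cast h3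
    have h6 : -1 < m := by exact_mod_cast h4
    omega
  exact ⟨i, u, rfl⟩

theorem mem_interior_TR_or (hF : L.IsSunLike F) (x : T) :
    x ∈ interior (L.TR F) ∨ ∃ (m : ℤ) (i : L.Branch F) (t : unitInterval), x = (L.τ ^ m) (hF.arc i t) := by
  by_cases hx : x ∈ interior (L.TR F)
  · exact Or.inl hx
  right
  rw [← mem_compl_iff, ← closure_compl] at hx
  set m := ⌊L.retr x⌋ with hm
  have : (L.τ ^ (-m)) x ∈ L.X F := by
    refine ⟨map_mem_closure (L.tau_zpow_continuous (-m)) hx fun y hy h => hy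
      ((hF.tau_zpow_mem_TR_iff _).1 h), ?_⟩
    rw [mem_preimage, retr_tau_zpow]
    push_cast
    exact ⟨by linarith [Int.floor_le (L.retr x)], by linarith [Int.lt_floor_add_one (L.retr x)]⟩
  obtain ⟨i, t, hit⟩ := hF.exists_arc_of_mem_X this
  exact ⟨m, i, t, by rw [← hit, tau_zpow_apply_neg]⟩

theorem shift_arc_notMem_interior (hF : L.IsSunLike F) (m : ℤ) (i : L.Branch F) (t : unitInterval) :
    (L.τ ^ m) (hF.arc i t) ∉ interior (L.TR F) := by
  rw [← mem_compl_iff, ← closure_compl]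
  exact map_mem_closure (L.tau_zpow_continuous m) (branch_subset_X i (hF.arc_mem i t)).1
    fun y hy h => hy ((hF.tau_zpow_mem_TR_iff _).1 h)

/-- Intermediate values: an arc of a branch, starting at a point mapped to the endpoint of a branch,
covers everything below its values in this branch. -/
theorem exists_map_arc_eq (hF : L.IsSunLike F) {i j : L.Branch F} {m : ℤ} {a t y y' : unitInterval}
    (hat : a ≤ t) (ha : F (hF.arc i a) = (L.τ ^ m) (hF.arc j 0))
    (ht : F (hF.arc i t) = (L.τ ^ m) (hF.arc j y)) (hy : y' ≤ y) :
    ∃ t' ∈ Icc a t, F (hF.arc i t') = (L.τ ^ m) (hF.arc j y') := by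
  rcases unitInterval.nonneg'.eq_or_lt (a := (0 : unitInterval)) (b := y') with rfl | hy0
  · exact ⟨a, ⟨le_rfl, hat⟩, ha⟩
  rcases hy.eq_or_lt with rfl | hy
  · exact ⟨t, ⟨hat, le_rfl⟩, ht⟩
  by_contra! hcon
  set g : unitInterval → T := fun s => (L.τ ^ (-m)) (F (hF.arc i s)) with hg
  have hgc : Continuous g :=
    (L.tau_zpow_continuous _).comp (hF.continuous.comp (hF.continuous_arc i))
  have hga : g a = hF.arc j 0 := by simp only [hg]; rw [ha, tau_zpow_neg_apply]
  have hgt : g t = hF.arc j y := by simp only [hg]; rw [ht, tau_zpow_neg_apply]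
  have hpre : IsPreconnected (g '' Icc a t) := isPreconnected_Icc.image g hgc.continuousOn
  -- If y' were missed, these two open sets would disconnect the image of the interval: the part of
  -- the branch above y' is open in T because a branch is attached to T_ℝ only at its minimum.
  have hcov : g '' Icc a t ⊆ hF.arc j '' Ioi y' ∪ (hF.arc j '' Ici y')ᶜ := by
    rintro _ ⟨s, hs, rfl⟩
    by_cases h : g s ∈ hF.arc j '' Ici y'
    · obtain ⟨v, hv, hvs⟩ := h
      rcases (show y' ≤ v from hv).eq_or_lt with rfl | hv'
      · refine absurd ?_ (hcon s hs)
        rw [hvs, hg, tau_zpow_apply_neg]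
      · exact Or.inl ⟨v, hv', hvs⟩
    · exact Or.inr h
  have h0 : hF.arc j 0 ∉ hF.arc j '' Ici y' := by
    rintro ⟨v, hv, hv0⟩
    rw [hF.injective_arc j hv0] at hv
    exact absurd hy0 (not_lt.2 (mem_Ici.1 hv))
  obtain ⟨z, -, hz1, hz2⟩ := hpre _ _ (hF.isOpen_arc_image_Ioi j y')
    (isClosed_Ici.isCompact.image (hF.continuous_arc j)).isClosed.isOpen_compl hcov
    ⟨g t, ⟨t, ⟨hat, le_rfl⟩, rfl⟩, y, hy, hgt.symm⟩
    ⟨g a, ⟨a, ⟨le_rfl, hat⟩, rfl⟩, hga ▸ h0⟩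
  exact hz2 (image_mono Ioi_subset_Ici_self hz1)

end IsSunLike

end LocallyConnected

end LiftedGraph

/-! ### Existence of basic partitions -/

/-- Disjoint sets `Z c` of points of `[0, 1]` whose unions are closed are separated by finitely many
intervals, each of which meets only one of the sets. -/
theorem exists_blocks {C : Type*} {Z : C → Set unitInterval}
    (hZ : ∀ S : Set C, IsClosed (⋃ c ∈ S, Z c)) (hdisj : ∀ c c' t, t ∈ Z c → t ∈ Z c' → c = c') :
    ∃ D : List (unitInterval × unitInterval × C), D.Pairwise (fun a b => a.2.1 < b.1) ∧
      (∀ d ∈ D, d.1 ≤ d.2.1 ∧ d.1 ∈ Z d.2.2 ∧ (∀ c, ∀ t ∈ Icc d.1 d.2.1, t ∈ Z c → c = d.2.2) ∧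
        (d.1 = 0 ∨ d.1 ∈ closure (⋃ c, Z c)ᶜ)) ∧
      ∀ c, ∀ t ∈ Z c, ∃ d ∈ D, t ∈ Icc d.1 d.2.1 := by
  by_cases hC : Nonempty C
  swap
  · exact ⟨[], List.Pairwise.nil, by simp, fun c => absurd ⟨c⟩ hC⟩
  obtain ⟨c₀⟩ := hC
  have hZ1 : ∀ c, IsClosed (Z c) := fun c => by simpa using hZ {c}
  have hZU : IsClosed (⋃ c, Z c) := by simpa using hZ univ
  -- A Lebesgue number of the cover by the sets missing all colours but one: points of different
  -- colours are at least δ apart, so passing to a block of another colour costs a length δ and the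
  -- recursion stops.
  obtain ⟨δ, hδ, hball⟩ := lebesgue_number_lemma_of_metric (isCompact_univ (X := unitInterval))
    (c := fun c => (⋃ c' ∈ ({c}ᶜ : Set C), Z c')ᶜ) (fun c => (hZ _).isOpen_compl) (fun t _ => by
      by_cases h : ∃ c, t ∈ Z c
      · obtain ⟨c, hc⟩ := h
        refine mem_iUnion.2 ⟨c, fun h' => ?_⟩
        obtain ⟨c', hc', ht⟩ := mem_iUnion₂.1 h'
        exact hc' (hdisj _ _ _ ht hc)
      · push Not at h
        refine mem_iUnion.2 ⟨c₀, fun h' => ?_⟩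
        obtain ⟨c', hc', ht⟩ := mem_iUnion₂.1 h'
        exact h c' ht)
  have hsep : ∀ c c', ∀ x ∈ Z c, ∀ y ∈ Z c', c ≠ c' → δ ≤ dist y x := by
    intro c c' x hx y hy hne
    by_contra! hlt
    obtain ⟨d, hd⟩ := hball x (mem_univ _)
    have key : ∀ e z, z ∈ Z e → z ∈ Metric.ball x δ → e = d := by
      intro e z hz hzb
      by_contra hed
      exact hd hzb (mem_iUnion₂.2 ⟨e, hed, hz⟩)
    exact hne ((key c x hx (Metric.mem_ball_self hδ)).trans (key c' y hy hlt).symm)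
  suffices h : ∀ (n : ℕ) (s : unitInterval), (s : ℝ) < n * δ →
      ∃ D : List (unitInterval × unitInterval × C), D.Pairwise (fun a b => a.2.1 < b.1) ∧
        (∀ d ∈ D, d.1 ≤ d.2.1 ∧ d.1 ∈ Z d.2.2 ∧ (∀ c, ∀ t ∈ Icc d.1 d.2.1, t ∈ Z c → c = d.2.2) ∧
          (d.1 = 0 ∨ d.1 ∈ closure (⋃ c, Z c)ᶜ)) ∧
        (∀ d ∈ D, d.2.1 ≤ s) ∧ ∀ c, ∀ t ∈ Z c, t ≤ s → ∃ d ∈ D, t ∈ Icc d.1 d.2.1 by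
    obtain ⟨n, hn⟩ := exists_nat_gt (1 / δ)
    obtain ⟨D, h1, h2, -, h3⟩ := h n 1 (by rw [div_lt_iff₀ hδ] at hn; exact_mod_cast hn)
    exact ⟨D, h1, h2, fun c t ht => h3 c t ht unitInterval.le_one'⟩
  intro n
  induction n with
  | zero =>
    intro s hs
    have := s.2.1
    simp only [Nat.cast_zero, zero_mul] at hs
    linarith
  | succ n ih =>
    intro s hs
    by_cases hW : ((⋃ c, Z c) ∩ Iic s).Nonempty
    swap
    · exact ⟨[], List.Pairwise.nil, by simp, by simp, fun c t ht hts =>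
        absurd ⟨t, mem_iUnion.2 ⟨c, ht⟩, hts⟩ hW⟩
    -- The last block ends at the greatest coloured point t. It starts at the first point of the
    -- colour of t after the last differently coloured point t', and the recursion continues below
    -- t'. Just before the start there are only uncoloured points.
    obtain ⟨t, ⟨ht, hts⟩, htmax⟩ := (hZU.inter isClosed_Iic).isCompact.exists_isGreatest hW
    obtain ⟨c, hc⟩ := mem_iUnion.1 ht
    by_cases hV : ((⋃ c' ∈ ({c}ᶜ : Set C), Z c') ∩ Iic t).Nonempty
    · obtain ⟨t', ⟨ht', htt'⟩, htmax'⟩ :=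
        ((hZ {c}ᶜ).inter isClosed_Iic).isCompact.exists_isGreatest hV
      obtain ⟨c', hc', htc'⟩ := mem_iUnion₂.1 ht'
      obtain ⟨a, ⟨ha, hat', hat⟩, hamin⟩ := ((hZ1 c).inter
        (isClosed_Icc (a := t') (b := t))).isCompact.exists_isLeast ⟨t, hc, htt', le_rfl⟩
      have hδa : δ ≤ a - t' := by
        have := hsep c' c t' htc' a ha hc'
        rwa [Subtype.dist_eq, Real.dist_eq, abs_of_nonneg (sub_nonneg.2 (by exact_mod_cast hat'))]
          at this
      have hlt : t' < a := by
        have : (t' : ℝ) < a := by linarith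
        exact_mod_cast this
      have has : (a : ℝ) ≤ s := by exact_mod_cast hat.trans hts
      obtain ⟨D, h1, h2, h3, h4⟩ := ih t' (by push_cast at hs; linarith)
      refine ⟨D ++ [(a, t, c)], ?_, ?_, ?_, ?_⟩
      · rw [List.pairwise_append]
        refine ⟨h1, List.pairwise_singleton _ _, fun d hd e he => ?_⟩
        rw [List.mem_singleton] at he
        subst he
        exact (h3 d hd).trans_lt hlt
      · intro d hd
        rw [List.mem_append, List.mem_singleton] at hd
        rcases hd with hd | rfl
        · exact h2 d hd
        refine ⟨hat, ha, fun e u hu hue => ?_, Or.inr ?_⟩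
        · by_contra hne
          exact absurd (htmax' ⟨mem_iUnion₂.2 ⟨e, hne, hue⟩, hu.2⟩) (not_le.2 (hlt.trans_le hu.1))
        · have h5 : Ioo t' a ⊆ (⋃ c, Z c)ᶜ := by
            intro u hu hu'
            obtain ⟨e, he⟩ := mem_iUnion.1 hu'
            by_cases hec : e = c
            · subst hec
              exact absurd (hamin ⟨he, hu.1.le, hu.2.le.trans hat⟩) (not_le.2 hu.2)
            · exact absurd (htmax' ⟨mem_iUnion₂.2 ⟨e, hec, he⟩, hu.2.le.trans hat⟩) (not_le.2 hu.1)
          refine closure_mono h5 ?_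
          rw [closure_Ioo hlt.ne]
          exact ⟨hlt.le, le_rfl⟩
      · intro d hd
        rw [List.mem_append, List.mem_singleton] at hd
        rcases hd with hd | rfl
        · exact (h3 d hd).trans (htt'.trans hts)
        · exact hts
      · intro e u hu hus
        have hut : u ≤ t := htmax ⟨mem_iUnion.2 ⟨e, hu⟩, hus⟩
        rcases le_or_gt u t' with h | h
        · obtain ⟨d, hd, hud⟩ := h4 e u hu h
          exact ⟨d, List.mem_append_left _ hd, hud⟩
        · have hec : e = c := by
            by_contra hec
            exact absurd (htmax' ⟨mem_iUnion₂.2 ⟨e, hec, hu⟩, hut⟩) (not_le.2 h)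
          subst hec
          exact ⟨_, List.mem_append_right _ (List.mem_singleton_self _), hamin ⟨hu, h.le, hut⟩, hut⟩
    · obtain ⟨a, ⟨ha, hat⟩, hamin⟩ := ((hZ1 c).inter (isClosed_Iic (a := t))).isCompact.exists_isLeast
        ⟨t, hc, self_mem_Iic⟩
      have hcol : ∀ e u, u ∈ Z e → u ≤ t → e = c := by
        intro e u hu hut
        by_contra hec
        exact hV ⟨u, mem_iUnion₂.2 ⟨e, hec, hu⟩, hut⟩
      refine ⟨[(a, t, c)], List.pairwise_singleton _ _, ?_, ?_, ?_⟩
      · intro d hd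
        rw [List.mem_singleton] at hd
        subst hd
        refine ⟨hat, ha, fun e u hu hue => hcol e u hue hu.2, ?_⟩
        rcases unitInterval.nonneg'.eq_or_lt (a := (0 : unitInterval)) (b := a) with h | h
        · exact Or.inl h.symm
        right
        have h5 : Ioo 0 a ⊆ (⋃ c, Z c)ᶜ := by
          intro u hu hu'
          obtain ⟨e, he⟩ := mem_iUnion.1 hu'
          obtain rfl := hcol e u he (hu.2.le.trans hat)
          exact absurd (hamin ⟨he, hu.2.le.trans hat⟩) (not_le.2 hu.2)
        refine closure_mono h5 ?_
        rw [closure_Ioo h.ne]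
        exact ⟨h.le, le_rfl⟩
      · intro d hd
        rw [List.mem_singleton] at hd
        subst hd
        exact hts
      · intro e u hu hus
        have hut : u ≤ t := htmax ⟨mem_iUnion.2 ⟨e, hu⟩, hus⟩
        obtain rfl := hcol e u hu hut
        exact ⟨_, List.mem_singleton_self _, hamin ⟨hu, hut⟩, hut⟩

namespace LiftedGraph

variable {T : Type*} [MetricSpace T] {L : LiftedGraph T} {F : T → T}

/-- The points of the branch `i` mapped to the `c.2`-th translate of the branch `c.1`. -/
def IsSunLike.colorSet (hF : L.IsSunLike F) (i : L.Branch F) (c : L.Branch F × ℤ) :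
    Set unitInterval :=
  {t | F (hF.arc i t) ∈ L.shift c.2 c.1.1}

theorem IsSunLike.isClosed_colorSet (hF : L.IsSunLike F) (i : L.Branch F) (c : L.Branch F × ℤ) :
    IsClosed (hF.colorSet i c) :=
  (isClosed_shift_branch c.2 c.1).preimage (hF.continuous.comp (hF.continuous_arc i))

section LocallyConnected

variable [LocallyConnectedSpace T]

theorem IsSunLike.finite_colorSet (hF : L.IsSunLike F) (i : L.Branch F) :
    {c | (hF.colorSet i c).Nonempty}.Finite := by
  have := hF.finite_branches
  obtain ⟨M, -, hM⟩ := hF.toIsDegreeOne.exists_bound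
  obtain ⟨k, hk⟩ := exists_int_gt (M + 1)
  refine ((finite_univ (α := L.Branch F)).prod (finite_Icc (-k) k)).subset ?_
  rintro ⟨j, p⟩ ⟨t, ht⟩
  obtain ⟨u, hu⟩ := hF.mem_shift_branch.1 ht
  have h1 := retr_mem_of_branch (hF.arc_mem i t)
  have h2 := retr_mem_of_branch (hF.arc_mem j u)
  have h3 := abs_le.1 (hM (hF.arc i t))
  rw [hu, retr_tau_zpow] at h3
  have h4 : (-k : ℝ) ≤ p := by linarith [h3.1, h1.1, h2.2]
  have h5 : (p : ℝ) ≤ k := by linarith [h3.2, h1.2, h2.1]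
  exact ⟨mem_univ _, by exact_mod_cast h4, by exact_mod_cast h5⟩

theorem IsSunLike.colorSet_disjoint (hF : L.IsSunLike F) {i : L.Branch F} {c c' : L.Branch F × ℤ}
    {t : unitInterval} (h : t ∈ hF.colorSet i c) (h' : t ∈ hF.colorSet i c') : c = c' := by
  obtain ⟨u, hu⟩ := hF.mem_shift_branch.1 h
  obtain ⟨u', hu'⟩ := hF.mem_shift_branch.1 h'
  obtain ⟨h1, h2, -⟩ := hF.shift_arc_eq (hu.symm.trans hu')
  exact Prod.ext h2 h1

/-- Basic partitions exist. -/
theorem IsSunLike.nonempty_basicPartition (hF : L.IsSunLike F) : Nonempty (BasicPartition hF) := by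
  have hex : ∀ i : L.Branch F, _ := fun i => exists_blocks (Z := hF.colorSet i) (fun S => by
    have : ⋃ c ∈ S, hF.colorSet i c = ⋃ c ∈ S ∩ {c | (hF.colorSet i c).Nonempty}, hF.colorSet i c := by
      ext t
      simp only [mem_iUnion, exists_prop]
      exact ⟨fun ⟨c, hc, ht⟩ => ⟨c, ⟨hc, t, ht⟩, ht⟩, fun ⟨c, hc, ht⟩ => ⟨c, hc.1, ht⟩⟩
    rw [this]
    exact ((hF.finite_colorSet i).inter_of_right S).isClosed_biUnion
      fun c _ => hF.isClosed_colorSet i c) (fun c c' t h h' => hF.colorSet_disjoint h h')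
  choose D hpair hD hcov using hex
  have hint : ∀ i t, (∀ c, t ∉ hF.colorSet i c) → F (hF.arc i t) ∈ interior (L.TR F) := by
    intro i t h
    rcases hF.mem_interior_TR_or (F (hF.arc i t)) with h' | ⟨m, j, u, hu⟩
    · exact h'
    · exact absurd (hF.mem_shift_branch.2 ⟨u, hu⟩) (h (j, m))
  refine ⟨{
    N := fun i => (D i).length
    lo := fun i j => ((D i).get j).1
    hi := fun i j => ((D i).get j).2.1
    ℓ := fun i j => ((D i).get j).2.2.1
    p := fun i j => ((D i).get j).2.2.2
    lo_le_hi := fun i j => (hD i _ (List.get_mem _ j)).1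
    hi_lt_lo := fun i j k hjk => List.pairwise_iff_get.1 (hpair i) j k hjk
    image_subset := ?_
    image_min := ?_
    image_compl := ?_ }⟩
  · rintro i j _ ⟨_, ⟨t, ht, rfl⟩, rfl⟩
    by_cases h : ∃ c, t ∈ hF.colorSet i c
    · obtain ⟨c, hc⟩ := h
      obtain rfl := (hD i _ (List.get_mem _ j)).2.2.1 c t ht hc
      exact Or.inl hc
    · push Not at h
      exact Or.inr (hint i t h)
  · intro i j
    obtain ⟨-, h1, -, h2⟩ := hD i _ (List.get_mem _ j)
    set d := (D i).get j
    obtain ⟨u, hu⟩ := hF.mem_shift_branch.1 h1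
    -- The start of a block is 0 or a limit of parameters mapped into the interior of T_ℝ. Its image
    -- is therefore in T_ℝ and in a branch, so it is the minimum of that branch.
    have hTR : F (hF.arc i d.1) ∈ L.TR F := by
      rcases h2 with h2 | h2
      · rw [h2]
        exact hF.map_mem_TR (hF.arc_mem_TR_iff.2 rfl)
      · have h3 : F (hF.arc i d.1) ∈ closure (L.TR F) :=
          map_mem_closure (f := fun t => F (hF.arc i t))
            (hF.continuous.comp (hF.continuous_arc i)) h2 fun t ht =>
            interior_subset (hint i t fun c hc => ht (mem_iUnion.2 ⟨c, hc⟩))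
        rwa [isClosed_TR.closure_eq] at h3
    rw [hu, hF.toIsDegreeOne.tau_zpow_mem_TR_iff, hF.arc_mem_TR_iff] at hTR
    rw [hu, hTR]
  · intro x hx hout m hFx
    obtain ⟨i, t, rfl⟩ := hF.exists_arc_of_mem_X hx
    obtain ⟨y, hy, hyx⟩ := hFx
    obtain ⟨k, u, rfl⟩ := hF.exists_arc_of_mem_X hy
    obtain ⟨d, hd, htd⟩ := hcov i (k, m) t (hF.mem_shift_branch.2 ⟨u, hyx.symm⟩)
    obtain ⟨j, rfl⟩ := List.get_of_mem hd
    exact hout i j ⟨t, htd, rfl⟩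

end LocallyConnected

end LiftedGraph

/-! ### Runs along words and full coverings of letters -/

namespace LiftedGraph.BasicPartition

variable {T : Type*} [MetricSpace T] {L : LiftedGraph T} {F : T → T} {hF : L.IsSunLike F}
  (P : BasicPartition hF)

theorem finite_letter : Finite P.Letter := by
  have := hF.finite_branches
  infer_instance

theorem exists_abs_p_le : ∃ M : ℝ, ∀ A : P.Letter, |(P.p A.1 A.2 : ℝ)| ≤ M := by
  have := P.finite_letter
  obtain ⟨M, hM⟩ := (finite_range fun A : P.Letter => |(P.p A.1 A.2 : ℝ)|).bddAbove
  exact ⟨M, fun A => hM ⟨A, rfl⟩⟩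

/-- The parameters of the points of the interval `A`. -/
def interval (A : P.Letter) : Set unitInterval := Icc (P.lo A.1 A.2) (P.hi A.1 A.2)

theorem hi_mem_interval (A : P.Letter) : P.hi A.1 A.2 ∈ P.interval A := ⟨P.lo_le_hi _ _, le_rfl⟩

/-- The point of `A` with parameter `t` is mapped to the point of `B` with parameter `u`. -/
def Link (A : P.Letter) (t : unitInterval) (B : P.Letter) (u : unitInterval) : Prop :=
  P.ℓ A.1 A.2 = B.1 ∧ t ∈ P.interval A ∧ u ∈ P.interval B ∧
    F (hF.arc A.1 t) = (L.τ ^ P.p A.1 A.2) (hF.arc B.1 u)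

/-- `P.Run A t l C v` means that the orbit of the point of `A` with parameter `t` follows the
letters of the list `l` and arrives at the point of `C` with parameter `v`. -/
inductive Run : P.Letter → unitInterval → List P.Letter → P.Letter → unitInterval → Prop
  | nil {A : P.Letter} {t : unitInterval} (h : t ∈ P.interval A) : Run A t [] A t
  | cons {A B C : P.Letter} {t u v : unitInterval} {l : List P.Letter} (h : P.Link A t B u)
      (h' : Run B u l C v) : Run A t (B :: l) C v

/-- The sum of the weights along the word `A :: l`, without the last letter. -/
def wt : P.Letter → List P.Letter → ℤ
  | _, [] => 0
  | A, B :: l => P.p A.1 A.2 + wt B l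

/-- The word `A :: l` ends with `C` and its past is the whole interval `C`. -/
def Full (A : P.Letter) (l : List P.Letter) (C : P.Letter) : Prop :=
  ∃ t, P.Run A t l C (P.hi C.1 C.2)

variable {P} {A B B' C C' D : P.Letter} {t t' u v v' w : unitInterval} {l l' : List P.Letter}

theorem Run.mem_left (h : P.Run A t l C v) : t ∈ P.interval A := by
  cases h with
  | nil h => exact h
  | cons h _ => exact h.2.1

theorem Run.mem_right (h : P.Run A t l C v) : v ∈ P.interval C := by
  induction h with
  | nil h => exact h
  | cons _ _ ih => exact ih

theorem Run.iterate (h : P.Run A t l C v) :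
    F^[l.length] (hF.arc A.1 t) = (L.τ ^ P.wt A l) (hF.arc C.1 v) := by
  induction h with
  | nil h => simp [wt]
  | @cons A B C t u v l h _ ih =>
    rw [List.length_cons, Function.iterate_succ_apply, h.2.2.2,
      (hF.toIsDegreeOne.iterate _).map_tau_zpow, ih, wt, tau_zpow_add]

theorem Run.append (h : P.Run A t l C v) (h' : P.Run C v l' D w) : P.Run A t (l ++ l') D w := by
  induction h with
  | nil _ => exact h'
  | cons hl _ ih => exact .cons hl (ih h')

theorem Run.exists_of_append (h : P.Run A t (l ++ l') D w) :
    ∃ C v, P.Run A t l C v ∧ P.Run C v l' D w := by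
  induction l generalizing A t with
  | nil => exact ⟨A, t, .nil h.mem_left, h⟩
  | cons B l ih =>
    cases h with
    | cons hl h =>
      obtain ⟨C, v, h1, h2⟩ := ih h
      exact ⟨C, v, .cons hl h1, h2⟩

theorem Run.wt_append (h : P.Run A t l C v) (l' : List P.Letter) :
    P.wt A (l ++ l') = P.wt A l + P.wt C l' := by
  induction h with
  | nil _ => simp [wt]
  | cons _ _ ih => rw [List.cons_append, wt, wt, ih, add_assoc]

theorem Run.last_unique (h : P.Run A t l C v) (h' : P.Run A t' l C' v') : C = C' := by
  induction h generalizing t' with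
  | nil _ => cases h'; rfl
  | cons _ _ ih => cases h' with
    | cons _ h' => exact ih h'

theorem Run.last_eq (h : P.Run A t (l ++ [B]) C v) : C = B := by
  obtain ⟨D, w, -, h2⟩ := h.exists_of_append
  cases h2 with
  | cons _ h => cases h; rfl

/-- The relation is a composition of closed relations on compact spaces. This allows limits and
minima of runs to be taken. -/
theorem isCompact_run (P : BasicPartition hF) (A : P.Letter) (l : List P.Letter) (C : P.Letter) :
    IsCompact {x : unitInterval × unitInterval | P.Run A x.1 l C x.2} := by
  induction l generalizing A with
  | nil =>
    have : {x : unitInterval × unitInterval | P.Run A x.1 [] C x.2} =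
        {x | x.1 = x.2 ∧ x.1 ∈ P.interval A ∧ A = C} := by
      ext ⟨x, y⟩
      constructor
      · intro h
        cases h with
        | nil h => exact ⟨rfl, h, rfl⟩
      · rintro ⟨h1, h2, h3⟩
        simp only at h1 h2 h3
        subst h1 h3
        exact .nil h2
    rw [this]
    refine IsClosed.isCompact ((isClosed_eq continuous_fst continuous_snd).inter
      ((isClosed_Icc.preimage continuous_fst).inter ?_))
    exact isClosed_const
  | cons B l ih =>
    have : {x : unitInterval × unitInterval | P.Run A x.1 (B :: l) C x.2} =
        (fun y : unitInterval × unitInterval × unitInterval => (y.1, y.2.2)) ''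
          ({y | P.Link A y.1 B y.2.1} ∩ {y | P.Run B y.2.1 l C y.2.2}) := by
      ext ⟨x, z⟩
      constructor
      · intro h
        cases h with
        | @cons _ _ _ _ u _ _ h h' => exact ⟨(x, u, z), ⟨h, h'⟩, rfl⟩
      · rintro ⟨⟨_, u, _⟩, ⟨h, h'⟩, hxz⟩
        obtain ⟨rfl, rfl⟩ := Prod.mk.inj hxz
        exact .cons h h'
    rw [this]
    refine (IsClosed.isCompact (IsClosed.inter ?_ ?_)).image (by fun_prop)
    · by_cases hB : P.ℓ A.1 A.2 = B.1
      · simp only [Link, hB, true_and]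
        refine (isClosed_Icc.preimage continuous_fst).inter
          ((isClosed_Icc.preimage (continuous_fst.comp continuous_snd)).inter (isClosed_eq ?_ ?_))
        · exact hF.continuous.comp ((hF.continuous_arc _).comp continuous_fst)
        · exact (L.tau_zpow_continuous _).comp
            ((hF.continuous_arc _).comp (continuous_fst.comp continuous_snd))
      · simp [Link, hB]
    · exact (ih B).isClosed.preimage continuous_snd

theorem Full.of_append (h : P.Full A (l ++ l') C) (h' : P.Run A t l B u) : P.Full B l' C := by
  obtain ⟨t', ht'⟩ := h
  obtain ⟨B', v, h1, h2⟩ := ht'.exists_of_append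
  rw [h'.last_unique h1]
  exact ⟨v, h2⟩

theorem lt_or_lt_of_ne (hne : B ≠ B') (h : B.1 = B'.1) :
    P.hi B.1 B.2 < P.lo B'.1 B'.2 ∨ P.hi B'.1 B'.2 < P.lo B.1 B.2 := by
  obtain ⟨i, j⟩ := B
  obtain ⟨i', j'⟩ := B'
  simp only at h
  subst h
  rcases lt_trichotomy j j' with h | rfl | h
  · exact Or.inl (P.hi_lt_lo _ _ _ h)
  · exact absurd rfl hne
  · exact Or.inr (P.hi_lt_lo _ _ _ h)

theorem Run.branch_eq (h : P.Run A t (l ++ [B]) C v) (h' : P.Run A t' (l ++ [B']) C' v') :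
    B.1 = B'.1 := by
  obtain ⟨D, u, h1, h2⟩ := h.exists_of_append
  obtain ⟨D', u', h3, h4⟩ := h'.exists_of_append
  obtain rfl := h1.last_unique h3
  cases h2 with
  | cons hl _ => cases h4 with
    | cons hl' _ => exact hl.1.symm.trans hl'.1

section LocallyConnected

variable [LocallyConnectedSpace T]

/-- Points of branches are not in the interior of T_ℝ, so the image must lie in the branch and
translate prescribed by the labels of A, which determines m. -/
theorem link_of_map_eq {m : ℤ} (ht : t ∈ P.interval A) (hu : u ∈ P.interval B)
    (h : F (hF.arc A.1 t) = (L.τ ^ m) (hF.arc B.1 u)) : P.Link A t B u := by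
  have h1 := P.image_subset A.1 A.2 ⟨_, ⟨t, ht, rfl⟩, rfl⟩
  rw [h] at h1
  obtain ⟨w, hw⟩ := hF.mem_shift_branch.1
    (h1.resolve_right (hF.shift_arc_notMem_interior _ _ _))
  obtain ⟨rfl, h2, -⟩ := hF.shift_arc_eq hw
  exact ⟨h2.symm, ht, hu, h⟩

theorem Run.eq_of_eq (h : P.Run A t l C v) (h' : P.Run A t l C v') : v = v' := by
  have := h.iterate.symm.trans h'.iterate
  exact (hF.shift_arc_eq this).2.2

/-- The minimum of A is mapped to the minimum of the target branch, so intermediate values cover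
everything below u there, including points of other letters of the branch. -/
theorem Link.down (h : P.Link A t B u) (hB : B'.1 = B.1) (hv : v ∈ P.interval B') (hvu : v ≤ u) :
    ∃ t' ≤ t, P.Link A t' B' v := by
  obtain ⟨h1, h2, -, h4⟩ := h
  have h5 := P.image_min A.1 A.2
  obtain ⟨t', ht', h6⟩ := hF.exists_map_arc_eq h2.1 h5 (h1 ▸ h4) hvu
  have h7 : P.ℓ A.1 A.2 = B'.1 := h1.trans hB.symm
  exact ⟨t', ht'.2, h7, ⟨ht'.1, ht'.2.trans h2.2⟩, hv, by rw [h6, h7]⟩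

/-- The past of a word is an initial segment of its last letter. -/
theorem Run.down (h : P.Run A t l C v) (hv' : v' ∈ P.interval C) (hv : v' ≤ v) :
    ∃ t' ≤ t, P.Run A t' l C v' := by
  induction h with
  | nil _ => exact ⟨v', hv, .nil hv'⟩
  | cons hl _ ih =>
    obtain ⟨u', hu', hr⟩ := ih hv' hv
    obtain ⟨t', ht', hl'⟩ := hl.down rfl hr.mem_left hu'
    exact ⟨t', ht', .cons hl' hr⟩

theorem Full.exists_run (h : P.Full A l C) (hv : v ∈ P.interval C) : ∃ t, P.Run A t l C v := by
  obtain ⟨t, ht⟩ := h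
  obtain ⟨t', -, h'⟩ := ht.down hv hv.2
  exact ⟨t', h'⟩

/-- A full word reaches every point of its last letter, so any run starting in that letter can be
prefixed by it. -/
theorem Full.append_run (h : P.Full A l B) (h' : P.Run B t l' C v) :
    ∃ t', P.Run A t' (l ++ l') C v := by
  obtain ⟨t', ht'⟩ := h.exists_run h'.mem_left
  exact ⟨t', ht'.append h'⟩

theorem Full.append (h : P.Full A l B) (h' : P.Full B l' C) : P.Full A (l ++ l') C := by
  obtain ⟨t, ht⟩ := h'
  exact h.append_run ht

/-- If a word can be continued by two letters, then the smaller one is covered. -/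
theorem Run.full_of_lt (h : P.Run A t (l ++ [B']) B' v) (hB : B.1 = B'.1)
    (hlt : P.hi B.1 B.2 < P.lo B'.1 B'.2) : P.Full A (l ++ [B]) B := by
  have hv := h.mem_right
  obtain ⟨C, u, h1, h2⟩ := h.exists_of_append
  cases h2 with
  | cons hl h2 =>
    cases h2
    obtain ⟨u', hu', hl'⟩ := hl.down hB (P.hi_mem_interval B) (hlt.le.trans hv.1)
    obtain ⟨t', -, hr⟩ := h1.down hl'.2.1 hu'
    exact ⟨t', hr.append (.cons hl' (.nil (P.hi_mem_interval B)))⟩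

/-- A word has at most one continuation whose past is not a whole interval. -/
theorem eq_of_not_full (h : P.Run A t (l ++ [B]) B v) (h' : P.Run A t' (l ++ [B']) B' v')
    (hB : ¬P.Full A (l ++ [B]) B) (hB' : ¬P.Full A (l ++ [B']) B') : B = B' := by
  by_contra hne
  rcases lt_or_lt_of_ne hne (h.branch_eq h') with hlt | hlt
  · exact hB (h'.full_of_lt (h.branch_eq h') hlt)
  · exact hB' (h.full_of_lt (h'.branch_eq h) hlt)

/-- Runs are not functions of the endpoint, so the fixed parameter is found as a minimum. For the
least starting parameter t₀ with t₀ ≤ v₀, pulling back t₀ itself gives a run starting at some t' ≤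
t₀, and minimality forces t' = t₀. -/
theorem Run.exists_fixed_of_le (h : P.Run D t l D v) (htv : t ≤ v) : ∃ t, P.Run D t l D t := by
  have hc : IsCompact {x : unitInterval × unitInterval | P.Run D x.1 l D x.2 ∧ x.1 ≤ x.2} :=
    (P.isCompact_run D l D).inter_right
      (isClosed_le (f := Prod.fst) (g := Prod.snd) continuous_fst continuous_snd)
  obtain ⟨⟨t₀, v₀⟩, ⟨h0, h0'⟩, hmin⟩ :=
    hc.exists_isMinOn ⟨(t, v), h, htv⟩ continuous_fst.continuousOn
  obtain ⟨t', ht', hr⟩ := h0.down h0.mem_left h0'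
  have := hmin (show (t', t₀) ∈ _ from ⟨hr, ht'⟩)
  obtain rfl : t' = t₀ := le_antisymm ht' this
  exact ⟨t', hr⟩

/-- If a word can be followed infinitely often, then some point follows it periodically. -/
theorem exists_fixed_of_forall_run {x : ℕ → unitInterval}
    (h : ∀ n, P.Run D (x n) l D (x (n + 1))) : ∃ t, P.Run D t l D t := by
  by_contra hno
  -- A single increase would already give a fixed parameter by the previous lemma; otherwise the
  -- sequence decreases and its limit is fixed because runs are closed.
  have hanti : Antitone x := antitone_nat_of_succ_le fun n => by
    by_contra! hlt
    exact hno ((h n).exists_fixed_of_le hlt.le)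
  have hlim := tendsto_atTop_iInf hanti
  exact hno ⟨_, (P.isCompact_run D l D).isClosed.mem_of_tendsto
    (hlim.prodMk_nhds (hlim.comp (tendsto_add_atTop_nat 1))) (Eventually.of_forall h)⟩

theorem Run.isPeriodicModOne (h : P.Run D t l D t) (hl : l ≠ []) :
    L.IsPeriodicModOne F (hF.arc D.1 t) ∧
      L.HasRotationNumber F (hF.arc D.1 t) (P.wt D l / l.length) := by
  have hpos : 0 < l.length := List.length_pos_iff.2 hl
  exact ⟨⟨_, hpos, _, h.iterate⟩, hF.toIsDegreeOne.hasRotationNumber_of_periodic hpos h.iterate⟩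

end LocallyConnected

end LiftedGraph.BasicPartition

/-! ### Infinite words, loops and chains -/

/-- The list `s (n + 1), …, s (n + k)`. -/
def seg {α : Type*} (s : ℕ → α) : ℕ → ℕ → List α
  | _, 0 => []
  | n, k + 1 => s (n + 1) :: seg s (n + 1) k

section Seg

variable {α : Type*} (s : ℕ → α)

theorem length_seg (n k : ℕ) : (seg s n k).length = k := by
  induction k generalizing n with
  | zero => rfl
  | succ k ih => rw [seg, List.length_cons, ih]

theorem seg_add (n j k : ℕ) : seg s n (j + k) = seg s n j ++ seg s (n + j) k := by
  induction j generalizing n with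
  | zero => simp [seg]
  | succ j ih =>
    rw [Nat.succ_add, seg, seg, ih, List.cons_append, show n + 1 + j = n + (j + 1) by ring]

theorem seg_succ (n k : ℕ) : seg s n (k + 1) = seg s n k ++ [s (n + k + 1)] := by
  rw [seg_add]; rfl

theorem seg_shift (m n k : ℕ) : seg (fun j => s (m + j)) n k = seg s (m + n) k := by
  induction k generalizing n with
  | zero => rfl
  | succ k ih => rw [seg, seg, ih]; rfl

theorem getElem_seg (n k i : ℕ) (h : i < (seg s n k).length) : (seg s n k)[i] = s (n + i + 1) := by
  induction k generalizing n i with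
  | zero => simp [seg] at h
  | succ k ih =>
    cases i with
    | zero => rfl
    | succ i =>
      have := ih (n + 1) i (by rw [length_seg] at h ⊢; omega)
      simp only [seg, List.getElem_cons_succ]
      rw [this]
      congr 1
      ring

/-- Nested lists are the initial segments of an infinite sequence. -/
theorem exists_seq_of_prefix {Λ : ℕ → List α} (h : ∀ k, Λ k <+: Λ (k + 1))
    (hlen : ∀ k, k ≤ (Λ k).length) (a : α) : ∃ s : ℕ → α, s 0 = a ∧ ∀ k, seg s 0 (Λ k).length = Λ k := by
  have hmono : ∀ j k, j ≤ k → Λ j <+: Λ k := fun j k hjk => by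
    induction k, hjk using Nat.le_induction with
    | base => exact List.prefix_refl _
    | succ k _ ih => exact ih.trans (h k)
  refine ⟨fun n => match n with
    | 0 => a
    | i + 1 => (Λ (i + 1))[i]'(hlen (i + 1)), rfl, fun k => ?_⟩
  refine List.ext_getElem (length_seg _ _ _) fun i h1 h2 => ?_
  rw [getElem_seg]
  simp only [zero_add]
  rcases le_total (i + 1) k with hk | hk
  · exact (hmono _ _ hk).getElem _
  · exact ((hmono _ _ hk).getElem _).symm

end Seg

theorem tendsto_div_of_abs_sub_le {a b : ℕ → ℝ} {C ρ : ℝ} (h : ∀ n, |a n - b n| ≤ C)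
    (hb : Tendsto (fun n : ℕ => b n / n) atTop (𝓝 ρ)) :
    Tendsto (fun n : ℕ => a n / n) atTop (𝓝 ρ) := by
  have h1 : Tendsto (fun n : ℕ => C / (n : ℝ)) atTop (𝓝 0) :=
    tendsto_const_nhds.div_atTop tendsto_natCast_atTop_atTop
  have h2 : Tendsto (fun n : ℕ => (a n - b n) / (n : ℝ)) atTop (𝓝 0) := by
    refine squeeze_zero_norm (fun n => ?_) h1
    rw [norm_div, Real.norm_eq_abs, Real.norm_natCast]
    exact div_le_div_of_nonneg_right (h n) (Nat.cast_nonneg n)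
  have h3 := h2.add hb
  rw [zero_add] at h3
  refine h3.congr fun n => ?_
  ring

namespace LiftedGraph.BasicPartition

variable {T : Type*} [MetricSpace T] {L : LiftedGraph T} {F : T → T} {hF : L.IsSunLike F}
  (P : BasicPartition hF)

/-- The lengths and weights of the loops of the letter `D`. -/
def loops (D : P.Letter) : Set (ℕ × ℤ) :=
  {x | ∃ l, l ≠ [] ∧ P.Full D l D ∧ x = (l.length, P.wt D l)}

/-- The closure of the set of mean weights of the loops of `D`. -/
def loopRot (D : P.Letter) : Set ℝ := closure (means (P.loops D))

/-- The sum of the weights of the first `n` letters. -/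
def wtSum (s : ℕ → P.Letter) (n : ℕ) : ℤ := ∑ i ∈ Finset.range n, P.p (s i).1 (s i).2

/-- The points of the letters `s n` with parameters `t n` form an orbit (mod 1). -/
def IsOrbit (s : ℕ → P.Letter) (t : ℕ → unitInterval) : Prop :=
  ∀ n, P.Link (s n) (t n) (s (n + 1)) (t (n + 1))

variable {P} {D : P.Letter} {s s' : ℕ → P.Letter} {t t' : ℕ → unitInterval} {ρ : ℝ}

theorem loops_pos : ∀ x ∈ P.loops D, 0 < x.1 := by
  rintro _ ⟨l, hl, -, rfl⟩
  exact List.length_pos_iff.2 hl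

theorem wtSum_add (s : ℕ → P.Letter) (m n : ℕ) :
    P.wtSum s (m + n) = P.wtSum s m + P.wtSum (fun j => s (m + j)) n :=
  Finset.sum_range_add _ m n

theorem wt_seg (s : ℕ → P.Letter) (n : ℕ) : P.wt (s 0) (seg s 0 n) = P.wtSum s n := by
  suffices h : ∀ m, P.wt (s m) (seg s m n) = P.wtSum (fun j => s (m + j)) n by
    simpa using h 0
  induction n with
  | zero => intro m; rfl
  | succ n ih =>
    intro m
    have h1 : P.wtSum (fun j => s (m + j)) 1 = P.p (s m).1 (s m).2 := by simp [wtSum]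
    rw [seg, wt, ih, add_comm n 1, wtSum_add, h1]
    simp only [add_assoc]

theorem exists_abs_wtSum_le (P : BasicPartition hF) :
    ∃ M : ℝ, 0 ≤ M ∧ ∀ s m n, |(P.wtSum s (m + n) : ℝ) - P.wtSum s m| ≤ n * M := by
  obtain ⟨M, hM⟩ := P.exists_abs_p_le
  refine ⟨max M 0, le_max_right _ _, fun s m n => ?_⟩
  rw [wtSum_add, Int.cast_add, add_sub_cancel_left, wtSum, Int.cast_sum]
  refine (Finset.abs_sum_le_sum_abs _ _).trans ?_
  refine (Finset.sum_le_card_nsmul _ _ (max M 0) fun i _ => (hM _).trans (le_max_left _ _)).trans ?_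
  simp

theorem tendsto_wtSum_shift (h : Tendsto (fun n : ℕ => (P.wtSum s n : ℝ) / n) atTop (𝓝 ρ)) (m : ℕ) :
    Tendsto (fun n : ℕ => (P.wtSum (fun j => s (m + j)) n : ℝ) / n) atTop (𝓝 ρ) := by
  obtain ⟨M, -, hM⟩ := P.exists_abs_wtSum_le
  refine tendsto_div_of_abs_sub_le (C := m * M + m * M) (fun n => ?_) h
  have h1 := hM s n m
  have h2 := hM s 0 m
  rw [zero_add] at h2
  have h3 : (P.wtSum s (n + m) : ℝ) = P.wtSum s m + P.wtSum (fun j => s (m + j)) n := by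
    rw [add_comm, wtSum_add]; push_cast; ring
  have h4 : (P.wtSum s 0 : ℝ) = 0 := by simp [wtSum]
  rw [h4] at h2
  rw [abs_le] at h1 h2 ⊢
  constructor <;> linarith [h1.1, h1.2, h2.1, h2.2]

theorem IsOrbit.shift (h : P.IsOrbit s t) (m : ℕ) :
    P.IsOrbit (fun j => s (m + j)) (fun j => t (m + j)) := fun n => h (m + n)

theorem IsOrbit.run (h : P.IsOrbit s t) (n k : ℕ) :
    P.Run (s n) (t n) (seg s n k) (s (n + k)) (t (n + k)) := by
  induction k generalizing n with
  | zero => exact .nil (h n).2.1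
  | succ k ih =>
    have := ih (n + 1)
    rw [show n + 1 + k = n + (k + 1) by ring] at this
    exact .cons (h n) this

theorem IsOrbit.iterate (h : P.IsOrbit s t) (n : ℕ) :
    F^[n] (hF.arc (s 0).1 (t 0)) = (L.τ ^ P.wtSum s n) (hF.arc (s n).1 (t n)) := by
  have := (h.run 0 n).iterate
  rwa [length_seg, wt_seg, zero_add] at this

theorem nonempty_loops (h : (P.loopRot D).Nonempty) :
    (P.loops D).Nonempty := by
  obtain ⟨_, x, hx, -⟩ := closure_nonempty_iff.1 h
  exact ⟨x, hx⟩

theorem nonempty_loopRot (h : (P.loops D).Nonempty) :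
    (P.loopRot D).Nonempty := by
  obtain ⟨x, hx⟩ := h
  exact ⟨_, subset_closure ⟨x, hx, rfl⟩⟩

section LocallyConnected

variable [LocallyConnectedSpace T]

/-- Full loops concatenate to full loops. This additivity makes the set of means dense in an
interval. -/
theorem loops_add : ∀ x ∈ P.loops D, ∀ y ∈ P.loops D, x + y ∈ P.loops D := by
  rintro _ ⟨l, hl, h, rfl⟩ _ ⟨l', hl', h', rfl⟩
  refine ⟨l ++ l', by simp [hl], h.append h', ?_⟩
  obtain ⟨t, ht⟩ := h
  rw [ht.wt_append, List.length_append]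
  rfl

theorem ordConnected_loopRot : (P.loopRot D).OrdConnected :=
  ordConnected_closure_means loops_add loops_pos

theorem IsOrbit.abs_sub_le (h : P.IsOrbit s t) (n : ℕ) :
    |(L.retr (F^[n] (hF.arc (s 0).1 (t 0))) - L.retr (hF.arc (s 0).1 (t 0))) - P.wtSum s n| ≤ 1 := by
  rw [h.iterate, retr_tau_zpow, abs_le]
  have h1 := retr_mem_of_branch (hF.arc_mem (s 0).1 (t 0))
  have h2 := retr_mem_of_branch (hF.arc_mem (s n).1 (t n))
  constructor <;> linarith [h1.1, h1.2, h2.1, h2.2]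

theorem IsOrbit.hasRotationNumber_iff (h : P.IsOrbit s t) :
    L.HasRotationNumber F (hF.arc (s 0).1 (t 0)) ρ ↔
      Tendsto (fun n : ℕ => (P.wtSum s n : ℝ) / n) atTop (𝓝 ρ) :=
  ⟨fun h' => tendsto_div_of_abs_sub_le (fun n => by rw [abs_sub_comm]; exact h.abs_sub_le n) h',
    fun h' => tendsto_div_of_abs_sub_le h.abs_sub_le h'⟩

/-- An infinite word whose initial segments can be followed is followed by a point. -/
theorem exists_isOrbit (h : ∀ n, ∃ t v, P.Run (s 0) t (seg s 0 n) (s n) v) : ∃ t, P.IsOrbit s t := by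
  -- Starting parameters of the finite runs form nested nonempty compact sets. A common parameter
  -- works for all lengths, and uniqueness of endpoints makes the finite runs consistent.
  set K : ℕ → Set unitInterval := fun n => Prod.fst ''
    {x : unitInterval × unitInterval | P.Run (s 0) x.1 (seg s 0 n) (s n) x.2} with hK
  have hKc : ∀ n, IsCompact (K n) := fun n => (P.isCompact_run _ _ _).image continuous_fst
  have hsplit : ∀ {n t v}, P.Run (s 0) t (seg s 0 (n + 1)) (s (n + 1)) v →
      ∃ u, P.Run (s 0) t (seg s 0 n) (s n) u ∧ P.Link (s n) u (s (n + 1)) v := by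
    intro n t v hr
    rw [seg_succ] at hr
    obtain ⟨C, u, h1, h2⟩ := hr.exists_of_append
    obtain ⟨t', v', h'⟩ := h n
    obtain rfl := h1.last_unique h'
    rw [zero_add] at h2
    cases h2 with
    | cons hl h3 =>
      cases h3
      exact ⟨u, h1, hl⟩
  obtain ⟨t₀, ht₀⟩ := IsCompact.nonempty_iInter_of_sequence_nonempty_isCompact_isClosed K
    (fun n => by
      rintro _ ⟨⟨t, v⟩, hr, rfl⟩
      obtain ⟨u, hu, -⟩ := hsplit hr
      exact ⟨(t, u), hu, rfl⟩)
    (fun n => by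
      obtain ⟨t, v, hr⟩ := h n
      exact ⟨t, (t, v), hr, rfl⟩) (hKc 0) (fun n => (hKc n).isClosed)
  have hrun : ∀ n, ∃ v, P.Run (s 0) t₀ (seg s 0 n) (s n) v := by
    intro n
    obtain ⟨⟨_, v⟩, hr, rfl⟩ := mem_iInter.1 ht₀ n
    exact ⟨v, hr⟩
  choose v hv using hrun
  refine ⟨v, fun n => ?_⟩
  obtain ⟨u, hu, hl⟩ := hsplit (hv (n + 1))
  rwa [hu.eq_of_eq (hv n)] at hl

/-- The points of `loopRot D` are the slopes of concatenations of loops. -/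
theorem exists_seq_of_mem_loopRot {α : ℝ} (hα : α ∈ P.loopRot D) :
    ∃ (s : ℕ → P.Letter) (Q : ℕ → ℕ), s 0 = D ∧ (∀ k, k ≤ Q k) ∧
      (∀ k, s (Q k) = D ∧ P.Full D (seg s 0 (Q k)) D) ∧
      ∀ (a : ℕ → ℝ) (M C : ℝ), (∀ m, |a (m + 1) - a m| ≤ M) →
        (∀ n, |a n - P.wtSum s n| ≤ C) → Tendsto (fun m : ℕ => a m / m) atTop (𝓝 α) := by
  obtain ⟨x, hx, hsched⟩ := exists_schedule loops_pos hα
  choose l hl hfull hxl using hx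
  set Λ : ℕ → List P.Letter := fun k => Nat.rec [] (fun k r => r ++ l k) k with hΛ
  have hΛs : ∀ k, Λ (k + 1) = Λ k ++ l k := fun k => rfl
  have hΛf : ∀ k, P.Full D (Λ k) D := by
    intro k
    induction k with
    | zero => exact ⟨_, .nil (P.hi_mem_interval D)⟩
    | succ k ih => rw [hΛs]; exact ih.append (hfull k)
  have hlen : ∀ k, (Λ k).length = ∑ i ∈ Finset.range k, (x i).1 := by
    intro k
    induction k with
    | zero => rfl
    | succ k ih => rw [hΛs, List.length_append, ih, Finset.sum_range_succ, hxl]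
  have hwt : ∀ k, P.wt D (Λ k) = ∑ i ∈ Finset.range k, (x i).2 := by
    intro k
    induction k with
    | zero => rfl
    | succ k ih =>
      obtain ⟨t, ht⟩ := hΛf k
      rw [hΛs, ht.wt_append, ih, Finset.sum_range_succ, hxl]
  have hle : ∀ k, k ≤ (Λ k).length := by
    intro k
    induction k with
    | zero => exact Nat.zero_le _
    | succ k ih =>
      rw [hΛs, List.length_append]
      have := List.length_pos_iff.2 (hl k)
      omega
  obtain ⟨s, hs0, hs⟩ := exists_seq_of_prefix (fun k => ⟨l k, (hΛs k).symm⟩) hle D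
  refine ⟨s, fun k => (Λ k).length, hs0, hle, fun k => ⟨?_, by rw [hs]; exact hΛf k⟩,
    fun a M C hM hC => ?_⟩
  · show s (Λ k).length = D
    cases hk : (Λ k).length with
    | zero => exact hs0
    | succ n =>
      obtain ⟨t, ht⟩ := hΛf k
      rw [← hs k, hk, seg_succ, zero_add] at ht
      exact ht.last_eq.symm
  · refine hsched a M C hM fun n => ?_
    have := hC (Λ n).length
    rw [← wt_seg, hs, hs0, hwt, hlen] at this
    exact this

/-- A concatenation of loops with the prescribed slope has initial segments that can all be
followed, so by compactness some point follows the whole of it. -/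
theorem loopRot_subset_Rot : P.loopRot D ⊆ L.Rot F := by
  intro α hα
  obtain ⟨s, Q, hs0, hQ, hs, hlim⟩ := exists_seq_of_mem_loopRot hα
  obtain ⟨t, ht⟩ := exists_isOrbit (s := s) fun n => by
    obtain ⟨-, t, hr⟩ := hs n
    obtain ⟨k, hk⟩ := Nat.exists_eq_add_of_le (hQ n)
    rw [hk, seg_add] at hr
    obtain ⟨C, v, h1, -⟩ := hr.exists_of_append
    cases n with
    | zero =>
      cases h1
      exact ⟨t, t, by rw [hs0]; exact .nil ‹_›⟩
    | succ n =>
      have h2 := h1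
      rw [seg_succ, zero_add] at h2
      rw [← h2.last_eq, hs0]
      exact ⟨t, v, h1⟩
  obtain ⟨M, -, hM⟩ := hF.toIsDegreeOne.exists_bound
  refine ⟨_, hlim _ M 1 (fun m => ?_) ht.abs_sub_le⟩
  rw [sub_sub_sub_cancel_right, Function.iterate_succ_apply']
  exact hM _

/-- The orbits that do not enter the interior of `T_ℝ` follow the letters of the partition. -/
theorem exists_isOrbit_of_notMem (P : BasicPartition hF) {x : T}
    (hx : ∀ n, F^[n] x ∉ interior (L.TR F)) :
    ∃ (m : ℤ) (s : ℕ → P.Letter) (t : ℕ → unitInterval), P.IsOrbit s t ∧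
      x = (L.τ ^ m) (hF.arc (s 0).1 (t 0)) := by
  have h1 : ∀ n, ∃ (m : ℤ) (i : L.Branch F) (t : unitInterval), F^[n] x = (L.τ ^ m) (hF.arc i t) :=
    fun n => (hF.mem_interior_TR_or _).resolve_left (hx n)
  choose m i t h1 using h1
  have h2 : ∀ n, F (hF.arc (i n) (t n)) =
      (L.τ ^ (-m n + m (n + 1))) (hF.arc (i (n + 1)) (t (n + 1))) := by
    intro n
    rw [tau_zpow_add, ← h1, Function.iterate_succ_apply', h1, hF.toIsDegreeOne.map_tau_zpow,
      tau_zpow_neg_apply]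
  have h3 : ∀ n, ∃ j : Fin (P.N (i n)), t n ∈ Icc (P.lo (i n) j) (P.hi (i n) j) := by
    intro n
    by_contra! hcon
    refine P.image_compl _ (branch_subset_X _ (hF.arc_mem (i n) (t n))) ?_ (-m n + m (n + 1)) ?_
    · rintro k j ⟨u, hu, huk⟩
      have h4 : hF.arc k u = (L.τ ^ (0 : ℤ)) (hF.arc (i n) (t n)) := huk
      obtain ⟨-, rfl, rfl⟩ := hF.arc_eq_shift_arc h4
      exact hcon j hu
    · rw [h2]
      exact ⟨_, branch_subset_X _ (hF.arc_mem _ _), rfl⟩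
  choose j hj using h3
  refine ⟨m 0, fun n => ⟨i n, j n⟩, t, fun n => ?_, h1 0⟩
  exact link_of_map_eq (hj n) (hj (n + 1)) (h2 n)

/-- The orbit starts at the letter `D` and its initial words never cover a whole letter. -/
def IsChain (P : BasicPartition hF) (s : ℕ → P.Letter) : Prop :=
  ∀ k, 0 < k → ¬P.Full (s 0) (seg s 0 k) (s k)

/-- At each time both next letters are non-full continuations of the same word, so they coincide. -/
theorem IsOrbit.eq_of_isChain (h : P.IsOrbit s t) (h' : P.IsOrbit s' t') (hs : P.IsChain s)
    (hs' : P.IsChain s') (h0 : s 0 = s' 0) : s = s' := by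
  have key : ∀ n, seg s 0 n = seg s' 0 n ∧ s n = s' n := by
    intro n
    induction n with
    | zero => exact ⟨rfl, h0⟩
    | succ n ih =>
      have h1 := h.run 0 (n + 1)
      have h2 := h'.run 0 (n + 1)
      have h3 := hs (n + 1) n.succ_pos
      have h4 := hs' (n + 1) n.succ_pos
      rw [seg_succ, zero_add] at h1 h2 h3 h4
      rw [← ih.1, ← h0] at h2 h4
      rw [zero_add] at h1 h2
      have h5 := eq_of_not_full h1 h2 h3 h4
      exact ⟨by rw [seg_succ, seg_succ, ih.1, zero_add, h5], h5⟩
  exact funext fun n => (key n).2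

/-- Either the rotation number of an orbit is a limit of means of loops, or the orbit is eventually
a chain whose letters are periodic. -/
theorem IsOrbit.cases (h : P.IsOrbit s t)
    (hρ : Tendsto (fun n : ℕ => (P.wtSum s n : ℝ) / n) atTop (𝓝 ρ)) :
    (∃ D, ρ ∈ P.loopRot D) ∨ ∃ m k, 0 < k ∧ P.IsChain (fun j => s (m + j)) ∧
      ∀ j, s (m + (k + j)) = s (m + j) := by
  have := P.finite_letter
  by_cases hcase : ∃ n, ∃ᶠ k in atTop, P.Full (s n) (seg s n k) (s (n + k))
  · left
    obtain ⟨n, hn⟩ := hcase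
    -- Some letter is fully covered infinitely often. Between its first such occurrence and the
    -- later ones the orbit traces full loops of this letter.
    obtain ⟨B, hB⟩ : ∃ B, ∃ᶠ k in atTop, P.Full (s n) (seg s n k) (s (n + k)) ∧ s (n + k) = B := by
      by_contra! hcon
      refine hn ?_
      filter_upwards [eventually_all.2 hcon] with k hk hf
      exact hk _ hf rfl
    rw [frequently_atTop] at hB
    obtain ⟨k₀, -, -, hk₀⟩ := hB 0
    refine ⟨B, mem_closure_means_of_frequently (K := 0) (K' := 0)
      (tendsto_wtSum_shift hρ (n + k₀)) (frequently_atTop.2 fun a => ?_)⟩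
    obtain ⟨b, hb, hf, hsb⟩ := hB (k₀ + a + 1)
    obtain ⟨k, rfl⟩ := Nat.exists_eq_add_of_le (show k₀ ≤ b by omega)
    rw [seg_add, hsb] at hf
    have hf' := hf.of_append (h.run n k₀)
    rw [hk₀] at hf'
    refine ⟨k, by omega, (k, P.wtSum (fun j => s (n + k₀ + j)) k), ⟨seg s (n + k₀) k, ?_, hf', ?_⟩,
      le_rfl, le_rfl, by simp⟩
    · rw [← List.length_pos_iff, length_seg]
      omega
    · rw [length_seg, ← wt_seg, seg_shift, ← hk₀]
      rfl
  · right
    push Not at hcase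
    have hJ : ∀ n, ∃ m ≥ n, P.IsChain (fun j => s (m + j)) := by
      intro n
      obtain ⟨N, hN⟩ := eventually_atTop.1 (hcase n)
      classical
      have hex : ∃ k, P.Full (s n) (seg s n k) (s (n + k)) := ⟨0, _, .nil (P.hi_mem_interval _)⟩
      -- After the last full covering from n a chain begins, since a later full covering from n + k
      -- would compose with this one.
      obtain ⟨k, hk, hmax⟩ : ∃ k, P.Full (s n) (seg s n k) (s (n + k)) ∧
          ∀ j, P.Full (s n) (seg s n j) (s (n + j)) → j ≤ k := by
        have hfin : {k | P.Full (s n) (seg s n k) (s (n + k))}.Finite :=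
          (finite_lt_nat N).subset fun k hk => not_le.1 fun hle => hN k hle hk
        obtain ⟨k, hk, hmax⟩ := hfin.exists_maximalFor id _ hex
        refine ⟨k, hk, fun j hj => ?_⟩
        by_contra! hlt
        exact absurd (hmax hj hlt.le) (not_le.2 hlt)
      refine ⟨n + k, Nat.le_add_right _ _, fun j hj hf => ?_⟩
      rw [seg_shift] at hf
      have := hk.append hf
      simp only [add_zero] at this
      rw [← seg_add, add_assoc] at this
      have := hmax _ this
      omega
    have hinf : {m | P.IsChain (fun j => s (m + j))}.Infinite :=
      infinite_of_forall_exists_gt fun n => by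
        obtain ⟨m, hm, hc⟩ := hJ (n + 1)
        exact ⟨m, hc, hm⟩
    -- Two of the infinitely many chain starting times carry the same letter, and the chains
    -- starting there agree; this is the period.
    obtain ⟨m, hm, m', hm', hne, heq⟩ :=
      hinf.exists_lt_map_eq_of_mapsTo (f := s) (fun _ _ => mem_univ _) finite_univ
    obtain ⟨k, rfl⟩ := Nat.exists_eq_add_of_le hne.le
    have := (h.shift m).eq_of_isChain (h.shift (m + k)) hm hm' heq
    refine ⟨m, k, by omega, hm, fun j => ?_⟩
    rw [← add_assoc]
    exact (congrFun this j).symm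

/-- The rotation number of an orbit with a periodic sequence of letters is that of a periodic
point. -/
theorem IsOrbit.exists_periodic (h : P.IsOrbit s t)
    (hρ : Tendsto (fun n : ℕ => (P.wtSum s n : ℝ) / n) atTop (𝓝 ρ)) {k : ℕ} (hk : 0 < k)
    (hper : ∀ j, s (k + j) = s j) : ∃ x, L.IsPeriodicModOne F x ∧ L.HasRotationNumber F x ρ := by
  have hper' : ∀ n j, s (n * k + j) = s j := by
    intro n
    induction n with
    | zero => simp
    | succ n ih => intro j; rw [← ih j, ← hper (n * k + j)]; congr 1; ring
  have hseg : ∀ n, seg s (n * k) k = seg s 0 k := by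
    intro n
    have := seg_shift s (n * k) 0 k
    rw [add_zero] at this
    rw [← this]
    exact congrArg (fun σ => seg σ 0 k) (funext (hper' n))
  have hrun : ∀ n, P.Run (s 0) (t (n * k)) (seg s 0 k) (s 0) (t ((n + 1) * k)) := by
    intro n
    have h1 := h.run (n * k) k
    have h2 := hper' n 0
    have h3 := hper' (n + 1) 0
    rw [add_zero] at h2 h3
    rwa [hseg, h2, show n * k + k = (n + 1) * k by ring, h3] at h1
  obtain ⟨t₀, ht₀⟩ := exists_fixed_of_forall_run hrun
  have hne : seg s 0 k ≠ [] := by rw [← List.length_pos_iff, length_seg]; exact hk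
  obtain ⟨h1, h2⟩ := ht₀.isPeriodicModOne hne
  refine ⟨_, h1, ?_⟩
  rw [length_seg, wt_seg] at h2
  convert h2 using 1
  have hW : ∀ n, P.wtSum s (n * k) = n * P.wtSum s k := by
    intro n
    induction n with
    | zero => simp [wtSum]
    | succ n ih =>
      rw [show (n + 1) * k = n * k + k by ring, wtSum_add, ih, funext (hper' n)]
      push_cast; ring
  have hlim := hρ.comp (tendsto_id.atTop_mul_const' hk)
  refine tendsto_nhds_unique hlim (tendsto_const_nhds.congr' ?_)
  filter_upwards [eventually_ge_atTop 1] with n hn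
  have hn0 : (n : ℝ) ≠ 0 := by exact_mod_cast (by omega : n ≠ 0)
  have hk0 : (k : ℝ) ≠ 0 := by exact_mod_cast hk.ne'
  simp only [Function.comp, id]
  rw [hW]
  push_cast
  field_simp

/-- The rotation number of the chain starting at `D`, if there is one. -/
def chainRot (P : BasicPartition hF) (D : P.Letter) : Set ℝ :=
  {ρ | ∃ s t, s 0 = D ∧ P.IsOrbit s t ∧ P.IsChain s ∧
    Tendsto (fun n : ℕ => (P.wtSum s n : ℝ) / n) atTop (𝓝 ρ)}

theorem subsingleton_chainRot : (P.chainRot D).Subsingleton := by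
  rintro ρ ⟨s, t, h0, h1, h2, h3⟩ ρ' ⟨s', t', h0', h1', h2', h3'⟩
  obtain rfl := h1.eq_of_isChain h1' h2 h2' (h0.trans h0'.symm)
  exact tendsto_nhds_unique h3 h3'

theorem chainRot_subset_Rot : P.chainRot D ⊆ L.Rot F := by
  rintro ρ ⟨s, t, -, h1, -, h3⟩
  exact ⟨_, h1.hasRotationNumber_iff.2 h3⟩

/-- For a full loop the endpoint is the maximum of D, so the starting parameter is at most the final
one and a fixed parameter exists. -/
theorem exists_periodic_of_mem_means {x : ℝ} (hx : x ∈ means (P.loops D)) :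
    ∃ z, L.IsPeriodicModOne F z ∧ L.HasRotationNumber F z x := by
  obtain ⟨_, ⟨l, hl, ⟨t, ht⟩, rfl⟩, rfl⟩ := hx
  obtain ⟨t', ht'⟩ := ht.exists_fixed_of_le ht.mem_left.2
  exact ⟨_, ht'.isPeriodicModOne hl⟩

end LocallyConnected

end LiftedGraph.BasicPartition

/-! ### The covering graph and the rotation sets of its components -/

/-- A vertex lying on a cycle of an oriented graph belongs to a maximal strongly connected set of
vertices, which consists of the vertices `y` joined to it in both directions. -/
theorem maximal_stronglyConnected {V : Type*} {r : V → V → Prop} {x : V}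
    (hx : Relation.TransGen r x x) :
    Maximal (fun D : Set V => D.Nonempty ∧
      ∀ u ∈ D, ∀ v ∈ D, Relation.TransGen (fun a b => a ∈ D ∧ b ∈ D ∧ r a b) u v)
      {y | Relation.TransGen r x y ∧ Relation.TransGen r y x} := by
  set C : Set V := {y | Relation.TransGen r x y ∧ Relation.TransGen r y x} with hC
  have hstep : ∀ u ∈ C, ∀ v, Relation.TransGen r u v → v ∈ C →
      Relation.TransGen (fun a b => a ∈ C ∧ b ∈ C ∧ r a b) u v := by
    intro u hu v huv
    induction huv with
    | single h => exact fun hv => .single ⟨hu, hv, h⟩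
    | @tail b c hub hbc ih =>
      intro hv
      have hb : b ∈ C := ⟨hu.1.trans hub, .head hbc hv.2⟩
      exact .tail (ih hb) ⟨hb, hv, hbc⟩
  refine ⟨⟨⟨x, hx, hx⟩, fun u hu v hv => hstep u hu v (hu.2.trans hv.1) hv⟩, ?_⟩
  rintro D ⟨-, hD⟩ hCD y hy
  have hxD : x ∈ D := hCD ⟨hx, hx⟩
  have hsub : (fun a b => a ∈ D ∧ b ∈ D ∧ r a b) ≤ r := fun _ _ h => h.2.2
  exact ⟨Relation.TransGen.mono hsub _ _ (hD x hxD y hy),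
    Relation.TransGen.mono hsub _ _ (hD y hy x hxD)⟩

namespace LiftedGraph.BasicPartition

variable {T : Type*} [MetricSpace T] {L : LiftedGraph T} {F : T → T} {hF : L.IsSunLike F}
  {P : BasicPartition hF} {A B C D : P.Letter} {t v : unitInterval} {l l' : List P.Letter}

theorem mem_shift_cell {m : ℤ} {x : T} :
    x ∈ L.shift m (P.cell A) ↔ ∃ t ∈ P.interval A, x = (L.τ ^ m) (hF.arc A.1 t) := by
  constructor
  · rintro ⟨_, ⟨t, ht, rfl⟩, rfl⟩
    exact ⟨t, ht, rfl⟩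
  · rintro ⟨t, ht, rfl⟩
    exact ⟨_, ⟨t, ht, rfl⟩, rfl⟩

theorem exists_eq_append_singleton (h : P.Run A t l C v) : ∃ u, A :: l = u ++ [C] := by
  rcases List.eq_nil_or_concat l with rfl | ⟨l', B, rfl⟩
  · cases h
    exact ⟨[], rfl⟩
  · rw [List.concat_eq_append] at h ⊢
    rw [h.last_eq]
    exact ⟨A :: l', rfl⟩

theorem abs_wt_le (P : BasicPartition hF) : ∃ M : ℝ, 0 ≤ M ∧ ∀ A l, |(P.wt A l : ℝ)| ≤ l.length * M := by
  obtain ⟨M, hM⟩ := P.exists_abs_p_le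
  refine ⟨max M 0, le_max_right _ _, fun A l => ?_⟩
  induction l generalizing A with
  | nil => simp [wt]
  | cons B l ih =>
    rw [wt, List.length_cons]
    push_cast
    have h1 := (hM A).trans (le_max_left M 0)
    have h2 := ih B
    have h3 := abs_add_le (P.p A.1 A.2 : ℝ) (P.wt B l)
    linarith

theorem lastLetter_vertex (w : P.Word) : P.lastLetter (P.vertex w) = w.1.getLast w.2.1 := rfl

section LocallyConnected

variable [LocallyConnectedSpace T]

/-- Translates of the cells are located uniquely, so visiting them successively modulo translations
is the same as having linked parameters; the translations are forced by the weights. -/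
theorem follows_iff {x : T} : (∀ (i : ℕ) (hi : i < (A :: l).length),
      ∃ m : ℤ, F^[i] x ∈ L.shift m (P.cell (A :: l)[i])) ↔
    ∃ (m : ℤ) (t : unitInterval) (C : P.Letter) (v : unitInterval),
      x = (L.τ ^ m) (hF.arc A.1 t) ∧ P.Run A t l C v := by
  induction l generalizing A x with
  | nil =>
    constructor
    · intro h
      obtain ⟨m, hm⟩ := h 0 (by simp)
      obtain ⟨t, ht, hx⟩ := mem_shift_cell.1 hm
      exact ⟨m, t, A, t, hx, .nil ht⟩
    · rintro ⟨m, t, C, v, rfl, h⟩ i hi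
      obtain rfl : i = 0 := by simpa using hi
      exact ⟨m, mem_shift_cell.2 ⟨t, h.mem_left, rfl⟩⟩
  | cons B l ih =>
    constructor
    · intro h
      obtain ⟨m, hm⟩ := h 0 (by simp)
      obtain ⟨t, ht, hx⟩ := mem_shift_cell.1 hm
      obtain ⟨m', u, C, v, hu, hr⟩ := (ih (A := B) (x := F x)).1 fun i hi => by
        have := h (i + 1) (by simpa using hi)
        simpa only [Function.iterate_succ_apply, List.getElem_cons_succ] using this
      have hx0 : x = (L.τ ^ m) (hF.arc A.1 t) := hx
      refine ⟨m, t, C, v, hx0, .cons (link_of_map_eq (m := -m + m') ht hr.mem_left ?_) hr⟩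
      rw [tau_zpow_add, ← hu, hx0, hF.toIsDegreeOne.map_tau_zpow, tau_zpow_neg_apply]
    · rintro ⟨m, t, C, v, rfl, h⟩ i hi
      cases h with
      | @cons _ _ _ _ u _ _ hl hr =>
        cases i with
        | zero => exact ⟨m, mem_shift_cell.2 ⟨t, hl.2.1, rfl⟩⟩
        | succ i =>
          have h1 : F ((L.τ ^ m) (hF.arc A.1 t)) =
              (L.τ ^ (m + P.p A.1 A.2)) (hF.arc B.1 u) := by
            rw [hF.toIsDegreeOne.map_tau_zpow, hl.2.2.2, tau_zpow_add]
          have := (ih (A := B) (x := F ((L.τ ^ m) (hF.arc A.1 t)))).2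
            ⟨_, u, C, v, h1, hr⟩ i (by simpa using hi)
          simpa only [Function.iterate_succ_apply, List.getElem_cons_succ] using this

theorem mem_past_cons {y : T} :
    y ∈ P.past (A :: l) ↔ ∃ t C v, P.Run A t l C v ∧ y = hF.arc C.1 v := by
  constructor
  · rintro ⟨⟨x, hx, rfl⟩, hy⟩
    obtain ⟨m, t, C, v, rfl, hr⟩ := follows_iff.1 hx
    refine ⟨t, C, v, hr, ?_⟩
    obtain ⟨i, u, hu⟩ := hF.exists_arc_of_mem_X hy
    simp only [List.length_cons, Nat.add_sub_cancel] at hu ⊢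
    rw [(hF.toIsDegreeOne.iterate _).map_tau_zpow, hr.iterate, ← tau_zpow_add] at hu ⊢
    obtain ⟨h0, -, -⟩ := hF.arc_eq_shift_arc hu.symm
    rw [h0, zpow_zero]
    rfl
  · rintro ⟨t, C, v, hr, rfl⟩
    refine ⟨⟨(L.τ ^ (-P.wt A l)) (hF.arc A.1 t), follows_iff.2 ⟨_, t, C, v, rfl, hr⟩, ?_⟩,
      branch_subset_X _ (hF.arc_mem _ _)⟩
    simp only [List.length_cons, Nat.add_sub_cancel]
    rw [(hF.toIsDegreeOne.iterate _).map_tau_zpow, hr.iterate, tau_zpow_neg_apply]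

theorem eq_of_arc_eq {u v : unitInterval} (hu : u ∈ P.interval A) (hv : v ∈ P.interval B)
    (h : hF.arc A.1 u = hF.arc B.1 v) : A = B ∧ u = v := by
  have h' : hF.arc A.1 u = (L.τ ^ (0 : ℤ)) (hF.arc B.1 v) := h
  obtain ⟨-, h1, rfl⟩ := hF.arc_eq_shift_arc h'
  refine ⟨?_, rfl⟩
  by_contra hne
  rcases lt_or_lt_of_ne hne h1 with h2 | h2
  · exact absurd (hu.2.trans_lt h2) (not_lt.2 hv.1)
  · exact absurd (hv.2.trans_lt h2) (not_lt.2 hu.1)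

theorem past_eq_cell_iff : P.past (A :: l) = P.cell C ↔ P.Full A l C := by
  constructor
  · intro h
    have : hF.arc C.1 (P.hi C.1 C.2) ∈ P.past (A :: l) := h ▸ ⟨_, P.hi_mem_interval C, rfl⟩
    obtain ⟨t, C', v, hr, hv⟩ := mem_past_cons.1 this
    obtain ⟨rfl, rfl⟩ := eq_of_arc_eq (P.hi_mem_interval C) hr.mem_right hv
    exact ⟨t, hr⟩
  · intro h
    ext y
    rw [mem_past_cons]
    constructor
    · rintro ⟨t, C', v, hr, rfl⟩
      obtain ⟨t', hr'⟩ := h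
      obtain rfl := hr.last_unique hr'
      exact ⟨v, hr.mem_right, rfl⟩
    · rintro ⟨v, hv, rfl⟩
      obtain ⟨t, hr⟩ := h.exists_run hv
      exact ⟨t, C, v, hr, rfl⟩

/-- The past of a long word depends on an initial part only through the past of that part, which is
what makes `equiv` compatible with continuations. -/
theorem past_append (u s : List P.Letter) (S : P.Letter) : P.past ((u ++ [S]) ++ s) =
    {y | ∃ t C v, hF.arc S.1 t ∈ P.past (u ++ [S]) ∧ P.Run S t s C v ∧ y = hF.arc C.1 v} := by
  obtain ⟨A, l, h, hlast⟩ : ∃ A l, u ++ [S] = A :: l ∧ ∀ t C v, P.Run A t l C v → C = S := by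
    cases u with
    | nil => exact ⟨S, [], rfl, fun t C v h => by cases h; rfl⟩
    | cons A u => exact ⟨A, u ++ [S], rfl, fun t C v h => h.last_eq⟩
  rw [h]
  ext y
  rw [List.cons_append, mem_past_cons]
  constructor
  · rintro ⟨t, C, v, hr, rfl⟩
    obtain ⟨B, w, h1, h2⟩ := hr.exists_of_append
    obtain rfl := hlast _ _ _ h1
    exact ⟨w, C, v, mem_past_cons.2 ⟨t, B, w, h1, rfl⟩, h2, rfl⟩
  · rintro ⟨t, C, v, ht, hr, rfl⟩
    obtain ⟨t', B, w, h1, h2⟩ := mem_past_cons.1 ht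
    obtain rfl := hlast _ _ _ h1
    obtain ⟨-, rfl⟩ := eq_of_arc_eq hr.mem_left h1.mem_right h2
    exact ⟨t', C, v, h1.append hr, rfl⟩

/-- Vertices are a quotient by the equivalence relation generated by `equiv`, so the claim is
checked on generators and propagated. Arrows out of a vertex can then be read on any chosen
representative. -/
theorem past_congr {w w' : P.Word} (h : P.vertex w = P.vertex w') :
    P.past w.1 = P.past w'.1 ∧
      ∀ A, ((P.past (w.1 ++ [A])).Nonempty ↔ (P.past (w'.1 ++ [A])).Nonempty) ∧
        ∀ h h', P.vertex ⟨w.1 ++ [A], h⟩ = P.vertex ⟨w'.1 ++ [A], h'⟩ := by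
  replace h := Quot.eqvGen_exact h
  induction h with
  | rel w w' h =>
    obtain ⟨u, u', s, S, h1, h2, h3, h4⟩ := h
    have hp : ∀ s, P.past ((u ++ [S]) ++ s) = P.past ((u' ++ [S]) ++ s) := fun s => by
      rw [past_append, past_append, h3, h4]
    refine ⟨by rw [h1, h2, hp], fun A => ⟨?_, fun h h' => Quot.sound
      ⟨u, u', s ++ [A], S, ?_, ?_, h3, h4⟩⟩⟩
    · rw [h1, h2, List.append_assoc _ s, List.append_assoc _ s, hp]
    · simp only [h1, List.append_assoc]
    · simp only [h2, List.append_assoc]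
  | refl w => exact ⟨rfl, fun A => ⟨Iff.rfl, fun _ _ => rfl⟩⟩
  | symm w w' _ ih =>
    exact ⟨ih.1.symm, fun A => ⟨(ih.2 A).1.symm, fun h h' => ((ih.2 A).2 h' h).symm⟩⟩
  | trans w₁ w₂ w₃ _ _ ih ih' =>
    refine ⟨ih.1.trans ih'.1, fun A => ⟨(ih.2 A).1.trans (ih'.2 A).1, fun h h' => ?_⟩⟩
    have h2 : w₂.1 ++ [A] ≠ [] ∧ (P.past (w₂.1 ++ [A])).Nonempty :=
      ⟨by simp, (ih.2 A).1.1 h.2⟩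
    exact ((ih.2 A).2 h h2).trans ((ih'.2 A).2 h2 h')

theorem Arrow.exists_word {w : P.Word} {β : P.Vertex} (h : P.Arrow (P.vertex w) β) :
    ∃ (A : P.Letter) (h : w.1 ++ [A] ≠ [] ∧ (P.past (w.1 ++ [A])).Nonempty),
      β = P.vertex ⟨w.1 ++ [A], h⟩ := by
  obtain ⟨w₁, w₁', A, h1, h2, rfl⟩ := h
  obtain ⟨-, h3⟩ := past_congr h2
  obtain ⟨w₁', hw⟩ := w₁'
  simp only at h1
  subst h1
  exact ⟨A, ⟨by simp, (h3 A).1.2 hw.2⟩, ((h3 A).2 _ _).symm⟩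

theorem exists_word_of_transGen {w : P.Word} {β : P.Vertex}
    (h : Relation.TransGen P.Arrow (P.vertex w) β) :
    ∃ (l : List P.Letter) (h : w.1 ++ l ≠ [] ∧ (P.past (w.1 ++ l)).Nonempty),
      β = P.vertex ⟨w.1 ++ l, h⟩ := by
  induction h with
  | single h =>
    obtain ⟨A, hA, rfl⟩ := Arrow.exists_word h
    exact ⟨[A], hA, rfl⟩
  | tail _ h ih =>
    obtain ⟨l, hl, rfl⟩ := ih
    obtain ⟨A, hA, rfl⟩ := Arrow.exists_word h
    simp only [List.append_assoc] at hA ⊢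
    exact ⟨l ++ [A], hA, rfl⟩

/-- The word `A :: l`. -/
def Run.word (h : P.Run A t l C v) : P.Word :=
  ⟨A :: l, List.cons_ne_nil _ _, _, mem_past_cons.2 ⟨t, C, v, h, rfl⟩⟩

/-- The vertex of the word with the single letter `D`. -/
def base (P : BasicPartition hF) (D : P.Letter) : P.Vertex :=
  P.vertex (Run.nil (P.hi_mem_interval D)).word

/-- Returning to the vertex of the single letter D means exactly covering D, so cycles through this
vertex are the loops of D. -/
theorem vertex_word_eq_base_iff (h : P.Run A t l C v) :
    P.vertex h.word = P.base D ↔ P.Full A l D := by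
  constructor
  · intro he
    have h1 : P.past (A :: l) = P.past [D] := (past_congr he).1
    rw [past_eq_cell_iff.2 ⟨_, Run.nil (P.hi_mem_interval D)⟩] at h1
    exact past_eq_cell_iff.1 h1
  · intro hf
    obtain ⟨t', ht'⟩ := id hf
    obtain ⟨u, hu⟩ := exists_eq_append_singleton ht'
    refine Quot.sound ⟨u, [], [], D, ?_, rfl, ?_, ?_⟩
    · rw [List.append_nil]
      exact hu
    · rw [← hu]
      exact past_eq_cell_iff.2 hf
    · exact past_eq_cell_iff.2 ⟨_, Run.nil (P.hi_mem_interval D)⟩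

/-- The vertices on the loops of the vertex `D`. -/
def loopComponent (P : BasicPartition hF) (D : P.Letter) : Set P.Vertex :=
  {β | Relation.TransGen P.Arrow (P.base D) β ∧ Relation.TransGen P.Arrow β (P.base D)}

end LocallyConnected

end LiftedGraph.BasicPartition

namespace LiftedGraph.BasicPartition

variable {T : Type*} [MetricSpace T] [LocallyConnectedSpace T] {L : LiftedGraph T} {F : T → T}
  {hF : L.IsSunLike F} {P : BasicPartition hF} {A B C D : P.Letter} {t v : unitInterval}
  {l l' : List P.Letter}

theorem weight_vertex_word (h : P.Run A t l C v) :
    P.weight (P.vertex h.word) = P.p C.1 C.2 := by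
  obtain ⟨u, hu⟩ := exists_eq_append_singleton h
  have h1 : P.lastLetter (P.vertex h.word) = C := by
    rw [lastLetter_vertex]
    have : h.word.1 = u ++ [C] := hu
    simp only [this, List.getLast_append_singleton]
  rw [weight, h1]

theorem exists_run_of_transGen (h : P.Run A t l C v) {β : P.Vertex}
    (hβ : Relation.TransGen P.Arrow (P.vertex h.word) β) :
    ∃ (l' : List P.Letter) (t' : unitInterval) (B : P.Letter) (v' : unitInterval)
      (h' : P.Run A t' (l ++ l') B v'), β = P.vertex h'.word := by
  obtain ⟨l', hl', rfl⟩ := exists_word_of_transGen hβ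
  obtain ⟨y, hy⟩ := hl'.2
  obtain ⟨t', B, v', h', -⟩ := mem_past_cons.1 (show y ∈ P.past (A :: (l ++ l')) from hy)
  exact ⟨l', t', B, v', h', rfl⟩

theorem exists_run_of_arrow (h : P.Run A t l C v) {β : P.Vertex}
    (hβ : P.Arrow (P.vertex h.word) β) :
    ∃ (B : P.Letter) (t' v' : unitInterval) (h' : P.Run A t' (l ++ [B]) B v'),
      β = P.vertex h'.word := by
  obtain ⟨B, hB, rfl⟩ := Arrow.exists_word hβ
  obtain ⟨y, hy⟩ := hB.2
  obtain ⟨t', B', v', h', -⟩ := mem_past_cons.1 (show y ∈ P.past (A :: (l ++ [B])) from hy)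
  obtain rfl := h'.last_eq
  exact ⟨_, t', v', h', rfl⟩

theorem exists_full_of_transGen (h : P.Run A t l C v)
    (hD : Relation.TransGen P.Arrow (P.vertex h.word) (P.base D)) :
    ∃ l', P.Full A (l ++ l') D := by
  obtain ⟨l', t', B, v', h', he⟩ := exists_run_of_transGen h hD
  exact ⟨l', (vertex_word_eq_base_iff h').1 he.symm⟩

/-- The path of vertices along an infinite word that returns infinitely often to `D`. -/
theorem exists_path {s : ℕ → P.Letter} {Q : ℕ → ℕ} (h0 : s 0 = D) (hQ : ∀ k, k ≤ Q k)
    (hs : ∀ k, s (Q k) = D ∧ P.Full D (seg s 0 (Q k)) D) :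
    ∃ α ∈ P.paths (P.loopComponent D), α 0 = P.base D ∧ ∀ n, P.weight (α n) = P.p (s n).1 (s n).2 := by
  have hrun : ∀ n, ∃ t v, P.Run D t (seg s 0 n) (s n) v := by
    intro n
    obtain ⟨-, t, hr⟩ := hs n
    obtain ⟨k, hk⟩ := Nat.exists_eq_add_of_le (hQ n)
    rw [hk, seg_add] at hr
    obtain ⟨C, v, h1, -⟩ := hr.exists_of_append
    cases n with
    | zero =>
      cases h1
      exact ⟨t, t, by rw [h0]; exact .nil ‹_›⟩
    | succ n =>
      have h2 := h1
      rw [seg_succ, zero_add] at h2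
      rw [← h2.last_eq]
      exact ⟨t, v, h1⟩
  choose t v hr using hrun
  set α : ℕ → P.Vertex := fun n => P.vertex (hr n).word with hα
  have harrow : ∀ n, P.Arrow (α n) (α (n + 1)) := by
    intro n
    refine ⟨(hr n).word, (hr (n + 1)).word, s (n + 1), ?_, rfl, rfl⟩
    show D :: seg s 0 (n + 1) = (D :: seg s 0 n) ++ [s (n + 1)]
    rw [seg_succ, zero_add]
    rfl
  have htrans : ∀ m k, Relation.TransGen P.Arrow (α m) (α (m + (k + 1))) := by
    intro m k
    induction k with
    | zero => exact .single (harrow m)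
    | succ k ih => exact ih.tail (harrow _)
  have hbase : ∀ k, α (Q k) = P.base D := fun k => by
    rw [hα]
    exact (vertex_word_eq_base_iff (hr (Q k))).2 (hs k).2
  have hα0 : α 0 = P.base D :=
    (vertex_word_eq_base_iff (hr 0)).2 ⟨_, .nil (P.hi_mem_interval D)⟩
  refine ⟨α, fun n => ⟨?_, harrow n⟩, hα0, fun n => weight_vertex_word (hr n)⟩
  have hto : ∀ n, Relation.TransGen P.Arrow (α n) (P.base D) := by
    intro n
    obtain ⟨k, hk⟩ := Nat.exists_eq_add_of_le (hQ (n + 1))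
    rw [← hbase (n + 1), hk, show n + 1 + k = n + (k + 1) by ring]
    exact htrans n k
  refine ⟨?_, hto n⟩
  cases n with
  | zero => rw [hα0]; have := hto 0; rwa [hα0] at this
  | succ n => rw [← hα0, ← zero_add (n + 1)]; exact htrans 0 n

theorem loopRot_subset_RotPaths : P.loopRot D ⊆ P.RotPaths (P.loopComponent D) := by
  intro ρ hρ
  obtain ⟨s, Q, h0, hQ, hs, hlim⟩ := exists_seq_of_mem_loopRot hρ
  obtain ⟨α, hα, -, hw⟩ := exists_path h0 hQ hs
  obtain ⟨M, -, hM⟩ := P.exists_abs_wtSum_le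
  refine ⟨α, hα, ?_⟩
  refine (hlim (fun n => P.wtSum s n) M 0 (fun m => ?_) (fun n => by simp)).congr fun n => ?_
  · simpa using hM s m 1
  · simp only [wtSum, hw]

/-- A loop of D gives a cycle through its base vertex, and the vertices joined to that vertex in
both directions form a component. -/
theorem isComponent_loopComponent (h : (P.loops D).Nonempty) :
    P.IsComponent (P.loopComponent D) := by
  obtain ⟨x, hx⟩ := h
  have hρ : (x.2 : ℝ) / x.1 ∈ P.loopRot D := subset_closure ⟨x, hx, rfl⟩
  obtain ⟨s, Q, h0, hQ, hs, -⟩ := exists_seq_of_mem_loopRot hρ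
  obtain ⟨α, hα, hα0, -⟩ := exists_path h0 hQ hs
  have := (hα 0).1.1
  rw [hα0] at this
  exact maximal_stronglyConnected this

/-- If every initial segment of an infinite word can be continued to a loop of `D`, then
infinitely many of them can be continued by words of bounded length. -/
theorem exists_bounded_return {s : ℕ → P.Letter} {N : ℕ}
    (hrun : ∀ n, N ≤ n → ∃ t v, P.Run D t (seg s 0 n) (s n) v)
    (hret : ∀ n, N ≤ n → ∃ l, P.Full D (seg s 0 n ++ l) D) :
    ∃ K, ∀ n, N ≤ n → ∃ n' ≥ n, ∃ l, l.length ≤ K ∧ P.Full D (seg s 0 n' ++ l) D := by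
  have := P.finite_letter
  -- One return word is fixed for each letter that admits one. The graph may have infinitely many
  -- vertices, but fully covered letters are finite in number, so these return words have bounded
  -- length.
  obtain ⟨f, hf⟩ : ∃ f : P.Letter → List P.Letter, ∀ B, (∃ l, P.Full B l D) → P.Full B (f B) D :=
    ⟨fun B => Classical.epsilon fun l => P.Full B l D, fun B h => Classical.epsilon_spec h⟩
  obtain ⟨K, hK⟩ := (finite_range fun B => (f B).length).bddAbove
  have hK' : ∀ B, (f B).length ≤ K := fun B => hK ⟨B, rfl⟩
  suffices h : ∀ l n, N ≤ n → P.Full D (seg s 0 n ++ l) D →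
      ∃ n' ≥ n, ∃ l', l'.length ≤ K + 1 ∧ P.Full D (seg s 0 n' ++ l') D by
    refine ⟨K + 1, fun n hn => ?_⟩
    obtain ⟨l, hl⟩ := hret n hn
    exact h l n hn hl
  intro l
  induction l with
  | nil => exact fun n _ h => ⟨n, le_rfl, [], Nat.zero_le _, h⟩
  | cons B l ih =>
    intro n hn h
    rw [← List.singleton_append, ← List.append_assoc] at h
    obtain ⟨t, ht⟩ := id h
    obtain ⟨B', v, h1, -⟩ := ht.exists_of_append
    obtain rfl := h1.last_eq
    -- If the first letter of the return word, or the next letter of the sequence, is fully covered,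
    -- a fixed return word can be used from there. If neither is, the two letters coincide, so one
    -- can advance along the sequence with a shorter return word.
    by_cases hB : P.Full D (seg s 0 n ++ [B']) B'
    · refine ⟨n, le_rfl, [B'] ++ f B', ?_, ?_⟩
      · rw [List.length_append, List.length_singleton]
        have := hK' B'
        omega
      · rw [← List.append_assoc]
        exact hB.append (hf B' ⟨l, h.of_append h1⟩)
    obtain ⟨t', v', h2⟩ := hrun (n + 1) (by omega)
    have hseg : seg s 0 (n + 1) = seg s 0 n ++ [s (n + 1)] := by rw [seg_succ, zero_add]
    by_cases hs : P.Full D (seg s 0 (n + 1)) (s (n + 1))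
    · obtain ⟨l'', hl''⟩ := hret (n + 1) (by omega)
      refine ⟨n + 1, Nat.le_succ n, f (s (n + 1)), (hK' _).trans (Nat.le_succ K), ?_⟩
      exact hs.append (hf _ ⟨l'', hl''.of_append h2⟩)
    · rw [hseg] at h2 hs
      obtain rfl := eq_of_not_full h1 h2 hB hs
      rw [← hseg] at h
      obtain ⟨n', hn', h'⟩ := ih (n + 1) (by omega) h
      exact ⟨n', by omega, h'⟩

/-- A path in the component is read as an infinite word issuing from D. Infinitely many of its
initial segments close up to loops of D by words of bounded length, which do not affect the slope.
-/
theorem RotPaths_subset_loopRot : P.RotPaths (P.loopComponent D) ⊆ P.loopRot D := by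
  rintro ρ ⟨α, hα, hρ⟩
  obtain ⟨l₀, t₀, C₀, v₀, h₀, he₀⟩ :=
    exists_run_of_transGen (.nil (P.hi_mem_interval D)) (hα 0).1.1
  rw [List.nil_append] at h₀
  let S : List P.Letter → ℕ → Prop := fun l n =>
    ∃ (t : unitInterval) (C : P.Letter) (v : unitInterval) (h : P.Run D t l C v),
      α n = P.vertex h.word
  have hstep : ∀ n l, S l n → ∃ B, S (l ++ [B]) (n + 1) := by
    rintro n l ⟨t, C, v, h, he⟩
    have := (hα n).2
    rw [he] at this
    obtain ⟨B, t', v', h', he'⟩ := exists_run_of_arrow h this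
    exact ⟨B, t', B, v', h', he'⟩
  have : Nonempty P.Letter := ⟨D⟩
  choose! f hf using hstep
  set Λ : ℕ → List P.Letter := fun n => Nat.rec l₀ (fun n l => l ++ [f n l]) n with hΛ
  have hΛs : ∀ n, Λ (n + 1) = Λ n ++ [f n (Λ n)] := fun n => rfl
  have hS : ∀ n, S (Λ n) n := by
    intro n
    induction n with
    | zero => exact ⟨t₀, C₀, v₀, h₀, he₀⟩
    | succ n ih => exact hf n _ ih
  have hlen : ∀ n, (Λ n).length = l₀.length + n := by
    intro n
    induction n with
    | zero => rfl
    | succ n ih => rw [hΛs, List.length_append, ih]; rfl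
  obtain ⟨s, hs0, hs⟩ := exists_seq_of_prefix (fun n => ⟨_, (hΛs n).symm⟩)
    (fun n => by rw [hlen]; omega) D
  have hs' : ∀ n, seg s 0 (l₀.length + n) = Λ n := fun n => by rw [← hlen, hs]
  have hlast : ∀ n t C v, P.Run D t (seg s 0 n) C v → C = s n := by
    intro n t C v h
    cases n with
    | zero => cases h; exact hs0.symm
    | succ n =>
      rw [seg_succ, zero_add] at h
      exact h.last_eq
  have hw : ∀ n, P.weight (α n) = P.p (s (l₀.length + n)).1 (s (l₀.length + n)).2 := by
    intro n
    obtain ⟨t, C, v, h, he⟩ := hS n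
    rw [he, weight_vertex_word, hlast _ _ _ _ (show P.Run D t (seg s 0 _) C v from (hs' n).symm ▸ h)]
  obtain ⟨K, hK⟩ := exists_bounded_return (D := D) (s := s) (N := l₀.length) (fun n hn => by
    obtain ⟨k, rfl⟩ := Nat.exists_eq_add_of_le hn
    obtain ⟨t, C, v, h, -⟩ := hS k
    rw [← hs'] at h
    have := hlast _ _ _ _ h
    exact ⟨t, v, this ▸ h⟩) (fun n hn => by
    obtain ⟨k, rfl⟩ := Nat.exists_eq_add_of_le hn
    obtain ⟨t, C, v, h, he⟩ := hS k
    have := (hα k).1.2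
    rw [he] at this
    rw [hs']
    exact exists_full_of_transGen h this)
  obtain ⟨M, hM0, hM⟩ := P.abs_wt_le
  have hρ' : Tendsto (fun n : ℕ => (P.wtSum (fun j => s (l₀.length + j)) n : ℝ) / n) atTop (𝓝 ρ) :=
    hρ.congr fun n => by simp only [wtSum, hw]
  -- Both constants account for the word l₀ leading from D to the start of the path and for the
  -- return word.
  refine mem_closure_means_of_frequently (K := l₀.length + K)
    (K' := |(P.wtSum s l₀.length : ℝ)| + K * M) hρ' (frequently_atTop.2 fun a => ?_)
  obtain ⟨n', hn', l, hlK, hfull⟩ := hK (l₀.length + (a + 1)) (by omega)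
  obtain ⟨n, rfl⟩ := Nat.exists_eq_add_of_le (show l₀.length ≤ n' by omega)
  obtain ⟨t, ht⟩ := id hfull
  obtain ⟨C, v, hr, -⟩ := ht.exists_of_append
  refine ⟨n, by omega, _, ⟨seg s 0 (l₀.length + n) ++ l, ?_, hfull, rfl⟩, ?_, ?_, ?_⟩
  · rw [← List.length_pos_iff, List.length_append, length_seg]
    omega
  · simp only [List.length_append, length_seg]
    omega
  · simp only [List.length_append, length_seg]
    omega
  · have h1 : P.wt D (seg s 0 (l₀.length + n)) = P.wtSum s (l₀.length + n) := by
      rw [← wt_seg, hs0]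
    simp only
    rw [hr.wt_append, h1, wtSum_add]
    push_cast
    have h2 := hM C l
    have h3 : (l.length : ℝ) * M ≤ K * M :=
      mul_le_mul_of_nonneg_right (by exact_mod_cast hlK) hM0
    have h4 := abs_add_le (P.wtSum s l₀.length : ℝ) (P.wt C l)
    rw [show ∀ a b c : ℝ, a + b + c - b = a + c from fun a b c => by ring]
    linarith

/-- The rotation set of the component of a letter `D` is the closure of the means of its loops. -/
theorem RotPaths_loopComponent : P.RotPaths (P.loopComponent D) = P.loopRot D :=
  subset_antisymm RotPaths_subset_loopRot loopRot_subset_RotPaths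

end LiftedGraph.BasicPartition

/-! ### The rotation set and the exceptional set -/

/-- A finite union of preconnected sets has finitely many connected components. -/
theorem finite_connectedComponents_sUnion {X : Type*} [TopologicalSpace X] {𝒜 : Set (Set X)}
    (hfin : 𝒜.Finite) (h : ∀ A ∈ 𝒜, IsPreconnected A) : Finite (ConnectedComponents (⋃₀ 𝒜)) := by
  have : Finite {A // A ∈ 𝒜 ∧ A.Nonempty} := (hfin.subset (sep_subset _ _)).to_subtype
  let f : {A // A ∈ 𝒜 ∧ A.Nonempty} → ConnectedComponents (⋃₀ 𝒜) := fun A =>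
    ((⟨A.2.2.some, A.1, A.2.1, A.2.2.some_mem⟩ : ⋃₀ 𝒜) : ConnectedComponents (⋃₀ 𝒜))
  refine Finite.of_surjective f fun c => ?_
  obtain ⟨⟨x, A, hA, hx⟩, rfl⟩ := ConnectedComponents.surjective_coe c
  refine ⟨⟨A, hA, x, hx⟩, ConnectedComponents.coe_eq_coe.2 ?_⟩
  have hpre : IsPreconnected (Subtype.val ⁻¹' A : Set (⋃₀ 𝒜)) := by
    rw [← IsInducing.subtypeVal.isPreconnected_image, Subtype.image_preimage_coe,
      inter_eq_right.2 (subset_sUnion_of_mem hA)]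
    exact h A hA
  have hne : A.Nonempty := ⟨x, hx⟩
  exact connectedComponent_eq (hpre.subset_connectedComponent
    (show (⟨hne.some, A, hA, hne.some_mem⟩ : ⋃₀ 𝒜) ∈ _ from hne.some_mem) hx)

theorem IsLeast.mem_frontier_real {S : Set ℝ} {a : ℝ} (h : IsLeast S a) : a ∈ frontier S := by
  refine ⟨subset_closure h.1, fun hi => ?_⟩
  have := interior_mono (show S ⊆ Ici a from h.2) hi
  rw [interior_Ici] at this
  exact lt_irrefl a this

theorem IsGreatest.mem_frontier_real {S : Set ℝ} {a : ℝ} (h : IsGreatest S a) :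
    a ∈ frontier S := by
  refine ⟨subset_closure h.1, fun hi => ?_⟩
  have := interior_mono (show S ⊆ Iic a from h.2) hi
  rw [interior_Iic] at this
  exact lt_irrefl a this

namespace LiftedGraph

variable {T : Type*} [MetricSpace T] {L : LiftedGraph T} {F : T → T}

theorem IsDegreeOne.hasRotationNumber_tau_zpow (hF : L.IsDegreeOne F) {x : T} {ρ : ℝ} (m : ℤ) :
    L.HasRotationNumber F ((L.τ ^ m) x) ρ ↔ L.HasRotationNumber F x ρ := by
  have h : (fun n : ℕ => (L.retr (F^[n] ((L.τ ^ m) x)) - L.retr ((L.τ ^ m) x)) / (n : ℝ)) =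
      fun n : ℕ => (L.retr (F^[n] x) - L.retr x) / (n : ℝ) := by
    funext n
    rw [(hF.iterate n).map_tau_zpow, retr_tau_zpow, retr_tau_zpow, add_sub_add_right_eq_sub]
  rw [HasRotationNumber, h, HasRotationNumber]

namespace BasicPartition

theorem finite_rotFamily {hF : L.IsSunLike F} (P : BasicPartition hF) :
    ({L.rotLine F} ∪ (range P.loopRot ∪ range P.chainRot) : Set (Set ℝ)).Finite := by
  have := P.finite_letter
  exact (finite_singleton _).union ((finite_range _).union (finite_range _))

end BasicPartition

section LocallyConnected

variable [LocallyConnectedSpace T]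

theorem IsDegreeOne.hasRotationNumber_iterate (hF : L.IsDegreeOne F) {x : T} {ρ : ℝ}
    (h : L.HasRotationNumber F x ρ) (n : ℕ) : L.HasRotationNumber F (F^[n] x) ρ := by
  obtain ⟨M, -, hM⟩ := hF.exists_bound
  refine tendsto_div_of_abs_sub_le (C := n * M + n * M) (fun k => ?_) h
  rw [← Function.iterate_add_apply, add_comm k n, Function.iterate_add_apply]
  have h1 := IsDegreeOne.abs_iterate_le hM n (F^[k] x)
  have h2 := IsDegreeOne.abs_iterate_le hM n x
  rw [abs_le] at h1 h2 ⊢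
  constructor <;> linarith [h1.1, h1.2, h2.1, h2.2]

namespace BasicPartition

variable {hF : L.IsSunLike F}

theorem isCompact_loopRot (P : BasicPartition hF) (D : P.Letter) : IsCompact (P.loopRot D) := by
  obtain ⟨M, hM⟩ := hF.toIsDegreeOne.exists_rotation_bound
  refine (isCompact_Icc (a := -M) (b := M)).of_isClosed_subset isClosed_closure fun ρ hρ => ?_
  obtain ⟨x, hx⟩ := loopRot_subset_Rot hρ
  exact hM x ρ hx

/-- In the chain alternative a periodic point comes along, so these rotation numbers contribute
nothing to the exceptional set. -/
theorem rot_cases (P : BasicPartition hF) {x : T} {ρ : ℝ} (h : L.HasRotationNumber F x ρ) :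
    (∃ y ∈ L.TR F, L.HasRotationNumber F y ρ) ∨ (∃ D, ρ ∈ P.loopRot D) ∨
      (∃ D, ρ ∈ P.chainRot D) ∧ ∃ z, L.IsPeriodicModOne F z ∧ L.HasRotationNumber F z ρ := by
  by_cases hx : ∃ n, F^[n] x ∈ interior (L.TR F)
  · obtain ⟨n, hn⟩ := hx
    exact Or.inl ⟨_, interior_subset hn, hF.toIsDegreeOne.hasRotationNumber_iterate h n⟩
  push Not at hx
  obtain ⟨m, s, t, ho, rfl⟩ := P.exists_isOrbit_of_notMem hx
  have hρ := ho.hasRotationNumber_iff.1 ((hF.toIsDegreeOne.hasRotationNumber_tau_zpow m).1 h)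
  rcases ho.cases hρ with h1 | ⟨n, k, hk, hchain, hper⟩
  · exact Or.inr (Or.inl h1)
  · have hρ' := tendsto_wtSum_shift hρ n
    exact Or.inr (Or.inr ⟨⟨_, _, _, rfl, ho.shift n, hchain, hρ'⟩,
      (ho.shift n).exists_periodic hρ' hk hper⟩)

/-- The rotation set is a finite union of compact intervals. -/
theorem Rot_eq_sUnion (P : BasicPartition hF) :
    L.Rot F = ⋃₀ ({L.rotLine F} ∪ (range P.loopRot ∪ range P.chainRot)) := by
  apply subset_antisymm
  · rintro ρ ⟨x, hx⟩
    rcases P.rot_cases hx with ⟨y, hy, hρ⟩ | ⟨D, hD⟩ | ⟨⟨D, hD⟩, -⟩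
    · exact ⟨_, Or.inl rfl, hF.toIsDegreeOne.mem_rotLine hy hρ⟩
    · exact ⟨_, Or.inr (Or.inl ⟨D, rfl⟩), hD⟩
    · exact ⟨_, Or.inr (Or.inr ⟨D, rfl⟩), hD⟩
  · rintro ρ ⟨_, rfl | ⟨D, rfl⟩ | ⟨D, rfl⟩, hρ⟩
    · obtain ⟨y, hy⟩ := hρ
      exact ⟨_, hy⟩
    · exact loopRot_subset_Rot hρ
    · exact chainRot_subset_Rot hρ

theorem isCompact_Rot (P : BasicPartition hF) : IsCompact (L.Rot F) := by
  rw [P.Rot_eq_sUnion]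
  refine P.finite_rotFamily.isCompact_sUnion ?_
  rintro _ (rfl | ⟨D, rfl⟩ | ⟨D, rfl⟩)
  · obtain ⟨M, hM⟩ := hF.toIsDegreeOne.exists_rotation_bound
    refine (isCompact_Icc (a := -M) (b := M)).of_isClosed_subset
      hF.toIsDegreeOne.isClosed_rotLine ?_
    rintro ρ ⟨y, hy⟩
    exact hM _ ρ hy
  · exact P.isCompact_loopRot D
  · exact subsingleton_chainRot.isCompact

theorem finite_components_Rot (P : BasicPartition hF) : Finite (ConnectedComponents (L.Rot F)) := by
  rw [P.Rot_eq_sUnion]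
  refine finite_connectedComponents_sUnion P.finite_rotFamily ?_
  rintro _ (rfl | ⟨D, rfl⟩ | ⟨D, rfl⟩)
  · exact hF.toIsDegreeOne.ordConnected_rotLine.isPreconnected
  · exact ordConnected_loopRot.isPreconnected
  · exact subsingleton_chainRot.isPreconnected

/-- A point of the interval other than its endpoints lies strictly between two actual means, so a
rational one is itself the mean of a loop. -/
theorem exists_periodic_of_mem_loopRot {P : BasicPartition hF} {D : P.Letter} {r : ℚ}
    (hr : (r : ℝ) ∈ P.loopRot D) (h1 : (r : ℝ) ≠ sInf (P.loopRot D))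
    (h2 : (r : ℝ) ≠ sSup (P.loopRot D)) :
    ∃ z, L.IsPeriodicModOne F z ∧ L.HasRotationNumber F z r := by
  have hc := P.isCompact_loopRot D
  have hlt := lt_of_le_of_ne (csInf_le hc.bddBelow hr) h1.symm
  have hgt := lt_of_le_of_ne (le_csSup hc.bddAbove hr) h2
  obtain ⟨a, ha, har⟩ := exists_lt_of_csInf_lt ⟨_, hr⟩ hlt
  obtain ⟨b, hb, hrb⟩ := exists_lt_of_lt_csSup ⟨_, hr⟩ hgt
  obtain ⟨x, hxr, hx⟩ := mem_closure_iff.1 ha _ isOpen_Iio har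
  obtain ⟨y, hry, hy⟩ := mem_closure_iff.1 hb _ isOpen_Ioi hrb
  exact exists_periodic_of_mem_means (rat_mem_means loops_add loops_pos hx hy hxr hry)

/-- All rational rotation numbers, up to the endpoints of the rotation sets of the components of the
covering graph, are rotation numbers of periodic points. -/
theorem exists_exceptional_set [ConnectedSpace T] (P : BasicPartition hF) : ∃ E : Finset ℝ,
    E.card ≤ 2 * Nat.card P.Letter ∧
      (E : Set ℝ) ⊆ ⋃ C ∈ {C : Set P.Vertex | P.IsComponent C}, frontier (P.RotPaths C) ∧
      ∀ r : ℚ, (r : ℝ) ∈ L.Rot F → (r : ℝ) ∉ E →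
        ∃ x : T, L.IsPeriodicModOne F x ∧ L.HasRotationNumber F x r := by
  classical
  have := P.finite_letter
  have := Fintype.ofFinite P.Letter
  set S : Finset P.Letter := Finset.univ.filter fun D => (P.loops D).Nonempty with hS
  -- The endpoints of the intervals `loopRot D`. Letters without loops are left out: their set is
  -- empty, and the default value 0 of `sInf` and `sSup` need not be a boundary point.
  refine ⟨S.image (fun D => sInf (P.loopRot D)) ∪ S.image (fun D => sSup (P.loopRot D)), ?_, ?_, ?_⟩
  · have hcard : S.card ≤ Nat.card P.Letter := by
      rw [Nat.card_eq_fintype_card]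
      exact Finset.card_le_univ S
    refine (Finset.card_union_le _ _).trans ?_
    have h1 := Finset.card_image_le (s := S) (f := fun D => sInf (P.loopRot D))
    have h2 := Finset.card_image_le (s := S) (f := fun D => sSup (P.loopRot D))
    omega
  · intro a ha
    obtain ⟨D, hD, had⟩ : ∃ D, (P.loops D).Nonempty ∧ a ∈ frontier (P.loopRot D) := by
      simp only [Finset.coe_union, Finset.coe_image, mem_union, mem_image, Finset.mem_coe, hS,
        Finset.mem_filter, Finset.mem_univ, true_and] at ha
      rcases ha with ⟨D, hD, rfl⟩ | ⟨D, hD, rfl⟩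
      · exact ⟨D, hD, ((P.isCompact_loopRot D).isLeast_sInf (nonempty_loopRot hD)).mem_frontier_real⟩
      · exact ⟨D, hD,
          ((P.isCompact_loopRot D).isGreatest_sSup (nonempty_loopRot hD)).mem_frontier_real⟩
    refine mem_iUnion₂.2 ⟨P.loopComponent D, isComponent_loopComponent hD, ?_⟩
    rwa [RotPaths_loopComponent]
  · rintro r ⟨x, hx⟩ hr
    rcases P.rot_cases hx with ⟨y, hy, hρ⟩ | ⟨D, hD⟩ | ⟨-, h⟩
    · exact hF.toIsDegreeOne.exists_periodicModOne hy hρ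
    · have hDS : D ∈ S := by simpa [hS] using nonempty_loops ⟨_, hD⟩
      rw [Finset.mem_union, not_or] at hr
      refine exists_periodic_of_mem_loopRot hD (fun h => hr.1 ?_) (fun h => hr.2 ?_)
      · exact Finset.mem_image.2 ⟨D, hDS, h.symm⟩
      · exact Finset.mem_image.2 ⟨D, hDS, h.symm⟩
    · exact h

end BasicPartition

end LocallyConnected

end LiftedGraph

theorem mainTheorem1 {T : Type*} [MetricSpace T] [ConnectedSpace T] [LocallyConnectedSpace T]
    (L : LiftedGraph T) (F : T → T) (hF : L.IsSunLike F) :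
    (L.Rot F).Nonempty ∧ IsCompact (L.Rot F) ∧ Finite (ConnectedComponents (L.Rot F)) ∧
    Nonempty (LiftedGraph.BasicPartition hF) ∧
    ∀ P : LiftedGraph.BasicPartition hF, ∃ E : Finset ℝ,
      E.card ≤ 2 * Nat.card P.Letter ∧
      (E : Set ℝ) ⊆ ⋃ C ∈ {C : Set P.Vertex | P.IsComponent C}, frontier (P.RotPaths C) ∧
      ∀ r : ℚ, (r : ℝ) ∈ L.Rot F → (r : ℝ) ∉ E →
        ∃ x : T, L.IsPeriodicModOne F x ∧ L.HasRotationNumber F x r := by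
  obtain ⟨P⟩ := hF.nonempty_basicPartition
  obtain ⟨ρ, y, hy⟩ := hF.toIsDegreeOne.rotLine_nonempty
  exact ⟨⟨ρ, _, hy⟩, P.isCompact_Rot, P.finite_components_Rot, ⟨P⟩,
    fun P => P.exists_exceptional_set⟩
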